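/- **Notation.** For $k\in\mathbb R$ let $(M_k^2,|\cdot|_k)$ be the model plane of constant curvature $k$: the Euclidean plane if $k=0$, the unit sphere $\mathbb S^2$ with its angular distance multiplied by $1/\sqrt k$ if $k>0$, and the hyperbolic plane $\mathbb H^2$ with its distance multiplied by $1/\sqrt{-k}$ if $k<0$. Let $D_k=\pi/\sqrt k$ for $k>0$ and $D_k=\infty$ for $k\le 0$. A geodesic metric space $(X,d)$ is *CAT(k)* if for every geodesic triangle $ABC$ in $X$ of perimeter less than $2D_k$, every comparison triangle $A'B'C'$ in $M_k^2$ with the same side lengths, every point $D$ of the side $BC$ and the corresponding point $D'$ of $B'C'$ (that is, $|B'D'|_k=d(B,D)$ and $|C'D'|_k=d(C,D)$) one has $d(A,D)\le |A'D'|_k$. For $a,b,c>0$ satisfying the triangle inequalities and $k\le \left(\frac{2\pi}{a+b+c}\right)^2$ let $$S(a,b,c,k)=\min_{P\in\Delta ABC}\bigl(|PA|_k+|PB|_k+|PC|_k\bigr),$$ where $\Delta ABC$ is a (solid) triangle in $M_k^2$ with side lengths $a,b,c$; put $S(a,b,c,-\infty)=\lim_{k\to-\infty}S(a,b,c,k)$.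 The function $\Lambda(a,b,c)$ is symmetric, and for $0<a\le b\le c\le a+b$ it is given as follows. If $c^2=a^2+b^2+ab$, then $\Lambda=0$. If $c^2<a^2+b^2+ab$, then $\Lambda$ is the number $\lambda\in\left(0,\left(\frac{2\pi}{a+b+c}\right)^2\right]$ with $\cos(c\sqrt\lambda)=\cos(a\sqrt\lambda)\cos(b\sqrt\lambda)-\frac12\sin(a\sqrt\lambda)\sin(b\sqrt\lambda)$. If $a^2+b^2+ab<c^2<(a+b)^2$, then $\Lambda$ is the number $\lambda<0$ with $\cosh(c\sqrt{-\lambda})=\cosh(a\sqrt{-\lambda})\cosh(b\sqrt{-\lambda})+\frac12\sinh(a\sqrt{-\lambda})\sinh(b\sqrt{-\lambda})$. If $c=a+b$, then $\Lambda=-\infty$. A *metric triple* in a metric space $(X,d)$ is a set $T=\{A,B,C\}$ of three distinct points. Put $a=d(B,C)$, $b=d(A,C)$, $c=d(A,B)$ and $g_X(T)=\inf_{x\in X}\bigl(d(A,x)+d(B,x)+d(C,x)\bigr)$. The *curvature* $k_X(T)$ is the number $\kappa\in[-\infty,\Lambda(a,b,c)]$ with $g_X(T)=S(a,b,c,\kappa)$.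 Finally let $H_k=\frac{\pi}{2\sqrt k}$ for $k>0$, $H_0=\infty$, and $H_k=\frac{1.3877}{\sqrt{-k}}$ for $k<0$. **Theorem.** Let $k\in\mathbb R$, let $(X,d)$ be a CAT(k) space, and let $T=\{A,B,C\}$ be a metric triple in $X$ with $\max\{d(A,B),d(A,C),d(B,C)\}\le H_k$. Then the curvature $k_X(T)$ is well defined (there is exactly one such $\kappa$), and $k_X(T)\le k$. -/

import Mathlib

noncomputable section

namespace TripleCurv

/-- A type together with a distance function; used only to package the concrete model planes. -/
structure Plane where
  carrier : Type
  d : carrier → carrier → ℝ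

/-- The model plane `M_k^2` of constant curvature `k`: the Euclidean plane for `k = 0`, the unit
sphere in `ℝ³` with its angular distance multiplied by `1 / √k` for `k > 0`, and the hyperbolic
plane with its distance multiplied by `1 / √(-k)` for `k < 0`. -/
def modelPlane (k : ℝ) : Plane :=
  if k = 0 then
    { carrier := EuclideanSpace ℝ (Fin 2)
      d := fun x y => dist x y }
  else if 0 < k then
    { carrier := Metric.sphere (0 : EuclideanSpace ℝ (Fin 3)) 1
      d := fun x y => InnerProductGeometry.angle
        (x : EuclideanSpace ℝ (Fin 3)) (y : EuclideanSpace ℝ (Fin 3)) / √k }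
  else
    { carrier := UpperHalfPlane
      d := fun x y => dist x y / √(-k) }

/-- The diameter `D_k` of the model plane. -/
def modelDiam (k : ℝ) : EReal :=
  if 0 < k then ((Real.pi / √k : ℝ) : EReal) else ⊤

/-- `Q` lies on a shortest path from `P` to `R`. -/
def Plane.Between (M : Plane) (P Q R : M.carrier) : Prop :=
  M.d P Q + M.d Q R = M.d P R

/-- `A, B, C` are the vertices of a triangle with `|BC| = a`, `|AC| = b`, `|AB| = c`. -/
def Plane.IsTriangle (M : Plane) (a b c : ℝ) (A B C : M.carrier) : Prop :=
  M.d B C = a ∧ M.d A C = b ∧ M.d A B = c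

/-- The solid triangle `ABC`: the union of the segments from `A` to the points of the
side `BC`. -/
def Plane.solidTriangle (M : Plane) (A B C : M.carrier) : Set M.carrier :=
  {P | ∃ D, M.Between B D C ∧ M.Between A P D}

/-- `S(a,b,c,k)`: the minimum of `|PA| + |PB| + |PC|` over the points `P` of a triangle `ABC` in
`M_k^2` with side lengths `a, b, c`. It is meaningful for `a + b + c ≤ 2 D_k`, where such triangles
exist; they are all congruent, so that the infimum may be taken over all of them. -/
def steiner (a b c k : ℝ) : ℝ :=
  sInf {s : ℝ | ∃ A B C P : (modelPlane k).carrier,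
    (modelPlane k).IsTriangle a b c A B C ∧
    P ∈ (modelPlane k).solidTriangle A B C ∧
    s = (modelPlane k).d P A + (modelPlane k).d P B + (modelPlane k).d P C}

/-- `Λ(a,b,c)` for `0 < a ≤ b ≤ c ≤ a + b`: the curvature `k` for which the triangle in `M_k^2`
with sides `a, b, c` has angle `2π/3` opposite to `c`. The sets below contain exactly
one number if `c < a + b`; in the degenerate case `c = a + b` there is no solution (the angle is
`π` for every `k`) and the value is `-∞`, the limit of `Λ(a,b,c)` as `c` increases to `a + b`. -/
def lambdaOrdered (a b c : ℝ) : EReal :=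
  if c ^ 2 = a ^ 2 + b ^ 2 + a * b then 0
  else if c ^ 2 < a ^ 2 + b ^ 2 + a * b then
    sSup (Real.toEReal '' {k : ℝ | 0 < k ∧ k ≤ (2 * Real.pi / (a + b + c)) ^ 2 ∧
      Real.cos (c * √k) = Real.cos (a * √k) * Real.cos (b * √k)
        - 1 / 2 * (Real.sin (a * √k) * Real.sin (b * √k))})
  else
    sSup (Real.toEReal '' {k : ℝ | k < 0 ∧
      Real.cosh (c * √(-k)) = Real.cosh (a * √(-k)) * Real.cosh (b * √(-k))
        + 1 / 2 * (Real.sinh (a * √(-k)) * Real.sinh (b * √(-k)))})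

/-- `Λ` as a symmetric function: the arguments are put in increasing order first. -/
def lambda (a b c : ℝ) : EReal :=
  lambdaOrdered (min a (min b c))
    (a + b + c - min a (min b c) - max a (max b c)) (max a (max b c))

section MetricSpaces

variable {X : Type*} [MetricSpace X]

/-- `g_X(T)` for the triple `T = {A, B, C}`. -/
def g (A B C : X) : ℝ := ⨅ x : X, (dist A x + dist B x + dist C x)

/-- `κ ∈ [-∞, Λ]` is the curvature `k_X(T)` of the triple `T = {A, B, C}`, that is,
`g_X(T) = S(a,b,c,κ)` for the side lengths `a, b, c` of `T`, where `S(a,b,c,-∞)` is the limit of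
`S(a,b,c,r)` as `r → -∞`. -/
def IsTripleCurvature (A B C : X) (κ : EReal) : Prop :=
  κ ≤ lambda (dist B C) (dist A C) (dist A B) ∧
  ((∃ r : ℝ, κ = (r : EReal) ∧ g A B C = steiner (dist B C) (dist A C) (dist A B) r) ∨
   (κ = ⊥ ∧ Filter.Tendsto (fun r : ℝ => steiner (dist B C) (dist A C) (dist A B) r)
      Filter.atBot (nhds (g A B C))))

/-- `γ`, restricted to `[0, d(x,y)]`, is a geodesic from `x` to `y` parametrized by arc length. -/
def IsGeodesic (γ : ℝ → X) (x y : X) : Prop :=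
  γ 0 = x ∧ γ (dist x y) = y ∧
  ∀ s ∈ Set.Icc 0 (dist x y), ∀ t ∈ Set.Icc 0 (dist x y), dist (γ s) (γ t) = |s - t|

end MetricSpaces

/-- `X` is a `CAT(k)` space: a geodesic metric space in which every geodesic triangle `ABC` of
perimeter less than `2 D_k` satisfies the `CAT(k)` inequality `d(A,D) ≤ |A'D'|_k` for every point
`D = γ t` of the side `BC`, parametrized by `γ`, and the corresponding point `D'` in a comparison
triangle `A'B'C'`. -/
structure IsCAT (X : Type*) [MetricSpace X] (k : ℝ) : Prop where
  geodesic : ∀ x y : X, ∃ γ : ℝ → X, IsGeodesic γ x y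
  comparison : ∀ (A B C : X) (γ : ℝ → X),
    ((dist B C + dist A C + dist A B : ℝ) : EReal) < 2 * modelDiam k →
    IsGeodesic γ B C →
    ∀ A' B' C' D' : (modelPlane k).carrier,
      (modelPlane k).IsTriangle (dist B C) (dist A C) (dist A B) A' B' C' →
      ∀ t ∈ Set.Icc 0 (dist B C),
        (modelPlane k).d B' D' = dist B (γ t) →
        (modelPlane k).d C' D' = dist C (γ t) →
        dist A (γ t) ≤ (modelPlane k).d A' D'

/-- The bound `H_k` on the side lengths. -/
def sideBound (k : ℝ) : EReal :=
  if 0 < k then ((Real.pi / (2 * √k) : ℝ) : EReal)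
  else if k = 0 then ⊤
  else ((1.3877 / √(-k) : ℝ) : EReal)

end TripleCurv

end

noncomputable section

namespace TripleCurv

open Real Filter Topology

/-! The functions `cs`, `sn`, `md` treat the three geometries at once. A point of a solid triangle
in M_k² is a normalized combination of the vertices with nonnegative weights l, m, j (`Comb`), and
its distances to the vertices depend only on the weights, the sides and k. The sum of distances thus
becomes a function on a fixed compact simplex, jointly continuous in k and the weights. Hence S is
continuous in k and its minimum is attained (`continuousOn_steiner`, `exists_steiner_point`).

Let a ≤ b ≤ c be the sides of a nondegenerate triangle. The angle opposite c increases with k and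
equals 2π/3 exactly at k = Λ (`strictMonoOn_psi`, `lambdaOrdered_eq`). For k < Λ the minimum is
below a + b, so it is attained at a Fermat point, from which the vertices are seen under angles 2π/3
(`exists_fermat`). If the weights of that point are kept and k decreases, the sum of distances
decreases to first order (`IsModel.legDeriv_sum_pos`). So S is strictly increasing on (-∞, Λ]. It
tends to (a+b+c)/2 at -∞, and if the sides are short relative to Λ, then S at Λ is at least a + b
(`le_steiner_of_psi_eq`). `Core` collects these facts in a form symmetric in the sides.

In any metric space g lies between (a+b+c)/2 and the sum of the two shorter sides. Existence of κ
follows from the intermediate value theorem and uniqueness from strict monotonicity. If Λ ≤ k, then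
κ ≤ Λ ≤ k. If k < Λ, it remains to show that g is at most S at k (`IsCAT.g_le_steiner`). There the
Fermat point P' of the comparison triangle lies on a segment A'D' with D' on B'C'. Transfer D' to D
on BC, and go from A towards D by the distance |A'P'|, or only to D if AD is shorter. The CAT
inequality bounds a weighted sum of the `md`-distances to B and C. Convexity of `md`, together with
the balance of the weights at a Fermat point, turns this into a bound on the sum of the distances
themselves.

Degenerate triples are separate: there Λ = -∞ and g is half the perimeter. -/

/-! ### Generalized trigonometric functions -/

/-- The generalized cosine of curvature `k`. -/
def cs (k t : ℝ) : ℝ := if 0 < k then cos (√k * t) else if k < 0 then cosh (√(-k) * t) else 1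

/-- The generalized sine of curvature `k`. -/
def sn (k t : ℝ) : ℝ :=
  if 0 < k then sin (√k * t) / √k else if k < 0 then sinh (√(-k) * t) / √(-k) else t

/-- The modified distance `(1 - cs k t) / k`, extended by `t ^ 2 / 2` to `k = 0`. -/
def md (k t : ℝ) : ℝ :=
  if 0 < k then (1 - cos (√k * t)) / k else if k < 0 then (1 - cosh (√(-k) * t)) / k
  else t ^ 2 / 2

theorem cs_pos_curv {k : ℝ} (hk : 0 < k) (t : ℝ) : cs k t = cos (√k * t) := by simp [cs, hk]
theorem sn_pos_curv {k : ℝ} (hk : 0 < k) (t : ℝ) : sn k t = sin (√k * t) / √k := by simp [sn, hk]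
theorem md_pos_curv {k : ℝ} (hk : 0 < k) (t : ℝ) : md k t = (1 - cos (√k * t)) / k := by
  simp [md, hk]
theorem cs_neg_curv {k : ℝ} (hk : k < 0) (t : ℝ) : cs k t = cosh (√(-k) * t) := by
  simp [cs, hk, hk.le.not_gt]
theorem sn_neg_curv {k : ℝ} (hk : k < 0) (t : ℝ) : sn k t = sinh (√(-k) * t) / √(-k) := by
  simp [sn, hk, hk.le.not_gt]
theorem md_neg_curv {k : ℝ} (hk : k < 0) (t : ℝ) : md k t = (1 - cosh (√(-k) * t)) / k := by
  simp [md, hk, hk.le.not_gt]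
@[simp] theorem cs_zero_curv (t : ℝ) : cs 0 t = 1 := by simp [cs]
@[simp] theorem sn_zero_curv (t : ℝ) : sn 0 t = t := by simp [sn]
@[simp] theorem md_zero_curv (t : ℝ) : md 0 t = t ^ 2 / 2 := by simp [md]

@[simp] theorem cs_zero (k : ℝ) : cs k 0 = 1 := by simp [cs]
@[simp] theorem sn_zero (k : ℝ) : sn k 0 = 0 := by simp [sn]
@[simp] theorem md_zero (k : ℝ) : md k 0 = 0 := by simp [md]

/-- Cosine laws become trivial at k = 0. Rewriting `cs` through `md` allows one polynomial identity
to serve all curvatures, with `md` carrying the Euclidean content. -/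
theorem cs_eq (k t : ℝ) : cs k t = 1 - k * md k t := by
  rcases lt_trichotomy k 0 with hk | rfl | hk
  · rw [cs_neg_curv hk, md_neg_curv hk]; field_simp [hk.ne]; ring
  · simp
  · rw [cs_pos_curv hk, md_pos_curv hk]; field_simp; ring

@[simp] theorem cs_neg (k t : ℝ) : cs k (-t) = cs k t := by simp [cs]
@[simp] theorem sn_neg (k t : ℝ) : sn k (-t) = - sn k t := by
  simp only [sn, mul_neg, sin_neg, sinh_neg]; split_ifs <;> ring
@[simp] theorem md_neg (k t : ℝ) : md k (-t) = md k t := by simp [md]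

theorem sq_sqrt_neg {k : ℝ} (hk : k < 0) : √(-k) ^ 2 = -k := sq_sqrt (by linarith)

theorem sn_sq (k t : ℝ) : sn k t ^ 2 = 2 * md k t - k * md k t ^ 2 := by
  rcases lt_trichotomy k 0 with hk | rfl | hk
  · rw [sn_neg_curv hk, md_neg_curv hk, div_pow, sinh_sq, sq_sqrt_neg hk]
    field_simp [hk.ne]; ring
  · simp; ring
  · rw [sn_pos_curv hk, md_pos_curv hk, div_pow, sin_sq, sq_sqrt hk.le]
    field_simp; ring

theorem cs_sq (k t : ℝ) : cs k t ^ 2 = 1 - k * sn k t ^ 2 := by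
  rw [sn_sq, cs_eq]; ring

theorem sn_add (k t u : ℝ) : sn k (t + u) = sn k t * cs k u + cs k t * sn k u := by
  rcases lt_trichotomy k 0 with hk | rfl | hk
  · simp only [sn_neg_curv hk, cs_neg_curv hk, mul_add, sinh_add]; ring
  · simp
  · simp only [sn_pos_curv hk, cs_pos_curv hk, mul_add, sin_add]; ring

theorem cs_add (k t u : ℝ) : cs k (t + u) = cs k t * cs k u - k * (sn k t * sn k u) := by
  rcases lt_trichotomy k 0 with hk | rfl | hk
  · have h : √(-k) ≠ 0 := (sqrt_pos.2 (by linarith)).ne'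
    have h2 := sq_sqrt_neg hk
    simp only [sn_neg_curv hk, cs_neg_curv hk, mul_add, cosh_add]
    field_simp
    rw [h2]; ring
  · simp
  · have h : √k ≠ 0 := (sqrt_pos.2 hk).ne'
    have h2 := sq_sqrt hk.le
    simp only [sn_pos_curv hk, cs_pos_curv hk, mul_add, cos_add]
    field_simp
    rw [h2]; ring

theorem md_add (k t u : ℝ) :
    md k (t + u) = md k t + md k u - k * (md k t * md k u) + sn k t * sn k u := by
  by_cases hk : k = 0
  · subst hk; simp; ring
  · have h := cs_add k t u
    simp only [cs_eq] at h
    apply mul_left_cancel₀ hk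
    linear_combination -h

theorem sn_sub (k t u : ℝ) : sn k (t - u) = sn k t * cs k u - cs k t * sn k u := by
  rw [sub_eq_add_neg, sn_add]; simp; ring

theorem cs_sub (k t u : ℝ) : cs k (t - u) = cs k t * cs k u + k * (sn k t * sn k u) := by
  rw [sub_eq_add_neg, cs_add]; simp

theorem md_sub (k t u : ℝ) :
    md k (t - u) = md k t + md k u - k * (md k t * md k u) - sn k t * sn k u := by
  rw [sub_eq_add_neg, md_add]; simp; ring

theorem md_eq_half (k t : ℝ) : md k t = 2 * sn k (t / 2) ^ 2 := by
  have h := md_add k (t / 2) (t / 2)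
  rw [add_halves] at h
  have := sn_sq k (t / 2)
  linear_combination h - this

/-- The product form is the source of the monotonicity of `md` and of the half-angle formulas for
triangles. -/
theorem md_sub_md (k t u : ℝ) :
    md k t - md k u = 2 * (sn k ((t + u) / 2) * sn k ((t - u) / 2)) := by
  have h1 := md_add k ((t + u) / 2) ((t - u) / 2)
  have h2 := md_sub k ((t + u) / 2) ((t - u) / 2)
  rw [show (t + u) / 2 + (t - u) / 2 = t by ring] at h1
  rw [show (t + u) / 2 - (t - u) / 2 = u by ring] at h2
  linear_combination h1 - h2

theorem hasDerivAt_sn (k t : ℝ) : HasDerivAt (sn k) (cs k t) t := by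
  rcases lt_trichotomy k 0 with hk | rfl | hk
  · have h : √(-k) ≠ 0 := (sqrt_pos.2 (by linarith)).ne'
    have := (((hasDerivAt_id t).const_mul √(-k)).sinh).div_const √(-k)
    refine (this.congr_deriv ?_).congr_of_eventuallyEq (.of_forall fun u => ?_)
    · rw [cs_neg_curv hk]; simp; field_simp
    · simp [sn_neg_curv hk]
  · simpa [funext sn_zero_curv] using hasDerivAt_id' t
  · have h : √k ≠ 0 := (sqrt_pos.2 hk).ne'
    have := (((hasDerivAt_id t).const_mul √k).sin).div_const √k
    refine (this.congr_deriv ?_).congr_of_eventuallyEq (.of_forall fun u => ?_)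
    · rw [cs_pos_curv hk]; simp; field_simp
    · simp [sn_pos_curv hk]

theorem hasDerivAt_md (k t : ℝ) : HasDerivAt (md k) (sn k t) t := by
  have h1 : HasDerivAt (fun t => sn k (t / 2)) (cs k (t / 2) * (1 / 2)) t :=
    HasDerivAt.comp (h₂ := sn k) t (hasDerivAt_sn k (t / 2)) ((hasDerivAt_id' t).div_const 2)
  have h2 := (h1.pow 2).const_mul 2
  refine (h2.congr_deriv ?_).congr_of_eventuallyEq (.of_forall fun u => ?_)
  · have := sn_add k (t / 2) (t / 2)
    rw [add_halves] at this
    rw [this]; simp; ring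
  · simp [md_eq_half k u]

/-- For t ≥ 0 the condition `k * t ^ 2 < π ^ 2` expresses t < D_k for every sign of k without
division. Similarly `4 * (k * t ^ 2) ≤ π ^ 2` expresses t ≤ D_k / 2. -/
theorem sqrt_mul_lt_pi {k t : ℝ} (hk : 0 < k) (h : k * t ^ 2 < π ^ 2) : √k * t < π := by
  apply lt_of_pow_lt_pow_left₀ 2 pi_pos.le
  rwa [mul_pow, sq_sqrt hk.le]

theorem sqrt_mul_le_pi {k t : ℝ} (hk : 0 < k) (h : k * t ^ 2 ≤ π ^ 2) : √k * t ≤ π := by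
  apply le_of_sq_le_sq _ pi_pos.le
  rwa [mul_pow, sq_sqrt hk.le]

theorem sn_pos {k t : ℝ} (ht : 0 < t) (h : k * t ^ 2 < π ^ 2) : 0 < sn k t := by
  rcases lt_trichotomy k 0 with hk | rfl | hk
  · rw [sn_neg_curv hk]
    have := sqrt_pos.2 (neg_pos.2 hk)
    exact div_pos (sinh_pos_iff.2 (by positivity)) this
  · simpa
  · rw [sn_pos_curv hk]
    have := sqrt_pos.2 hk
    exact div_pos (sin_pos_of_pos_of_lt_pi (by positivity) (sqrt_mul_lt_pi hk h)) this

theorem sn_nonneg {k t : ℝ} (ht : 0 ≤ t) (h : k * t ^ 2 ≤ π ^ 2) : 0 ≤ sn k t := by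
  rcases lt_trichotomy k 0 with hk | rfl | hk
  · rw [sn_neg_curv hk]
    exact div_nonneg (sinh_nonneg_iff.2 (by positivity)) (by positivity)
  · simpa
  · rw [sn_pos_curv hk]
    exact div_nonneg (sin_nonneg_of_nonneg_of_le_pi (by positivity) (sqrt_mul_le_pi hk h))
      (by positivity)

theorem mul_sq_le_of_le {k t u : ℝ} (ht : 0 ≤ t) (htu : t ≤ u) (h : k * u ^ 2 ≤ π ^ 2) :
    k * t ^ 2 ≤ π ^ 2 := by
  rcases le_total k 0 with hk | hk
  · nlinarith [sq_nonneg t, pi_pos]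
  · exact (mul_le_mul_of_nonneg_left (pow_le_pow_left₀ ht htu 2) hk).trans h

theorem mul_sq_lt_of_le {k t u : ℝ} (ht : 0 ≤ t) (htu : t ≤ u) (h : k * u ^ 2 < π ^ 2) :
    k * t ^ 2 < π ^ 2 := by
  rcases le_total k 0 with hk | hk
  · nlinarith [sq_nonneg t, pi_pos]
  · exact (mul_le_mul_of_nonneg_left (pow_le_pow_left₀ ht htu 2) hk).trans_lt h

theorem mul_sq_lt_of_lt {k t u : ℝ} (ht : 0 ≤ t) (htu : t < u) (h : k * u ^ 2 ≤ π ^ 2) :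
    k * t ^ 2 < π ^ 2 := by
  rcases le_or_gt k 0 with hk | hk
  · nlinarith [sq_nonneg t, pi_pos]
  · exact (mul_lt_mul_of_pos_left (pow_lt_pow_left₀ htu ht two_ne_zero) hk).trans_le h

theorem md_nonneg (k t : ℝ) : 0 ≤ md k t := by rw [md_eq_half]; positivity

theorem md_lt_md {k t u : ℝ} (ht : 0 ≤ t) (htu : t < u) (h : k * u ^ 2 ≤ π ^ 2) :
    md k t < md k u := by
  have := md_sub_md k u t
  have h1 : 0 < sn k ((u + t) / 2) := sn_pos (by linarith)
    (mul_sq_lt_of_lt (by linarith) (by linarith) h)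
  have h2 : 0 < sn k ((u - t) / 2) := sn_pos (by linarith)
    (mul_sq_lt_of_lt (by linarith) (by linarith) h)
  nlinarith [mul_pos h1 h2]

theorem md_le_md {k t u : ℝ} (ht : 0 ≤ t) (htu : t ≤ u) (h : k * u ^ 2 ≤ π ^ 2) :
    md k t ≤ md k u := by
  rcases htu.eq_or_lt with rfl | h1
  · exact le_rfl
  · exact (md_lt_md ht h1 h).le

theorem md_inj {k t u : ℝ} (ht : 0 ≤ t) (hu : 0 ≤ u) (hkt : k * t ^ 2 ≤ π ^ 2)
    (hku : k * u ^ 2 ≤ π ^ 2) (h : md k t = md k u) : t = u := by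
  rcases lt_trichotomy t u with h1 | h1 | h1
  · exact absurd h (md_lt_md ht h1 hku).ne
  · exact h1
  · exact absurd h (md_lt_md hu h1 hkt).ne'

theorem lt_of_md_lt {k t u : ℝ} (hu : 0 ≤ u) (hkt : k * t ^ 2 ≤ π ^ 2)
    (h : md k t < md k u) : t < u := by
  by_contra! h1
  exact absurd h (md_le_md hu h1 hkt).not_gt

theorem md_eq_zero {k t : ℝ} (ht : 0 ≤ t) (hkt : k * t ^ 2 ≤ π ^ 2) (h : md k t = 0) : t = 0 :=
  md_inj ht le_rfl hkt (by simp; positivity) (by simpa using h)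

theorem cs_pos_of_nonpos {k : ℝ} (hk : k ≤ 0) (t : ℝ) : 1 ≤ cs k t := by
  rw [cs_eq]; nlinarith [md_nonneg k t]

theorem cs_nonneg {k t : ℝ} (ht : 0 ≤ t) (h : 4 * (k * t ^ 2) ≤ π ^ 2) : 0 ≤ cs k t := by
  rcases le_or_gt k 0 with hk | hk
  · linarith [cs_pos_of_nonpos hk t]
  · rw [cs_pos_curv hk]
    have h1 := sqrt_mul_le_pi (t := 2 * t) hk (by linarith)
    have : 0 ≤ √k * t := by positivity
    exact cos_nonneg_of_neg_pi_div_two_le_of_le (by linarith [pi_pos]) (by linarith)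

/-- The tangent line inequality for `md`, where it is convex. -/
theorem md_tangent {k y r : ℝ} (hy : 0 ≤ y) (hr : 0 ≤ r) (hky : 0 ≤ cs k y)
    (hkr : 0 ≤ cs k r) (hky' : k * y ^ 2 ≤ π ^ 2) (hkr' : k * r ^ 2 ≤ π ^ 2) :
    md k y + sn k y * (r - y) ≤ md k r := by
  -- The second derivative of `md k` is `cs k`. For k > 0 it decreases on this interval, so its sign
  -- at the larger endpoint controls it throughout.
  have key : ConvexOn ℝ (Set.Icc 0 (max y r)) (md k) := by
    apply MonotoneOn.convexOn_of_deriv (convex_Icc _ _)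
    · exact fun t _ => (hasDerivAt_md k t).continuousAt.continuousWithinAt
    · exact fun t _ => (hasDerivAt_md k t).differentiableAt.differentiableWithinAt
    · have : deriv (md k) = sn k := funext fun t => (hasDerivAt_md k t).deriv
      rw [this]
      apply monotoneOn_of_deriv_nonneg ((convex_Icc _ _).interior)
      · exact fun t _ => (hasDerivAt_sn k t).continuousAt.continuousWithinAt
      · exact fun t _ => (hasDerivAt_sn k t).differentiableAt.differentiableWithinAt
      · intro t ht
        rw [interior_interior, interior_Icc] at ht
        rw [(hasDerivAt_sn k t).deriv]
        rcases le_or_gt k 0 with hk | hk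
        · linarith [cs_pos_of_nonpos hk t]
        · rcases max_choice y r with h | h <;> rw [h] at ht
          · have := md_le_md ht.1.le ht.2.le hky'
            rw [cs_eq] at *; nlinarith
          · have := md_le_md ht.1.le ht.2.le hkr'
            rw [cs_eq] at *; nlinarith
  have hmem1 : y ∈ Set.Icc 0 (max y r) := ⟨hy, le_max_left _ _⟩
  have hmem2 : r ∈ Set.Icc 0 (max y r) := ⟨hr, le_max_right _ _⟩
  rcases lt_trichotomy y r with h | h | h
  · have := key.le_slope_of_hasDerivAt hmem1 hmem2 h (hasDerivAt_md k y)
    rw [slope_def_field, le_div_iff₀ (by linarith)] at this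
    linarith
  · subst h; simp
  · have := key.slope_le_of_hasDerivAt hmem2 hmem1 h (hasDerivAt_md k y)
    rw [slope_def_field, div_le_iff₀ (by linarith)] at this
    linarith

/-! ### Continuity in the curvature, and the inverse of `md` -/

theorem continuous_dslope_zero {f : ℝ → ℝ} (hf : Continuous f) (hd : DifferentiableAt ℝ f 0) :
    Continuous (dslope f 0) := by
  rw [continuous_iff_continuousAt]
  intro x
  rcases eq_or_ne x 0 with rfl | hx
  · exact continuousAt_dslope_same.2 hd
  · exact (continuousAt_dslope_of_ne hx).2 hf.continuousAt

theorem dslope_zero_of_ne {f : ℝ → ℝ} (hf : f 0 = 0) {x : ℝ} (hx : x ≠ 0) :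
    dslope f 0 x = f x / x := by
  rw [dslope_of_ne _ hx, slope_def_field, hf]; simp

/-- Gluing of two even functions `f`, `h` with the same value at `0` as a function of the signed
square of the variable. -/
def glue (f h : ℝ → ℝ) (v : ℝ) : ℝ := if 0 ≤ v then f √v else h √(-v)

theorem continuous_glue {f h : ℝ → ℝ} (hf : Continuous f) (hh : Continuous h) (h0 : f 0 = h 0) :
    Continuous (glue f h) := by
  apply Continuous.if_le (by fun_prop) (by fun_prop) continuous_const continuous_id
  intro v hv
  simp only [id] at hv
  subst hv
  simpa using h0

theorem glue_of_pos {f h : ℝ → ℝ} {v : ℝ} (hv : 0 < v) : glue f h v = f √v := by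
  simp [glue, hv.le]

theorem glue_of_neg {f h : ℝ → ℝ} {v : ℝ} (hv : v < 0) : glue f h v = h √(-v) := by
  simp [glue, hv]

theorem glue_zero {f h : ℝ → ℝ} : glue f h 0 = f 0 := by simp [glue]

/-- By scaling, sn k t / t is a function of k t² alone: sin w / w with w² = k t² on one side of 0,
sinh w / w with w² = -k t² on the other. Both have value 1 at 0, so continuity in k through 0
reduces to a gluing. -/
theorem sn_eq_glue {k t : ℝ} (ht : 0 < t) :
    sn k t = t * glue (dslope sin 0) (dslope sinh 0) (k * t ^ 2) := by
  rcases lt_trichotomy k 0 with hk | rfl | hk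
  · have h : √(-k) ≠ 0 := (sqrt_pos.2 (by linarith)).ne'
    have h2 : √(-(k * t ^ 2)) = √(-k) * t := by
      rw [neg_mul_eq_neg_mul, sqrt_mul (by linarith), sqrt_sq ht.le]
    rw [glue_of_neg (by nlinarith [sq_pos_of_pos ht]), h2, sn_neg_curv hk,
      dslope_zero_of_ne sinh_zero (by positivity)]
    field_simp
  · simp [glue_zero]
  · have h : √k ≠ 0 := (sqrt_pos.2 hk).ne'
    have h2 : √(k * t ^ 2) = √k * t := by
      rw [sqrt_mul hk.le, sqrt_sq ht.le]
    rw [glue_of_pos (by positivity), h2, sn_pos_curv hk,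
      dslope_zero_of_ne sin_zero (by positivity)]
    field_simp

theorem continuous_sn_curv (t : ℝ) : Continuous fun k => sn k t := by
  have key : ∀ t : ℝ, 0 < t → Continuous fun k => sn k t := by
    intro t ht
    simp only [sn_eq_glue ht]
    have : Continuous (glue (dslope sin 0) (dslope sinh 0)) :=
      continuous_glue (continuous_dslope_zero continuous_sin differentiableAt_sin)
        (continuous_dslope_zero continuous_sinh differentiable_sinh.differentiableAt)
        (by simp)
    fun_prop
  rcases lt_trichotomy t 0 with ht | rfl | ht
  · exact (key (-t) (by linarith)).neg.congr fun k => by simp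
  · simpa using continuous_const
  · exact key t ht

theorem continuous_md_curv (t : ℝ) : Continuous fun k => md k t := by
  simp only [md_eq_half]
  exact continuous_const.mul ((continuous_sn_curv _).pow 2)

/-- The inverse of `md k` on `[0, D_k]`. -/
def amd (k m : ℝ) : ℝ := √(2 * m) * glue (dslope arcsin 0) (dslope arsinh 0) (k * m / 2)

/-- Solving md = 2 sn(t/2)² for k > 0 gives t = (2/√k) arcsin √(km/2). Once √(2m) is factored out,
what remains depends continuously on km/2 through 0. As arcsin and arsinh are continuous on the
whole line, no domain restriction is needed. -/
theorem continuous_amd : Continuous fun p : ℝ × ℝ => amd p.1 p.2 := by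
  have : Continuous (glue (dslope arcsin 0) (dslope arsinh 0)) := by
    refine continuous_glue (continuous_dslope_zero continuous_arcsin
      (differentiableAt_arcsin.2 ⟨by norm_num, by norm_num⟩))
        (continuous_dslope_zero continuous_arsinh differentiable_arsinh.differentiableAt) ?_
    simp [(Real.hasDerivAt_arsinh 0).deriv, Real.deriv_arcsin]
  unfold amd
  fun_prop

theorem amd_md {k t : ℝ} (ht : 0 ≤ t) (h : k * t ^ 2 ≤ π ^ 2) : amd k (md k t) = t := by
  rcases ht.eq_or_lt with rfl | ht
  · simp [amd]
  have hs : 0 < sn k (t / 2) := sn_pos (by linarith)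
    (mul_sq_lt_of_lt (by linarith) (by linarith) h)
  have e1 : √(2 * md k t) = 2 * sn k (t / 2) := by
    rw [md_eq_half, show 2 * (2 * sn k (t / 2) ^ 2) = (2 * sn k (t / 2)) ^ 2 by ring,
      sqrt_sq (by positivity)]
  have e2 : k * md k t / 2 = k * sn k (t / 2) ^ 2 := by rw [md_eq_half]; ring
  rw [amd, e1, e2]
  rcases lt_trichotomy k 0 with hk | rfl | hk
  · have h0 : 0 < √(-k) := sqrt_pos.2 (by linarith)
    have h2 : √(-(k * sn k (t / 2) ^ 2)) = sinh (√(-k) * (t / 2)) := by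
      rw [neg_mul_eq_neg_mul, sqrt_mul (by linarith), sqrt_sq hs.le, sn_neg_curv hk]
      field_simp
    have h3 : sinh (√(-k) * (t / 2)) ≠ 0 := (sinh_pos_iff.2 (by positivity)).ne'
    rw [glue_of_neg (by nlinarith [sq_pos_of_pos hs]), h2, dslope_zero_of_ne arsinh_zero h3,
      arsinh_sinh, sn_neg_curv hk]
    field_simp
  · simp [glue_zero, Real.deriv_arcsin]; ring
  · have h0 : 0 < √k := sqrt_pos.2 hk
    have h2 : √(k * sn k (t / 2) ^ 2) = sin (√k * (t / 2)) := by
      rw [sqrt_mul hk.le, sqrt_sq hs.le, sn_pos_curv hk]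
      field_simp
    have h4 := sqrt_mul_le_pi hk h
    have h5 : 0 < √k * (t / 2) := by positivity
    have h3 : sin (√k * (t / 2)) ≠ 0 :=
      (sin_pos_of_pos_of_lt_pi h5 (by linarith [pi_pos])).ne'
    rw [glue_of_pos (by positivity), h2, dslope_zero_of_ne arcsin_zero h3,
      arcsin_sin (by linarith [pi_pos]) (by linarith), sn_pos_curv hk]
    generalize sin (√k * (t / 2)) = q at *
    field_simp

/-! ### Derivatives with respect to the curvature -/

theorem hasDerivAt_cs_curv {k : ℝ} (hk : k ≠ 0) {f : ℝ → ℝ} {f' : ℝ} (hf : HasDerivAt f f' k) :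
    HasDerivAt (fun k => cs k (f k)) (-(f k / 2) * sn k (f k) - k * f' * sn k (f k)) k := by
  rcases hk.lt_or_gt with hk | hk
  · have h0 : 0 < √(-k) := sqrt_pos.2 (by linarith)
    have h1 : HasDerivAt (fun k => √(-k)) (-1 / (2 * √(-k))) k :=
      ((hasDerivAt_id' k).neg).sqrt (by simpa using hk.ne)
    refine ((h1.mul hf).cosh.congr_deriv ?_).congr_of_eventuallyEq ?_
    · rw [sn_neg_curv hk]
      have := sq_sqrt_neg hk
      field_simp
      linear_combination sinh (√(-k) * f k) * (2 * f') * this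
    · filter_upwards [eventually_lt_nhds hk] with u hu
      simp [cs_neg_curv hu]
  · have h0 : 0 < √k := sqrt_pos.2 hk
    have h1 : HasDerivAt (fun k => √k) (1 / (2 * √k)) k := (hasDerivAt_id' k).sqrt hk.ne'
    refine ((h1.mul hf).cos.congr_deriv ?_).congr_of_eventuallyEq ?_
    · rw [sn_pos_curv hk]
      have := sq_sqrt hk.le
      field_simp
      linear_combination -sin (√k * f k) * (2 * f') * this
    · filter_upwards [eventually_gt_nhds hk] with u hu
      simp [cs_pos_curv hu]

theorem hasDerivAt_sn_curv {k : ℝ} (hk : k ≠ 0) (t : ℝ) :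
    HasDerivAt (fun k => sn k t) ((t * cs k t - sn k t) / (2 * k)) k := by
  rcases hk.lt_or_gt with hk | hk
  · have h0 : 0 < √(-k) := sqrt_pos.2 (by linarith)
    have h1 : HasDerivAt (fun k => √(-k)) (-1 / (2 * √(-k))) k :=
      ((hasDerivAt_id' k).neg).sqrt (by simpa using hk.ne)
    refine (((h1.mul_const t).sinh.div h1 h0.ne').congr_deriv ?_).congr_of_eventuallyEq ?_
    · rw [sn_neg_curv hk, cs_neg_curv hk]
      have := sq_sqrt_neg hk
      have hk' : k = -√(-k) ^ 2 := by linarith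
      set r := √(-k)
      rw [hk']
      field_simp
      ring
    · filter_upwards [eventually_lt_nhds hk] with u hu
      simp [sn_neg_curv hu]
  · have h0 : 0 < √k := sqrt_pos.2 hk
    have h1 : HasDerivAt (fun k => √k) (1 / (2 * √k)) k := (hasDerivAt_id' k).sqrt hk.ne'
    refine (((h1.mul_const t).sin.div h1 h0.ne').congr_deriv ?_).congr_of_eventuallyEq ?_
    · rw [sn_pos_curv hk, cs_pos_curv hk]
      have := sq_sqrt hk.le
      have hk' : k = √k ^ 2 := by linarith
      generalize √k = r at *
      subst hk'
      field_simp
    · filter_upwards [eventually_gt_nhds hk] with u hu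
      simp [sn_pos_curv hu]

/-- `t * cs k t / sn k t` is strictly decreasing in `t` for `k > 0` and strictly increasing for
`k < 0`. -/
theorem mul_cs_mul_sn_lt {k u v : ℝ} (hk : k ≠ 0) (hu : 0 < u) (huv : u < v)
    (hv : k * v ^ 2 < π ^ 2) : 0 < k * (u * cs k u * sn k v - v * cs k v * sn k u) := by
  have hpos : ∀ t, 0 < t → t ≤ v → 0 < sn k t := fun t h1 h2 =>
    sn_pos h1 (mul_sq_lt_of_le h1.le h2 hv)
  have hcs : ∀ t, HasDerivAt (cs k) (-k * sn k t) t := by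
    intro t
    have := ((hasDerivAt_md k t).const_mul k).const_sub 1
    simpa [funext (cs_eq k)] using this
  have hlt : ∀ t, 0 < t → t < v → 0 < k * (t - sn k t * cs k t) := by
    intro t h1 h2
    have hmono : StrictMonoOn (fun t => k * (t - sn k t * cs k t)) (Set.Icc 0 v) := by
      have hd : ∀ t, HasDerivAt (fun t => k * (t - sn k t * cs k t))
          (k * (1 - (cs k t * cs k t + sn k t * (-k * sn k t)))) t := fun t =>
        ((hasDerivAt_id' t).sub ((hasDerivAt_sn k t).mul (hcs t))).const_mul k
      apply strictMonoOn_of_deriv_pos (convex_Icc _ _)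
      · exact fun t _ => (hd t).continuousAt.continuousWithinAt
      · intro t ht
        rw [interior_Icc] at ht
        rw [(hd t).deriv]
        have h3 := hpos t ht.1 ht.2.le
        have h4 := cs_sq k t
        have : k * (1 - (cs k t * cs k t + sn k t * (-k * sn k t))) = 2 * k ^ 2 * sn k t ^ 2 := by
          linear_combination -k * h4
        rw [this]; positivity
    have := hmono ⟨le_rfl, by linarith⟩ ⟨h1.le, h2.le⟩ h1
    simpa using this
  have hmono : StrictAntiOn (fun t => k * (t * cs k t / sn k t)) (Set.Icc u v) := by
    have hd : ∀ t ∈ Set.Icc u v, HasDerivAt (fun t => k * (t * cs k t / sn k t))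
        (k * (((1 * cs k t + t * (-k * sn k t)) * sn k t - t * cs k t * cs k t) / sn k t ^ 2)) t :=
      fun t ht => (((hasDerivAt_id' t).mul (hcs t)).div (hasDerivAt_sn k t)
        (hpos t (by linarith [ht.1]) ht.2).ne').const_mul k
    apply strictAntiOn_of_deriv_neg (convex_Icc _ _)
    · exact fun t ht => (hd t ht).continuousAt.continuousWithinAt
    · intro t ht
      rw [interior_Icc] at ht
      rw [(hd t ⟨ht.1.le, ht.2.le⟩).deriv]
      have h3 := hpos t (by linarith [ht.1]) ht.2.le
      have h4 := cs_sq k t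
      have h5 := hlt t (by linarith [ht.1]) ht.2
      have : k * (((1 * cs k t + t * (-k * sn k t)) * sn k t - t * cs k t * cs k t) / sn k t ^ 2)
          = - (k * (t - sn k t * cs k t)) / sn k t ^ 2 := by
        field_simp
        linear_combination -t * h4
      rw [this]
      exact div_neg_of_neg_of_pos (by linarith) (by positivity)
  have h := hmono ⟨le_rfl, huv.le⟩ ⟨huv.le, le_rfl⟩ huv
  simp only at h
  have h1 := hpos u hu huv.le
  have h2 := hpos v (by linarith) le_rfl
  rw [← mul_div_assoc, ← mul_div_assoc, div_lt_div_iff₀ h2 h1] at h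
  linarith

/-- The sign of the derivative in k is given by `mul_cs_mul_sn_lt`. The derivative formula divides
by k, so the two half-lines are treated separately and joined at 0 by continuity. -/
theorem strictMonoOn_sn_div_sn {u v : ℝ} (hu : 0 < u) (huv : u < v) :
    StrictMonoOn (fun k => sn k u / sn k v) {k | k * v ^ 2 < π ^ 2} := by
  have hv : 0 < v := hu.trans huv
  have hset : {k : ℝ | k * v ^ 2 < π ^ 2} = Set.Iio (π ^ 2 / v ^ 2) := by
    ext k; simp [lt_div_iff₀ (pow_pos hv 2)]
  have hP : (0 : ℝ) < π ^ 2 / v ^ 2 := by positivity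
  have hcont : ∀ k ∈ Set.Iio (π ^ 2 / v ^ 2), ContinuousAt (fun k => sn k u / sn k v) k := by
    intro k hk
    rw [← hset] at hk
    exact (continuous_sn_curv u).continuousAt.div (continuous_sn_curv v).continuousAt
      (sn_pos hv hk).ne'
  have hder : ∀ k ∈ Set.Iio (π ^ 2 / v ^ 2), k ≠ 0 → 0 < deriv (fun k => sn k u / sn k v) k := by
    intro k hk hk0
    rw [← hset] at hk
    have hs := sn_pos hv hk
    have h1 := (hasDerivAt_sn_curv hk0 u).div (hasDerivAt_sn_curv hk0 v) hs.ne'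
    have h1' : deriv (fun k => sn k u / sn k v) k = _ := h1.deriv
    rw [h1']
    have h2 := mul_cs_mul_sn_lt hk0 hu huv hk
    have : ((u * cs k u - sn k u) / (2 * k) * sn k v - sn k u * ((v * cs k v - sn k v) / (2 * k)))
        / sn k v ^ 2 = (k * (u * cs k u * sn k v - v * cs k v * sn k u)) /
          (2 * k ^ 2 * sn k v ^ 2) := by
      field_simp; ring
    rw [this]; positivity
  rw [hset]
  have h1 : StrictMonoOn (fun k => sn k u / sn k v) (Set.Iic 0) := by
    apply strictMonoOn_of_deriv_pos (convex_Iic _)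
    · exact fun k hk => (hcont k (lt_of_le_of_lt hk hP)).continuousWithinAt
    · intro k hk
      rw [interior_Iic] at hk
      exact hder k (hk.trans hP) hk.ne
  have h2 : StrictMonoOn (fun k => sn k u / sn k v) (Set.Ico 0 (π ^ 2 / v ^ 2)) := by
    apply strictMonoOn_of_deriv_pos (convex_Ico _ _)
    · exact fun k hk => (hcont k hk.2).continuousWithinAt
    · intro k hk
      rw [interior_Ico] at hk
      exact hder k hk.2 hk.1.ne'
  have := h1.union h2 (c := 0) isGreatest_Iic ⟨⟨le_rfl, hP⟩, fun x hx => hx.1⟩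
  rwa [Set.Iic_union_Ico_eq_Iio hP] at this

/-! ### Linear model of the planes -/

/-- `P` is the point on the ray of the vector `l A + m B + j C` (in the linear model of the plane),
expressed through the distances to all points `Y`. -/
def Comb (k : ℝ) (M : Plane) (A B C P : M.carrier) (l m j n E : ℝ) : Prop :=
  l + m + j = n + k * E ∧ ∀ Y, l * md k (M.d A Y) + m * md k (M.d B Y) + j * md k (M.d C Y) =
    n * md k (M.d P Y) + E

/-- The quadratic expression of the weights `l, m, j` in a triangle with sides `a, b, c`. -/
def qf (k a b c l m j : ℝ) : ℝ := l * m * md k c + m * j * md k a + l * j * md k b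

/-- The squared length of `l A + m B + j C`. -/
def nsq (k a b c l m j : ℝ) : ℝ := (l + m + j) ^ 2 - 2 * k * qf k a b c l m j

/-- The properties of a plane of constant curvature `k` that are used below. -/
structure IsModel (k : ℝ) (M : Plane) : Prop where
  d_nonneg : ∀ X Y, 0 ≤ M.d X Y
  d_self : ∀ X, M.d X X = 0
  d_comm : ∀ X Y, M.d X Y = M.d Y X
  d_triangle : ∀ X Y Z, M.d X Z ≤ M.d X Y + M.d Y Z
  d_le : ∀ X Y, k * M.d X Y ^ 2 ≤ π ^ 2
  comb_exists : ∀ A B C l m j, 0 ≤ l → 0 ≤ m → 0 ≤ j → 0 < l + m + j →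
    0 < nsq k (M.d B C) (M.d A C) (M.d A B) l m j →
    ∃ P, Comb k M A B C P l m j √(nsq k (M.d B C) (M.d A C) (M.d A B) l m j)
      (2 * qf k (M.d B C) (M.d A C) (M.d A B) l m j /
        (√(nsq k (M.d B C) (M.d A C) (M.d A B) l m j) + (l + m + j)))
  triangle_exists : ∀ a b c, 0 ≤ a → 0 ≤ b → 0 ≤ c → a ≤ b + c → b ≤ a + c → c ≤ a + b →
    k * ((a + b + c) / 2) ^ 2 ≤ π ^ 2 → ∃ A B C, M.IsTriangle a b c A B C

/-- Coordinates of a plane of curvature `k` on the quadric `u ^ 2 + v ^ 2 + k * m ^ 2 = 2 * m`. -/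
structure Chart (k : ℝ) (M : Plane) where
  m : M.carrier → ℝ
  u : M.carrier → ℝ
  v : M.carrier → ℝ
  surf : ∀ X, u X ^ 2 + v X ^ 2 + k * m X ^ 2 = 2 * m X
  sheet : ∀ X, k ≤ 0 → 0 < 1 - k * m X
  surj : ∀ m' u' v', u' ^ 2 + v' ^ 2 + k * m' ^ 2 = 2 * m' → (k ≤ 0 → 0 < 1 - k * m') →
    ∃ X, m X = m' ∧ u X = u' ∧ v X = v'
  d_nonneg : ∀ X Y, 0 ≤ M.d X Y
  d_triangle : ∀ X Y Z, M.d X Z ≤ M.d X Y + M.d Y Z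
  d_le : ∀ X Y, k * M.d X Y ^ 2 ≤ π ^ 2
  md_d : ∀ X Y, md k (M.d X Y) = m X + m Y - k * m X * m Y - u X * u Y - v X * v Y

/-- In a chart `m X` is the modified distance to the origin, and (1 - k m, u, v) are linear
coordinates. A nonnegative combination of vertices is divided by its length n to return to the
quadric. The number E corrects the coordinate m and keeps the construction meaningful at k = 0. -/
theorem Chart.isModel {k : ℝ} {M : Plane} (h : Chart k M) : IsModel k M where
  d_nonneg := h.d_nonneg
  d_triangle := h.d_triangle
  d_le := h.d_le
  d_self X := by
    apply md_eq_zero (h.d_nonneg _ _) (h.d_le _ _)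
    rw [h.md_d]
    linear_combination -h.surf X
  d_comm X Y := by
    apply md_inj (h.d_nonneg _ _) (h.d_nonneg _ _) (h.d_le _ _) (h.d_le _ _)
    rw [h.md_d, h.md_d]; ring
  comb_exists A B C l m j hl hm hj hT hn := by
    set N := nsq k (M.d B C) (M.d A C) (M.d A B) l m j with hN
    set Q := qf k (M.d B C) (M.d A C) (M.d A B) l m j with hQ
    set n := √N with hn'
    have hn0 : 0 < n := sqrt_pos.2 hn
    have hn2 : n ^ 2 = (l + m + j) ^ 2 - 2 * k * Q := by rw [hn', sq_sqrt hn.le]; rfl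
    -- From n² = (l+m+j)² - 2kQ one gets (l+m+j) - n = kE with this E. Unlike the quotient ((l+m+j)
    -- - n)/k, it is defined at k = 0.
    set E := 2 * Q / (n + (l + m + j)) with hE
    have hE1 : E * (n + (l + m + j)) = 2 * Q := by rw [hE]; field_simp
    have hE2 : l + m + j = n + k * E := by
      have : (n + (l + m + j)) * (l + m + j - n - k * E) = 0 := by
        linear_combination -hn2 - k * hE1
      rcases mul_eq_zero.1 this with h1 | h1 <;> linarith
    have hQ' : Q = l * m * (h.m A + h.m B - k * h.m A * h.m B - h.u A * h.u B - h.v A * h.v B)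
        + m * j * (h.m B + h.m C - k * h.m B * h.m C - h.u B * h.u C - h.v B * h.v C)
        + l * j * (h.m A + h.m C - k * h.m A * h.m C - h.u A * h.u C - h.v A * h.v C) := by
      rw [hQ, qf, h.md_d, h.md_d, h.md_d]
    obtain ⟨P, p1, p2, p3⟩ := h.surj ((l * h.m A + m * h.m B + j * h.m C - E) / n)
      ((l * h.u A + m * h.u B + j * h.u C) / n) ((l * h.v A + m * h.v B + j * h.v C) / n)
      (by
        field_simp
        have sA := h.surf A
        have sB := h.surf B
        have sC := h.surf C
        linear_combination l ^ 2 * sA + m ^ 2 * sB + j ^ 2 * sC + 2 * hQ' +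
          2 * (l * h.m A + m * h.m B + j * h.m C) * hE2 - E * hE2 + hE1)
      (by
        intro hk
        have hA := h.sheet A hk
        have hB := h.sheet B hk
        have hC := h.sheet C hk
        have : 1 - k * ((l * h.m A + m * h.m B + j * h.m C - E) / n) =
            (l * (1 - k * h.m A) + m * (1 - k * h.m B) + j * (1 - k * h.m C)) / n := by
          field_simp
          linear_combination -hE2
        rw [this]
        apply div_pos _ hn0
        have h1 := mul_nonneg hl hA.le
        have h2 := mul_nonneg hm hB.le
        have h3 := mul_nonneg hj hC.le
        rcases hl.eq_or_lt with h0 | h0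
        · rcases hm.eq_or_lt with h0' | h0'
          · have : 0 < j := by linarith
            have := mul_pos this hC
            linarith
          · have := mul_pos h0' hB
            linarith
        · have := mul_pos h0 hA
          linarith)
    refine ⟨P, hE2, fun Y => ?_⟩
    rw [h.md_d, h.md_d, h.md_d, h.md_d, p1, p2, p3]
    field_simp
    linear_combination h.m Y * hE2
  triangle_exists a b c ha hb hc h1 h2 h3 hk := by
    have hka : k * a ^ 2 ≤ π ^ 2 := mul_sq_le_of_le ha (by linarith) hk
    have hkb : k * b ^ 2 ≤ π ^ 2 := mul_sq_le_of_le hb (by linarith) hk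
    have hkc : k * c ^ 2 ≤ π ^ 2 := mul_sq_le_of_le hc (by linarith) hk
    -- C is put at the origin and B on the u-axis. The law of cosines prescribes the u-coordinate x
    -- of A. The triangle inequalities and the perimeter bound give |x| ≤ sn k b, so y exists. If sn
    -- k a = 0, the choice of x is free.
    obtain ⟨x, y, hxy, hx⟩ : ∃ x y : ℝ, x ^ 2 + y ^ 2 = sn k b ^ 2 ∧
        md k c = md k a + md k b - k * md k a * md k b - sn k a * x := by
      have e1 := md_sub_md k (a + b) c
      have e2 := md_sub_md k c (a - b)
      have p1 : 0 ≤ sn k ((a + b + c) / 2) := sn_nonneg (by linarith) hk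
      have p2 : 0 ≤ sn k ((a + b - c) / 2) := sn_nonneg (by linarith)
        (mul_sq_le_of_le (by linarith) (by linarith) hk)
      have p3 : 0 ≤ sn k ((c + (a - b)) / 2) := sn_nonneg (by linarith)
        (mul_sq_le_of_le (by linarith) (by linarith) hk)
      have p4 : 0 ≤ sn k ((c - (a - b)) / 2) := sn_nonneg (by linarith)
        (mul_sq_le_of_le (by linarith) (by linarith) hk)
      have q1 := mul_nonneg p1 p2
      have q2 := mul_nonneg p3 p4
      rw [md_add] at e1
      rw [md_sub] at e2
      set I := md k a + md k b - k * md k a * md k b - md k c with hI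
      have i1 : I ≤ sn k a * sn k b := by linarith
      have i2 : -(sn k a * sn k b) ≤ I := by linarith
      have sa := sn_nonneg ha hka
      have sb := sn_nonneg hb hkb
      rcases sa.eq_or_lt with h0 | h0
      · refine ⟨0, sn k b, by ring, ?_⟩
        rw [← h0] at i1 i2
        linarith
      · have j1 : I / sn k a ≤ sn k b := by rw [div_le_iff₀ h0]; linarith
        have j2 : -sn k b ≤ I / sn k a := by rw [le_div_iff₀ h0]; linarith
        refine ⟨I / sn k a, √(sn k b ^ 2 - (I / sn k a) ^ 2), ?_, ?_⟩
        · rw [sq_sqrt (by nlinarith)]; ring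
        · rw [mul_div_cancel₀ _ h0.ne']; linarith
    have sht : ∀ t, k ≤ 0 → 0 < 1 - k * md k t := fun t hk => by
      rw [← cs_eq]; linarith [cs_pos_of_nonpos hk t]
    obtain ⟨C, c1, c2, c3⟩ := h.surj 0 0 0 (by ring) (by simp)
    obtain ⟨B, b1, b2, b3⟩ := h.surj (md k a) (sn k a) 0 (by rw [sn_sq]; ring) (sht a)
    obtain ⟨A, a1, a2, a3⟩ := h.surj (md k b) x y (by rw [hxy, sn_sq]; ring) (sht b)
    refine ⟨A, B, C, ?_, ?_, ?_⟩
    · apply md_inj (h.d_nonneg _ _) ha (h.d_le _ _) hka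
      rw [h.md_d, b1, b2, b3, c1, c2, c3]; ring
    · apply md_inj (h.d_nonneg _ _) hb (h.d_le _ _) hkb
      rw [h.md_d, a1, a2, a3, c1, c2, c3]; ring
    · apply md_inj (h.d_nonneg _ _) hc (h.d_le _ _) hkc
      rw [h.md_d, a1, a2, a3, b1, b2, b3, hx]; ring

/-! ### Charts of the three model planes -/

/-- Coordinates of the Euclidean plane. -/
def euclideanChart : Chart 0 (modelPlane 0) := by
  have : modelPlane 0 = { carrier := EuclideanSpace ℝ (Fin 2), d := fun x y => dist x y } := by
    simp [modelPlane]
  rw [this]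
  exact
  { m := fun x => (x 0 ^ 2 + x 1 ^ 2) / 2
    u := fun x => x 0
    v := fun x => x 1
    surf := fun X => by ring
    sheet := fun X _ => by simp
    surj := fun m' u' v' h _ => ⟨!₂[u', v'], by simp; linarith, by simp, by simp⟩
    d_nonneg := fun X Y => dist_nonneg
    d_triangle := fun X Y Z => dist_triangle X Y Z
    d_le := fun X Y => by simp; positivity
    md_d := fun X Y => by
      simp only [md_zero_curv, EuclideanSpace.dist_sq_eq, Fin.sum_univ_two, Real.dist_eq, sq_abs]
      ring }

/-- Coordinates of the sphere of curvature `k > 0`. -/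
def sphereChart {k : ℝ} (hk : 0 < k) : Chart k (modelPlane k) := by
  have : modelPlane k =
      { carrier := Metric.sphere (0 : EuclideanSpace ℝ (Fin 3)) 1
        d := fun x y => InnerProductGeometry.angle x.1 y.1 / √k } := by
    simp [modelPlane, hk, hk.ne']
  rw [this]
  have hs : 0 < √k := sqrt_pos.2 hk
  have hs2 : √k ^ 2 = k := sq_sqrt hk.le
  have hnorm : ∀ X : Metric.sphere (0 : EuclideanSpace ℝ (Fin 3)) 1, ‖X.1‖ = 1 := fun X => by simp
  have hsq : ∀ X : Metric.sphere (0 : EuclideanSpace ℝ (Fin 3)) 1,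
      X.1 0 ^ 2 + X.1 1 ^ 2 + X.1 2 ^ 2 = 1 := by
    intro X
    have := EuclideanSpace.norm_sq_eq X.1
    rw [hnorm X, Fin.sum_univ_three] at this
    simpa using this.symm
  exact
  { m := fun x => (1 - x.1 0) / k
    u := fun x => x.1 1 / √k
    v := fun x => x.1 2 / √k
    surf := fun X => by
      have := hsq X
      rw [div_pow, div_pow, hs2]; field_simp; linear_combination this
    sheet := fun X h => absurd hk h.not_gt
    surj := fun m' u' v' h _ => by
      refine ⟨⟨!₂[1 - k * m', √k * u', √k * v'], ?_⟩, ?_, ?_, ?_⟩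
      · rw [mem_sphere_zero_iff_norm, ← sq_eq_sq₀ (norm_nonneg _) zero_le_one,
          EuclideanSpace.norm_sq_eq, Fin.sum_univ_three]
        simp [mul_pow, hs2]
        linear_combination k * h
      · simp; field_simp
      · simp; field_simp
      · simp; field_simp
    d_nonneg := fun X Y => div_nonneg (InnerProductGeometry.angle_nonneg _ _) hs.le
    d_triangle := fun X Y Z => by
      simp only
      rw [← add_div]
      gcongr
      exact InnerProductGeometry.angle_le_angle_add_angle _ _ _
    d_le := fun X Y => by
      simp only [div_pow, hs2]
      rw [mul_div_cancel₀ _ hk.ne']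
      exact pow_le_pow_left₀ (InnerProductGeometry.angle_nonneg _ _)
        (InnerProductGeometry.angle_le_pi _ _) 2
    md_d := fun X Y => by
      rw [md_pos_curv hk, mul_div_cancel₀ _ hs.ne', InnerProductGeometry.cos_angle, hnorm, hnorm]
      simp only [PiLp.inner_apply, Fin.sum_univ_three, RCLike.inner_apply, conj_trivial]
      generalize √k = r at *
      subst hs2
      field_simp
      ring }

/-- Coordinates of the hyperbolic plane of curvature `k < 0`. -/
def hyperbolicChart {k : ℝ} (hk : k < 0) : Chart k (modelPlane k) := by
  have : modelPlane k = { carrier := UpperHalfPlane, d := fun x y => dist x y / √(-k) } := by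
    simp [modelPlane, hk.le.not_gt, hk.ne]
  rw [this]
  have hs : 0 < √(-k) := sqrt_pos.2 (neg_pos.2 hk)
  have hs2 : √(-k) ^ 2 = -k := sq_sqrt_neg hk
  exact
  { m := fun z => (1 - (1 + z.re ^ 2 + z.im ^ 2) / (2 * z.im)) / k
    u := fun z => z.re / z.im / √(-k)
    v := fun z => (z.re ^ 2 + z.im ^ 2 - 1) / (2 * z.im) / √(-k)
    surf := fun z => by
      have := z.im_pos
      have hk' : k = -√(-k) ^ 2 := by linarith
      generalize √(-k) = r at *
      subst hk'
      field_simp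
      ring
    sheet := fun z _ => by
      have := z.im_pos
      rw [mul_div_cancel₀ _ hk.ne]
      have : 0 < (1 + z.re ^ 2 + z.im ^ 2) / (2 * z.im) := by positivity
      linarith
    surj := fun m' u' v' h h' => by
      have h1 := h' hk.le
      set w := 1 - k * m' with hw
      have hw2 : w ^ 2 = 1 + (√(-k) * u') ^ 2 + (√(-k) * v') ^ 2 := by
        rw [mul_pow, mul_pow, hs2, hw]; linear_combination k * h
      set U := √(-k) * u' with hU
      set V := √(-k) * v' with hV
      have hwV : 0 < w - V := by
        by_contra! hc
        nlinarith [sq_nonneg U]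
      have hm' : m' = (1 - w) / k := by rw [hw]; field_simp [hk.ne]; ring
      have hu' : u' = U / √(-k) := by rw [hU]; field_simp
      have hv' : v' = V / √(-k) := by rw [hV]; field_simp
      -- On the hyperboloid w - V equals 1 / im and U equals re / im, which inverts the coordinate
      -- map.
      refine ⟨⟨⟨U / (w - V), 1 / (w - V)⟩, by positivity⟩, ?_, ?_, ?_⟩
      · rw [hm']
        congr 1
        change 1 - (1 + (U / (w - V)) ^ 2 + (1 / (w - V)) ^ 2) / (2 * (1 / (w - V))) = _
        field_simp
        linear_combination hw2
      · rw [hu']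
        congr 1
        change U / (w - V) / (1 / (w - V)) = _
        field_simp
      · rw [hv']
        congr 1
        change ((U / (w - V)) ^ 2 + (1 / (w - V)) ^ 2 - 1) / (2 * (1 / (w - V))) = _
        field_simp
        linear_combination -hw2
    d_nonneg := fun X Y => div_nonneg dist_nonneg hs.le
    d_triangle := fun X Y Z => by
      simp only
      rw [← add_div]
      gcongr
      exact dist_triangle _ _ _
    d_le := fun X Y => by
      have : k * (dist X Y / √(-k)) ^ 2 ≤ 0 := mul_nonpos_of_nonpos_of_nonneg hk.le (by positivity)
      have : 0 ≤ π ^ 2 := by positivity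
      simp only
      linarith
    md_d := fun X Y => by
      have h1 := X.im_pos
      have h2 := Y.im_pos
      rw [md_neg_curv hk, mul_div_cancel₀ _ hs.ne', UpperHalfPlane.cosh_dist, dist_eq_norm,
        ← Complex.normSq_eq_norm_sq, Complex.normSq_apply]
      simp only [Complex.sub_re, Complex.sub_im, UpperHalfPlane.coe_re, UpperHalfPlane.coe_im]
      have hk' : k = -√(-k) ^ 2 := by linarith
      generalize √(-k) = r at *
      subst hk'
      field_simp
      ring }

theorem isModel_modelPlane (k : ℝ) : IsModel k (modelPlane k) := by
  rcases lt_trichotomy k 0 with hk | rfl | hk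
  · exact (hyperbolicChart hk).isModel
  · exact euclideanChart.isModel
  · exact (sphereChart hk).isModel

/-! ### Segments and inner products in the linear model -/

section

section Identities

/-- The point at distances p from B and q from C on a segment BC is (sn q · B + sn p · C) / sn
(p+q). This identity and the next three supply the length, the constant E, the distances to the
endpoints and the sum of the weights. -/
theorem seg_nsq (k p q : ℝ) :
    (sn k q + sn k p) ^ 2 - 2 * k * (sn k q * sn k p * md k (p + q)) = sn k (p + q) ^ 2 := by
  have h1 := sn_sq k p
  have h2 := sn_sq k q
  rw [md_add, sn_add, cs_eq, cs_eq]
  linear_combination -k * sn k p ^ 2 * h2 - k * sn k q ^ 2 * h1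

theorem seg_E (k p q : ℝ) :
    (sn k q * md k p + sn k p * md k q) * (sn k (p + q) + (sn k q + sn k p)) =
      2 * (sn k q * sn k p * md k (p + q)) := by
  have h1 := sn_sq k p
  have h2 := sn_sq k q
  rw [md_add, sn_add, cs_eq, cs_eq]
  linear_combination -sn k q ^ 2 * h1 - sn k p ^ 2 * h2

theorem seg_md (k p q : ℝ) : sn k p * md k (p + q) =
    sn k (p + q) * md k p + (sn k q * md k p + sn k p * md k q) := by
  have h1 := sn_sq k p
  rw [md_add, sn_add, cs_eq, cs_eq]
  linear_combination sn k q * h1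

theorem seg_sum (k p q : ℝ) : sn k q + sn k p =
    sn k (p + q) + k * (sn k q * md k p + sn k p * md k q) := by
  rw [sn_add, cs_eq, cs_eq]; ring

end Identities

theorem sn_add_sn_pos {k p q : ℝ} (hp : 0 ≤ p) (hq : 0 ≤ q) (h0 : 0 < p + q)
    (hk : k * (p + q) ^ 2 < π ^ 2) : 0 < sn k q + sn k p := by
  have h1 := sn_nonneg hp (mul_sq_lt_of_le hp (by linarith) hk).le
  have h2 := sn_nonneg hq (mul_sq_lt_of_le hq (by linarith) hk).le
  rcases hp.eq_or_lt with h | h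
  · have := sn_pos (t := q) (by linarith) (mul_sq_lt_of_le hq (by linarith) hk)
    linarith
  · have := sn_pos (t := p) h (mul_sq_lt_of_le hp (by linarith) hk)
    linarith

theorem nsq_two_pos {k a m j : ℝ} (ha : 0 < a) (hk : k * a ^ 2 < π ^ 2) (hm : 0 ≤ m) (hj : 0 ≤ j)
    (hmj : 0 < m + j) : 0 < (m + j) ^ 2 - 2 * k * (m * j * md k a) := by
  have h1 : (m + j) ^ 2 - 2 * k * (m * j * md k a) = (j + m * cs k a) ^ 2 +
      k * m ^ 2 * sn k a ^ 2 := by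
    rw [sn_sq, cs_eq]; ring
  rcases le_or_gt k 0 with hk0 | hk0
  · nlinarith [mul_nonneg (mul_nonneg hm hj) (md_nonneg k a)]
  · have hs := sn_pos ha hk
    rw [h1]
    rcases hm.eq_or_lt with h | h
    · subst h; simp at hmj ⊢; positivity
    · positivity

/-- No nonzero nonnegative combination of the vertices has zero or negative squared length. For k >
0 this reflects that a nondegenerate triangle of perimeter below 2 D_k lies in an open hemisphere.
-/
theorem nsq_pos {k a b c l m j : ℝ} (ha : 0 < a) (hb : 0 < b) (hc : 0 < c) (hca : c < a + b)
    (hk : k * ((a + b + c) / 2) ^ 2 < π ^ 2) (h1 : a ≤ b + c) (h2 : b ≤ a + c)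
    (hl : 0 ≤ l) (hm : 0 ≤ m) (hj : 0 ≤ j)
    (h0 : 0 < l + m + j) : 0 < nsq k a b c l m j := by
  have hka : k * a ^ 2 < π ^ 2 := mul_sq_lt_of_le ha.le (by linarith) hk
  have hkb : k * b ^ 2 < π ^ 2 := mul_sq_lt_of_le hb.le (by linarith) hk
  unfold nsq qf
  rcases hl.eq_or_lt with rfl | hl'
  · have := nsq_two_pos ha hka hm hj (by linarith)
    linarith
  rcases hm.eq_or_lt with rfl | hm'
  · have := nsq_two_pos hb hkb hl hj (by linarith)
    linarith
  rcases le_or_gt k 0 with hk0 | hk0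
  · have := mul_nonneg (mul_nonneg hl hm) (md_nonneg k c)
    have := mul_nonneg (mul_nonneg hm hj) (md_nonneg k a)
    have := mul_nonneg (mul_nonneg hl hj) (md_nonneg k b)
    nlinarith [sq_pos_of_pos h0]
  · have e := md_sub_md k (a + b) c
    have p1 : 0 < sn k ((a + b + c) / 2) := sn_pos (by linarith) hk
    have p2 : 0 < sn k ((a + b - c) / 2) := sn_pos (by linarith)
      (mul_sq_lt_of_le (by linarith) (by linarith) hk)
    -- The vector is split into its component along C and the part tangent at C. The last term is
    -- positive because c < a + b and the perimeter is less than 2 D_k.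
    have key : (l + m + j) ^ 2 - 2 * k * (l * m * md k c + m * j * md k a + l * j * md k b) =
        (j + m * cs k a + l * cs k b) ^ 2 + k * (m * sn k a - l * sn k b) ^ 2 +
        2 * k * (l * m * (md k (a + b) - md k c)) := by
      rw [md_add, cs_eq, cs_eq]
      linear_combination -k * m ^ 2 * sn_sq k a - k * l ^ 2 * sn_sq k b
    rw [key, e]
    have : 0 < l * m * (2 * (sn k ((a + b + c) / 2) * sn k ((a + b - c) / 2))) := by positivity
    positivity

/-- The inner product at `Z` of the tangent vectors towards `X` and `Y`, multiplied by the
generalized sines of the distances. -/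
def inn (k : ℝ) (M : Plane) (Z X Y : M.carrier) : ℝ :=
  md k (M.d Z X) + md k (M.d Z Y) - k * (md k (M.d Z X) * md k (M.d Z Y)) - md k (M.d X Y)

variable {k : ℝ} {M : Plane}

namespace IsModel

theorem d_congr (h : IsModel k M) {X Y : M.carrier} (hXY : M.d X Y = 0)
    (Z : M.carrier) : M.d X Z = M.d Y Z := by
  have h1 := h.d_triangle X Y Z
  have h2 := h.d_triangle Y X Z
  rw [h.d_comm Y X] at h2
  linarith

theorem md_d_eq_zero (h : IsModel k M) {X Y : M.carrier} (hXY : md k (M.d X Y) = 0) : M.d X Y = 0 :=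
  md_eq_zero (h.d_nonneg _ _) (h.d_le _ _) hXY

theorem inn_comm (h : IsModel k M) (Z X Y : M.carrier) : inn k M Z X Y = inn k M Z Y X := by
  unfold inn; rw [h.d_comm X Y]; ring

theorem inn_self (h : IsModel k M) (Z X : M.carrier) : inn k M Z X X = sn k (M.d Z X) ^ 2 := by
  unfold inn; rw [h.d_self, sn_sq]; simp; ring

theorem inn_base (h : IsModel k M) (Z Y : M.carrier) : inn k M Z Z Y = 0 := by
  unfold inn; rw [h.d_self]; simp

/-- The initial vector at Z towards P, scaled by sn, is the tangential part of P at Z, hence linear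
in P. -/
theorem comb_inn (h : IsModel k M) {A B C P : M.carrier} {l m j n E : ℝ}
    (hP : Comb k M A B C P l m j n E)
    (Z Y : M.carrier) :
    n * inn k M Z P Y = l * inn k M Z A Y + m * inn k M Z B Y + j * inn k M Z C Y := by
  have h1 := hP.1
  have h2 := hP.2 Z
  have h3 := hP.2 Y
  unfold inn
  rw [h.d_comm A Z, h.d_comm B Z, h.d_comm C Z, h.d_comm P Z] at h2
  linear_combination h3 - h2 * (1 - k * md k (M.d Z Y)) - md k (M.d Z Y) * h1

/-- The value of `E` and the vertex distances. -/
theorem comb_values (h : IsModel k M) {A B C P : M.carrier} {l m j n E : ℝ}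
    (hP : Comb k M A B C P l m j n E) :
    E = l * md k (M.d P A) + m * md k (M.d P B) + j * md k (M.d P C) ∧
    m * md k (M.d A B) + j * md k (M.d A C) = n * md k (M.d P A) + E ∧
    l * md k (M.d A B) + j * md k (M.d B C) = n * md k (M.d P B) + E ∧
    l * md k (M.d A C) + m * md k (M.d B C) = n * md k (M.d P C) + E := by
  have h1 := hP.2 P
  have h2 := hP.2 A
  have h3 := hP.2 B
  have h4 := hP.2 C
  simp only [h.d_self, md_zero, h.d_comm A P, h.d_comm B P, h.d_comm C P, h.d_comm B A,
    h.d_comm C A, h.d_comm C B] at h1 h2 h3 h4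
  refine ⟨by linarith, by linarith, by linarith, by linarith⟩

/-- Evaluating `Comb` at A, B, C and P and eliminating the distances from P shows that, for n > 0
and a positive total weight, n and E depend only on weights and sides. This makes P unique up to
distance zero. -/
theorem comb_nE (h : IsModel k M) {A B C P : M.carrier} {l m j n E : ℝ}
    (hP : Comb k M A B C P l m j n E) :
    E * (n + (l + m + j)) = 2 * qf k (M.d B C) (M.d A C) (M.d A B) l m j ∧
    n ^ 2 = nsq k (M.d B C) (M.d A C) (M.d A B) l m j := by
  obtain ⟨h1, h2, h3, h4⟩ := h.comb_values hP
  have h5 : E * (n + (l + m + j)) = 2 * qf k (M.d B C) (M.d A C) (M.d A B) l m j := by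
    unfold qf
    linear_combination n * h1 - l * h2 - m * h3 - j * h4
  refine ⟨h5, ?_⟩
  unfold nsq
  linear_combination -k * h5 - (n + (l + m + j)) * hP.1

theorem comb_eq_values (h : IsModel k M) {A B C P : M.carrier} {l m j n E : ℝ}
    (hP : Comb k M A B C P l m j n E)
    (hn : 0 < n) (h0 : 0 < l + m + j) :
    n = √(nsq k (M.d B C) (M.d A C) (M.d A B) l m j) ∧
    E = 2 * qf k (M.d B C) (M.d A C) (M.d A B) l m j /
        (√(nsq k (M.d B C) (M.d A C) (M.d A B) l m j) + (l + m + j)) := by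
  obtain ⟨h1, h2⟩ := h.comb_nE hP
  have : √(nsq k (M.d B C) (M.d A C) (M.d A B) l m j) = n := by rw [← h2, sqrt_sq hn.le]
  refine ⟨this.symm, ?_⟩
  rw [this, ← h1]
  field_simp

theorem comb_unique (h : IsModel k M) {A B C P P' : M.carrier} {l m j n n' E E' : ℝ}
    (hP : Comb k M A B C P l m j n E) (hP' : Comb k M A B C P' l m j n' E')
    (hn : 0 < n) (hn' : 0 < n') (h0 : 0 < l + m + j) : M.d P P' = 0 := by
  obtain ⟨e1, e2⟩ := h.comb_eq_values hP hn h0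
  obtain ⟨e3, e4⟩ := h.comb_eq_values hP' hn' h0
  have h1 := hP.2 P'
  have h2 := hP'.2 P'
  have hE : E = E' := by rw [e2, e4]
  rw [h.d_self, md_zero, h1] at h2
  apply h.md_d_eq_zero
  have : n * md k (M.d P P') = 0 := by linarith
  exact (mul_eq_zero.1 this).resolve_left (ne_of_gt hn)

/-- The point of a segment at given distances from the ends. -/
theorem exists_point (h : IsModel k M) (X B C : M.carrier) {p q : ℝ} (hp : 0 ≤ p) (hq : 0 ≤ q)
    (hpq : p + q = M.d B C) (h0 : 0 < M.d B C) (hk : k * M.d B C ^ 2 < π ^ 2) :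
    ∃ D, M.d B D = p ∧ M.d D C = q ∧
      Comb k M X B C D 0 (sn k q) (sn k p) (sn k (M.d B C))
        (sn k q * md k p + sn k p * md k q) := by
  have hs := sn_pos h0 hk
  have hkp : k * p ^ 2 ≤ π ^ 2 := (mul_sq_lt_of_le hp (by linarith) hk).le
  have hkq : k * q ^ 2 ≤ π ^ 2 := (mul_sq_lt_of_le hq (by linarith) hk).le
  have hsp := sn_nonneg hp hkp
  have hsq := sn_nonneg hq hkq
  have hsum := sn_add_sn_pos hp hq (by rwa [hpq]) (by rwa [hpq])
  have hnsq : nsq k (M.d B C) (M.d B C) (M.d B B) 0 (sn k q) (sn k p) = sn k (M.d B C) ^ 2 := by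
    unfold nsq qf
    rw [← hpq, ← seg_nsq]; ring
  obtain ⟨D, hD⟩ := h.comb_exists B B C 0 (sn k q) (sn k p) le_rfl hsq hsp (by linarith)
    (by rw [hnsq]; positivity)
  rw [hnsq, sqrt_sq hs.le] at hD
  have hE : 2 * qf k (M.d B C) (M.d B C) (M.d B B) 0 (sn k q) (sn k p) /
      (sn k (M.d B C) + (0 + sn k q + sn k p)) = sn k q * md k p + sn k p * md k q := by
    rw [div_eq_iff (by linarith)]
    have := seg_E k p q
    rw [hpq] at this
    unfold qf
    linear_combination -this
  rw [hE] at hD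
  have hB := hD.2 B
  have hC := hD.2 C
  have e1 := seg_md k p q
  have e2 := seg_md k q p
  rw [add_comm q p] at e2
  rw [hpq] at e1 e2
  rw [h.d_self, h.d_comm C B, md_zero] at hB
  rw [h.d_self, md_zero] at hC
  refine ⟨D, ?_, ?_, ?_⟩
  · rw [h.d_comm]
    apply md_inj (h.d_nonneg _ _) hp (h.d_le _ _) hkp
    apply mul_left_cancel₀ hs.ne'
    linarith
  · apply md_inj (h.d_nonneg _ _) hq (h.d_le _ _) hkq
    apply mul_left_cancel₀ hs.ne'
    linarith
  · refine ⟨by simpa using hD.1, fun Y => by simpa using hD.2 Y⟩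

theorem comb_of_between (h : IsModel k M) (X : M.carrier) {B D C : M.carrier} (hD : M.Between B D C)
    (h0 : 0 < M.d B C) (hk : k * M.d B C ^ 2 < π ^ 2) :
    Comb k M X B C D 0 (sn k (M.d D C)) (sn k (M.d B D)) (sn k (M.d B C))
        (sn k (M.d D C) * md k (M.d B D) + sn k (M.d B D) * md k (M.d D C)) := by
  obtain ⟨D', h1, h2, h3⟩ := h.exists_point X B C (h.d_nonneg B D) (h.d_nonneg D C) hD h0 hk
  have hs := sn_pos h0 hk
  have h4 : M.d D' D = 0 := by
    apply h.md_d_eq_zero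
    have := h3.2 D
    rw [h.d_comm C D] at this
    have : sn k (M.d B C) * md k (M.d D' D) = 0 := by linarith
    exact (mul_eq_zero.1 this).resolve_left hs.ne'
  refine ⟨h3.1, fun Y => ?_⟩
  rw [← h.d_congr h4 Y]
  exact h3.2 Y

/-- At D the tangent vectors towards B and C cancel with nonnegative weights. If both weights are
positive, the directions are opposite, and the law of cosines at D degenerates to the addition
formula for `md`. -/
theorem between_of_comb (h : IsModel k M) {X B D C : M.carrier} {m j n E : ℝ}
    (hD : Comb k M X B C D 0 m j n E)
    (hm : 0 ≤ m) (hj : 0 ≤ j) (hn : 0 < n) (hmj : 0 < m + j) (hk : k * M.d B C ^ 2 < π ^ 2) :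
    M.Between B D C := by
  have c1 := hD.1
  have cB := hD.2 B
  have cC := hD.2 C
  have cD := hD.2 D
  have i1 := h.comb_inn hD D B
  have i2 := h.comb_inn hD D C
  rw [h.inn_base, h.inn_self, h.inn_comm D C B] at i1
  rw [h.inn_base, h.inn_self] at i2
  simp only [h.d_self, md_zero, h.d_comm B D, h.d_comm C D, h.d_comm C B] at cB cC cD
  unfold Plane.Between
  rcases hm.eq_or_lt with h0 | h0
  · subst h0
    have : (n + j) * md k (M.d D C) = 0 := by linarith
    have h1 := h.md_d_eq_zero ((mul_eq_zero.1 this).resolve_left (by linarith))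
    rw [h1, h.d_comm B D, h.d_congr h1 B, h.d_comm C B, add_zero]
  rcases hj.eq_or_lt with h0' | h0'
  · subst h0'
    have : (n + m) * md k (M.d D B) = 0 := by linarith
    have h1 := h.md_d_eq_zero ((mul_eq_zero.1 this).resolve_left (by linarith))
    rw [h.d_comm B D, h1, h.d_congr h1 C, zero_add]
  set p := M.d D B with hp
  set q := M.d D C with hq
  have p0 : 0 ≤ p := h.d_nonneg _ _
  have q0 : 0 ≤ q := h.d_nonneg _ _
  have sp := sn_nonneg p0 (h.d_le D B)
  have sq := sn_nonneg q0 (h.d_le D C)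
  have hI : inn k M D B C = -(sn k p * sn k q) := by
    have e1 : inn k M D B C ^ 2 = (sn k p * sn k q) ^ 2 := by
      apply mul_left_cancel₀ (mul_pos h0 h0').ne'
      linear_combination -(j * inn k M D B C) * i2 + j * sn k q ^ 2 * i1
    rcases sq_eq_sq_iff_eq_or_eq_neg.1 e1 with e2 | e2
    · rw [e2] at i1 i2
      have e3 := mul_nonneg sp sq
      have : j * (sn k p * sn k q) = 0 := by
        linarith [mul_nonneg hm (sq_nonneg (sn k p)), mul_nonneg hj e3]
      have := (mul_eq_zero.1 this).resolve_left h0'.ne'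
      rw [e2, this]; simp
    · exact e2
  unfold inn at hI
  have hmd : md k (M.d B C) = md k (p + q) := by rw [md_add]; linarith
  -- Equality of `md` yields equality of lengths only if p + q ≤ D_k. For k > 0 this follows from cs
  -- p + cs q > 0, a product of cosines of the half-sum and half-difference.
  have hpq : k * (p + q) ^ 2 ≤ π ^ 2 := by
    rcases le_or_gt k 0 with hk0 | hk0
    · nlinarith [sq_nonneg (p + q), pi_pos]
    have e1 : n * (cs k p + cs k q) = (m + j) * (1 + cs k (M.d B C)) := by
      rw [cs_eq, cs_eq, cs_eq]
      linear_combination k * cB + k * cC - 2 * c1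
    have e2 : 0 < 1 + cs k (M.d B C) := by
      have h1 := cs_sq k (M.d B C)
      by_contra! h2
      rcases (h.d_nonneg B C).eq_or_lt with h3 | h3
      · rw [← h3] at h2; norm_num at h2
      · have h4 := sn_pos h3 hk
        nlinarith [mul_pos hk0 (sq_pos_of_pos h4)]
    have e3 : 0 < cs k p + cs k q := by
      have := mul_pos hmj e2
      rw [← e1] at this
      exact pos_of_mul_pos_right this hn.le
    have h1 := sqrt_mul_le_pi hk0 (h.d_le D B)
    have h2 := sqrt_mul_le_pi hk0 (h.d_le D C)
    have h3 : 0 ≤ √k * p := by positivity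
    have h4 : 0 ≤ √k * q := by positivity
    rw [cs_pos_curv hk0, cs_pos_curv hk0, cos_add_cos] at e3
    have h5 : 0 ≤ cos ((√k * p - √k * q) / 2) := by
      apply cos_nonneg_of_neg_pi_div_two_le_of_le <;> linarith
    have h6 : (√k * p + √k * q) / 2 < π / 2 := by
      by_contra! h7
      have : cos ((√k * p + √k * q) / 2) ≤ 0 :=
        cos_nonpos_of_pi_div_two_le_of_le h7 (by linarith)
      nlinarith
    have : √k * (p + q) ≤ π := by linarith
    calc k * (p + q) ^ 2 = (√k * (p + q)) ^ 2 := by rw [mul_pow, sq_sqrt hk0.le]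
      _ ≤ π ^ 2 := pow_le_pow_left₀ (by positivity) this 2
  rw [h.d_comm B D]
  exact (md_inj (h.d_nonneg _ _) (by linarith) (h.d_le _ _) hpq hmd).symm

end IsModel

end

/-! ### Solid triangles and barycentric weights -/

section

/-- `a, b, c` are the sides of a nondegenerate triangle of perimeter less than `2 D_k`. -/
structure Nondeg (a b c k : ℝ) : Prop where
  a_pos : 0 < a
  b_pos : 0 < b
  c_pos : 0 < c
  a_lt : a < b + c
  b_lt : b < a + c
  c_lt : c < a + b
  perim : k * ((a + b + c) / 2) ^ 2 < π ^ 2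

namespace Nondeg

variable {a b c k : ℝ}
theorem swap (h : Nondeg a b c k) : Nondeg b a c k :=
  ⟨h.b_pos, h.a_pos, h.c_pos, h.b_lt, h.a_lt, by linarith [h.c_lt], by
    rw [show b + a + c = a + b + c by ring]; exact h.perim⟩

theorem swap' (h : Nondeg a b c k) : Nondeg a c b k :=
  ⟨h.a_pos, h.c_pos, h.b_pos, by linarith [h.a_lt], h.c_lt, h.b_lt, by
    rw [show a + c + b = a + b + c by ring]; exact h.perim⟩

theorem ka (h : Nondeg a b c k) : k * a ^ 2 < π ^ 2 :=
  mul_sq_lt_of_le h.a_pos.le (by linarith [h.a_lt]) h.perim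

theorem kb (h : Nondeg a b c k) : k * b ^ 2 < π ^ 2 := h.swap.ka

theorem kc (h : Nondeg a b c k) : k * c ^ 2 < π ^ 2 := h.swap'.swap.ka

theorem of_le (h : Nondeg a b c k) {k' : ℝ} (hk : k' ≤ k) : Nondeg a b c k' :=
  { h with perim := (mul_le_mul_of_nonneg_right hk (sq_nonneg _)).trans_lt h.perim }

theorem nsq_pos (h : Nondeg a b c k) {l m j : ℝ} (hl : 0 ≤ l) (hm : 0 ≤ m) (hj : 0 ≤ j)
    (h0 : 0 < l + m + j) :
    0 < nsq k a b c l m j :=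
  TripleCurv.nsq_pos h.a_pos h.b_pos h.c_pos h.c_lt h.perim h.a_lt.le h.b_lt.le hl hm hj h0

end Nondeg

variable {k : ℝ} {M : Plane}

theorem Comb.scale {A B C P : M.carrier} {l m j n E : ℝ} (hP : Comb k M A B C P l m j n E)
    (t : ℝ) : Comb k M A B C P (t * l) (t * m) (t * j) (t * n) (t * E) :=
  ⟨by linear_combination t * hP.1, fun Y => by linear_combination t * hP.2 Y⟩

namespace IsModel

/-- Distances from a vertex to the points of the opposite side. -/
theorem cevian_bounds (h : IsModel k M) {a b c : ℝ} {A B C D : M.carrier} (hnd : Nondeg a b c k)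
    (hT : M.IsTriangle a b c A B C) (hD : M.Between B D C) :
    0 < M.d A D ∧ k * M.d A D ^ 2 < π ^ 2 := by
  obtain ⟨h1, h2, h3⟩ := hT
  unfold Plane.Between at hD
  rw [h1] at hD
  constructor
  · refine (h.d_nonneg A D).lt_of_ne fun h0 => ?_
    have e1 := h.d_congr h0.symm B
    have e2 := h.d_congr h0.symm C
    rw [h.d_comm D B] at e1
    linarith [hnd.a_lt]
  · refine mul_sq_lt_of_le (h.d_nonneg A D) ?_ hnd.perim
    have e1 := h.d_triangle A B D
    have e2 := h.d_triangle A C D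
    rw [h.d_comm C D] at e2
    linarith

/-- A point of the solid triangle is a combination of A and D, and D of B and C. Substituting one
into the other and rescaling gives weights of sum 1. -/
theorem comb_of_solid (h : IsModel k M) {a b c : ℝ} {A B C P : M.carrier} (hnd : Nondeg a b c k)
    (hT : M.IsTriangle a b c A B C) (hP : P ∈ M.solidTriangle A B C) :
    ∃ l m j n E, 0 ≤ l ∧ 0 ≤ m ∧ 0 ≤ j ∧ l + m + j = 1 ∧ 0 < n ∧ Comb k M A B C P l m j n E := by
  obtain ⟨D, hD, hP⟩ := hP
  obtain ⟨hh, hkh⟩ := h.cevian_bounds hnd hT hD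
  have hBC : M.d B C = a := hT.1
  have c1 := h.comb_of_between A hD (hBC ▸ hnd.a_pos) (hBC ▸ hnd.ka)
  have c2 := h.comb_of_between A hP hh hkh
  have hsD : 0 < sn k (M.d B C) := sn_pos (hBC ▸ hnd.a_pos) (hBC ▸ hnd.ka)
  have hsh : 0 < sn k (M.d A D) := sn_pos hh hkh
  have n1 := sn_nonneg (h.d_nonneg B D) (h.d_le B D)
  have n2 := sn_nonneg (h.d_nonneg D C) (h.d_le D C)
  have n3 := sn_nonneg (h.d_nonneg A P) (h.d_le A P)
  have n4 := sn_nonneg (h.d_nonneg P D) (h.d_le P D)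
  have s1 := sn_add_sn_pos (k := k) (h.d_nonneg B D) (h.d_nonneg D C)
    (by rw [hD, hBC]; exact hnd.a_pos) (by rw [hD, hBC]; exact hnd.ka)
  have s2 := sn_add_sn_pos (k := k) (h.d_nonneg A P) (h.d_nonneg P D)
    (by rw [hP]; exact hh) (by rw [hP]; exact hkh)
  set p := sn k (M.d B D)
  set q := sn k (M.d D C)
  set x := sn k (M.d A P)
  set y := sn k (M.d P D)
  have c3 : Comb k M A B C P (sn k (M.d B C) * y) (x * q) (x * p) (sn k (M.d B C) * sn k (M.d A D))
      (sn k (M.d B C) * (y * md k (M.d A P) + x * md k (M.d P D)) +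
        x * (q * md k (M.d B D) + p * md k (M.d D C))) := by
    refine ⟨?_, fun Y => ?_⟩
    · linear_combination sn k (M.d B C) * c2.1 + x * c1.1
    · linear_combination sn k (M.d B C) * c2.2 Y + x * c1.2 Y
  have hsum : 0 < sn k (M.d B C) * y + x * q + x * p := by
    rcases n3.eq_or_lt with h0 | h0
    · rw [← h0] at s2 ⊢
      have : 0 < sn k (M.d B C) * y := mul_pos hsD (by linarith)
      linarith
    · have := mul_pos h0 s1
      have := mul_nonneg hsD.le n4
      linarith
  have c4 := c3.scale (sn k (M.d B C) * y + x * q + x * p)⁻¹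
  refine ⟨_, _, _, _, _, by positivity, by positivity, by positivity, ?_, by positivity, c4⟩
  field_simp

/-- The point where the ray from `A` through `P` meets the opposite side. -/
theorem exists_cevian (h : IsModel k M) {a b c : ℝ} {A B C P : M.carrier} (hnd : Nondeg a b c k)
    (hT : M.IsTriangle a b c A B C) {l m j n E : ℝ} (hl : 0 ≤ l) (hm : 0 ≤ m) (hj : 0 ≤ j)
    (hmj : 0 < m + j) (hn : 0 < n) (hP : Comb k M A B C P l m j n E) :
    ∃ D n' E', M.Between B D C ∧ M.Between A P D ∧ 0 < n' ∧ Comb k M A B C D 0 m j n' E' := by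
  have hBC : M.d B C = a := hT.1
  have n1 : 0 < nsq k (M.d B C) (M.d B C) (M.d B B) 0 m j := by
    have := nsq_two_pos (hBC ▸ hnd.a_pos) (hBC ▸ hnd.ka) hm hj hmj
    unfold nsq qf
    linarith
  obtain ⟨D, hD⟩ := h.comb_exists B B C 0 m j le_rfl hm hj (by linarith) n1
  have hDb : M.Between B D C :=
    h.between_of_comb hD hm hj (sqrt_pos.2 n1) hmj (hBC ▸ hnd.ka)
  obtain ⟨hh, hkh⟩ := h.cevian_bounds hnd hT hDb
  set n' := √(nsq k (M.d B C) (M.d B C) (M.d B B) 0 m j)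
  have hn' : 0 < n' := sqrt_pos.2 n1
  have n2 : 0 < nsq k (M.d A D) (M.d A D) (M.d A A) 0 l n' := by
    have := nsq_two_pos hh hkh hl hn'.le (by linarith)
    unfold nsq qf
    linarith
  -- Since m B + j C = n' D in the linear model, l A + m B + j C = l A + n' D. So P lies on the
  -- segment AD by uniqueness.
  obtain ⟨P', hP'⟩ := h.comb_exists A A D 0 l n' le_rfl hl hn'.le (by linarith) n2
  have hPb : M.Between A P' D :=
    h.between_of_comb hP' hl hn'.le (sqrt_pos.2 n2) (by linarith) hkh
  have hc : Comb k M A B C P' l m j √(nsq k (M.d A D) (M.d A D) (M.d A A) 0 l n')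
      (2 * qf k (M.d A D) (M.d A D) (M.d A A) 0 l n' /
        (√(nsq k (M.d A D) (M.d A D) (M.d A A) 0 l n') + (0 + l + n')) +
      2 * qf k (M.d B C) (M.d B C) (M.d B B) 0 m j / (n' + (0 + m + j))) := by
    refine ⟨?_, fun Y => ?_⟩
    · linear_combination hP'.1 + hD.1
    · linear_combination hP'.2 Y + hD.2 Y
  have e := h.comb_unique hP hc hn (sqrt_pos.2 n2) (by linarith)
  refine ⟨D, n', _, hDb, ?_, hn', hD.1, fun Y => by linear_combination hD.2 Y⟩
  unfold Plane.Between at hPb ⊢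
  rw [h.d_congr e D, h.d_comm A P, h.d_congr e A, h.d_comm P' A, hPb]

theorem solid_of_comb (h : IsModel k M) {a b c : ℝ} {A B C P : M.carrier} (hnd : Nondeg a b c k)
    (hT : M.IsTriangle a b c A B C) {l m j n E : ℝ} (hl : 0 ≤ l) (hm : 0 ≤ m) (hj : 0 ≤ j)
    (h0 : 0 < l + m + j) (hn : 0 < n) (hP : Comb k M A B C P l m j n E) :
    P ∈ M.solidTriangle A B C := by
  rcases (add_nonneg hm hj).eq_or_lt with h1 | h1
  · have hm0 : m = 0 := by linarith
    have hj0 : j = 0 := by linarith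
    subst hm0 hj0
    have e1 := hP.2 A
    have e2 := hP.2 P
    rw [h.d_self, md_zero, h.d_comm A P] at e2
    rw [h.d_self, md_zero] at e1
    have : (n + l) * md k (M.d P A) = 0 := by linarith
    have e3 := h.md_d_eq_zero ((mul_eq_zero.1 this).resolve_left (by linarith))
    refine ⟨B, ?_, ?_⟩
    · unfold Plane.Between; rw [h.d_self, zero_add]
    · unfold Plane.Between
      rw [h.d_congr e3 B, h.d_comm A P, e3, zero_add]
  · obtain ⟨D, n', E', hD, hPD, -⟩ := h.exists_cevian hnd hT hl hm hj h1 hn hP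
    exact ⟨D, hD, hPD⟩

/-- Walking from `Z` towards `D`. -/
theorem exists_walk (h : IsModel k M) {Z D : M.carrier} (h0 : 0 < M.d Z D)
    (hk : k * M.d Z D ^ 2 < π ^ 2) {ε : ℝ}
    (hε : 0 ≤ ε) (hε' : ε ≤ M.d Z D) :
    ∃ P, M.Between Z P D ∧ M.d Z P = ε ∧ M.d P D = M.d Z D - ε ∧
      (∀ X, Comb k M X Z D P 0 (sn k (M.d Z D - ε)) (sn k ε) (sn k (M.d Z D))
        (sn k (M.d Z D - ε) * md k ε + sn k ε * md k (M.d Z D - ε))) ∧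
      ∀ Y, md k (M.d P Y) = md k ε + md k (M.d Z Y) - k * (md k ε * md k (M.d Z Y)) -
        sn k ε * (inn k M Z D Y / sn k (M.d Z D)) := by
  obtain ⟨P, h1, h2, h3⟩ := h.exists_point Z Z D hε (sub_nonneg.2 hε') (by ring) h0 hk
  have hs := sn_pos h0 hk
  refine ⟨P, by unfold Plane.Between; rw [h1, h2]; ring, h1, h2, fun X => ⟨h3.1, fun Y => ?_⟩,
    fun Y => ?_⟩
  · have := h3.2 Y
    linarith
  · have e := h.comb_inn h3 Z Y
    rw [h.inn_base] at e
    have e2 : inn k M Z P Y = sn k ε * (inn k M Z D Y / sn k (M.d Z D)) := by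
      field_simp
      linear_combination e
    unfold inn at e2
    rw [h1] at e2
    unfold inn
    linarith

end IsModel

/-! ### The sum of distances as a function on the simplex -/

/-- The value of the modified distance from `P = l A + m B + j C` to the first vertex. -/
def legMd (k a b c l m j : ℝ) : ℝ :=
  (m * md k c + j * md k b - 2 * qf k a b c l m j / (√(nsq k a b c l m j) + (l + m + j))) /
    √(nsq k a b c l m j)

/-- The sum of distances to the vertices as a function of the barycentric coordinates. -/
def sumDist (a b c k : ℝ) (p : Fin 3 → ℝ) : ℝ :=
  amd k (legMd k a b c (p 0) (p 1) (p 2)) + amd k (legMd k b a c (p 1) (p 0) (p 2)) +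
    amd k (legMd k c b a (p 2) (p 1) (p 0))

theorem qf_swap (k a b c l m j : ℝ) : qf k b a c m l j = qf k a b c l m j := by
  unfold qf; ring

theorem qf_swap' (k a b c l m j : ℝ) : qf k c b a j m l = qf k a b c l m j := by
  unfold qf; ring

theorem nsq_swap (k a b c l m j : ℝ) : nsq k b a c m l j = nsq k a b c l m j := by
  unfold nsq; rw [qf_swap]; ring

theorem nsq_swap' (k a b c l m j : ℝ) : nsq k c b a j m l = nsq k a b c l m j := by
  unfold nsq; rw [qf_swap']; ring

theorem IsModel.sum_eq_sumDist (h : IsModel k M) {a b c : ℝ} {A B C P : M.carrier}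
    (hT : M.IsTriangle a b c A B C) {l m j n E : ℝ} (h0 : 0 < l + m + j) (hn : 0 < n)
    (hP : Comb k M A B C P l m j n E) :
    M.d P A = amd k (legMd k a b c l m j) ∧ M.d P B = amd k (legMd k b a c m l j) ∧
    M.d P C = amd k (legMd k c b a j m l) := by
  obtain ⟨e1, e2⟩ := h.comb_eq_values hP hn h0
  obtain ⟨v1, v2, v3, v4⟩ := h.comb_values hP
  obtain ⟨t1, t2, t3⟩ := hT
  rw [t1, t2, t3] at e1 e2
  rw [← e1] at e2
  rw [t3, t2] at v2
  rw [t3, t1] at v3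
  rw [t2, t1] at v4
  have hA : md k (M.d P A) = legMd k a b c l m j := by
    unfold legMd; rw [← e1, ← e2]; field_simp; linarith
  have hB : md k (M.d P B) = legMd k b a c m l j := by
    unfold legMd; rw [nsq_swap, qf_swap, show m + l + j = l + m + j by ring, ← e1,
      ← e2]; field_simp; linarith
  have hC : md k (M.d P C) = legMd k c b a j m l := by
    unfold legMd; rw [nsq_swap', qf_swap', show j + m + l = l + m + j by ring, ← e1,
      ← e2]; field_simp; linarith
  rw [← hA, ← hB, ← hC, amd_md (h.d_nonneg _ _) (h.d_le _ _),
    amd_md (h.d_nonneg _ _) (h.d_le _ _), amd_md (h.d_nonneg _ _) (h.d_le _ _)]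
  exact ⟨rfl, rfl, rfl⟩

theorem Nondeg.triangle_exists {a b c : ℝ} (hnd : Nondeg a b c k) (h : IsModel k M) :
    ∃ A B C, M.IsTriangle a b c A B C :=
  h.triangle_exists a b c hnd.a_pos.le hnd.b_pos.le hnd.c_pos.le hnd.a_lt.le hnd.b_lt.le hnd.c_lt.le
    hnd.perim.le

/-- The sums depend only on the weights, not on the chosen triangle. So the infimum over all
triangles is one over the simplex, a compact set independent of k. -/
theorem steiner_set_eq {a b c : ℝ} (hnd : Nondeg a b c k) :
    {s : ℝ | ∃ A B C P : (modelPlane k).carrier, (modelPlane k).IsTriangle a b c A B C ∧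
      P ∈ (modelPlane k).solidTriangle A B C ∧
      s = (modelPlane k).d P A + (modelPlane k).d P B + (modelPlane k).d P C} =
    sumDist a b c k '' stdSimplex ℝ (Fin 3) := by
  have h := isModel_modelPlane k
  ext s
  constructor
  · rintro ⟨A, B, C, P, hT, hP, rfl⟩
    obtain ⟨l, m, j, n, E, hl, hm, hj, hs, hn, hc⟩ := h.comb_of_solid hnd hT hP
    obtain ⟨e1, e2, e3⟩ := h.sum_eq_sumDist hT (by linarith) hn hc
    refine ⟨![l, m, j], ⟨?_, ?_⟩, ?_⟩
    · intro i; fin_cases i <;> simpa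
    · simpa [Fin.sum_univ_three] using hs
    · rw [e1, e2, e3]; simp [sumDist]
  · rintro ⟨p, ⟨hp, hs⟩, rfl⟩
    rw [Fin.sum_univ_three] at hs
    obtain ⟨A, B, C, hT⟩ := hnd.triangle_exists h
    have hn := hnd.nsq_pos (hp 0) (hp 1) (hp 2) (by linarith)
    have hn' := hn
    obtain ⟨t1, t2, t3⟩ := hT
    rw [← t1, ← t2, ← t3] at hn'
    obtain ⟨P, hP⟩ := h.comb_exists A B C _ _ _ (hp 0) (hp 1) (hp 2) (by linarith) hn'
    obtain ⟨e1, e2, e3⟩ := h.sum_eq_sumDist ⟨t1, t2, t3⟩ (by linarith) (sqrt_pos.2 hn') hP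
    refine ⟨A, B, C, P, ⟨t1, t2, t3⟩, h.solid_of_comb hnd ⟨t1, t2, t3⟩ (hp 0) (hp 1) (hp 2)
      (by linarith) (sqrt_pos.2 hn') hP, ?_⟩
    rw [e1, e2, e3]; rfl

theorem steiner_eq {a b c : ℝ} (hnd : Nondeg a b c k) :
    steiner a b c k = sInf (sumDist a b c k '' stdSimplex ℝ (Fin 3)) := by
  rw [steiner, steiner_set_eq hnd]

theorem continuousOn_sumDist (a b c : ℝ) :
    ContinuousOn (fun q : ℝ × (Fin 3 → ℝ) => sumDist a b c q.1 q.2)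
      ({k | Nondeg a b c k} ×ˢ stdSimplex ℝ (Fin 3)) := by
  have key : ∀ a b c : ℝ, ∀ i i' i'' : Fin 3, (∀ q ∈ {k | Nondeg a b c k} ×ˢ stdSimplex ℝ (Fin 3),
      0 < nsq q.1 a b c (q.2 i) (q.2 i') (q.2 i'') ∧ 0 < q.2 i + q.2 i' + q.2 i'') →
      ContinuousOn (fun q : ℝ × (Fin 3 → ℝ) => amd q.1 (legMd q.1 a b c (q.2 i) (q.2 i') (q.2 i'')))
      ({k | Nondeg a b c k} ×ˢ stdSimplex ℝ (Fin 3)) := by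
    intro a b c i i' i'' hpos
    have ca : Continuous fun q : ℝ × (Fin 3 → ℝ) => md q.1 a :=
      (continuous_md_curv a).comp continuous_fst
    have cb : Continuous fun q : ℝ × (Fin 3 → ℝ) => md q.1 b :=
      (continuous_md_curv b).comp continuous_fst
    have cc : Continuous fun q : ℝ × (Fin 3 → ℝ) => md q.1 c :=
      (continuous_md_curv c).comp continuous_fst
    have cq : Continuous fun q : ℝ × (Fin 3 → ℝ) => qf q.1 a b c (q.2 i) (q.2 i') (q.2 i'') := by
      unfold qf; fun_prop
    have cn : Continuous fun q : ℝ × (Fin 3 → ℝ) => √(nsq q.1 a b c (q.2 i) (q.2 i') (q.2 i'')) := by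
      unfold nsq; fun_prop
    refine continuous_amd.comp_continuousOn (continuousOn_fst.prodMk ?_)
    refine ContinuousOn.div (ContinuousOn.sub (by fun_prop) (ContinuousOn.div
      (cq.const_mul 2).continuousOn (cn.add (by fun_prop)).continuousOn ?_)) cn.continuousOn ?_
    · intro q hq
      have := hpos q hq
      have := sqrt_pos.2 this.1
      linarith [this, (hpos q hq).2]
    · intro q hq
      exact (sqrt_pos.2 (hpos q hq).1).ne'
  have hs : ∀ q ∈ {k | Nondeg a b c k} ×ˢ stdSimplex ℝ (Fin 3),
      0 < nsq q.1 a b c (q.2 0) (q.2 1) (q.2 2) ∧ q.2 0 + q.2 1 + q.2 2 = 1 := by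
    rintro ⟨k, p⟩ ⟨hk, hp, hs⟩
    simp only [Fin.sum_univ_three] at hs
    exact ⟨hk.nsq_pos (hp 0) (hp 1) (hp 2) (by rw [hs]; norm_num), hs⟩
  have hset1 : {k | Nondeg a b c k} = {k | Nondeg b a c k} :=
    Set.ext fun k => ⟨Nondeg.swap, Nondeg.swap⟩
  have hset2 : {k | Nondeg a b c k} = {k | Nondeg c b a k} :=
    Set.ext fun k => ⟨fun h => h.swap.swap'.swap, fun h => h.swap.swap'.swap⟩
  refine ContinuousOn.add (ContinuousOn.add (key a b c 0 1 2 ?_) ?_) ?_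
  · intro q hq; exact ⟨(hs q hq).1, by linarith [(hs q hq).2]⟩
  · rw [hset1]
    apply key b a c 1 0 2
    rw [← hset1]
    intro q hq; exact ⟨by rw [nsq_swap]; exact (hs q hq).1, by linarith [(hs q hq).2]⟩
  · rw [hset2]
    apply key c b a 2 1 0
    rw [← hset2]
    intro q hq; exact ⟨by rw [nsq_swap']; exact (hs q hq).1, by linarith [(hs q hq).2]⟩

theorem continuousOn_steiner (a b c : ℝ) :
    ContinuousOn (fun k => steiner a b c k) {k | Nondeg a b c k} := by
  have h : ContinuousOn (fun k => sInf (sumDist a b c k '' stdSimplex ℝ (Fin 3)))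
      {k | Nondeg a b c k} := by
    rw [continuousOn_iff_continuous_domRestrict]
    have hc : CompactSpace (stdSimplex ℝ (Fin 3)) :=
      isCompact_iff_compactSpace.1 (isCompact_stdSimplex ℝ (Fin 3))
    have := IsCompact.continuous_sInf (γ := {k | Nondeg a b c k}) (β := stdSimplex ℝ (Fin 3))
      (f := fun k p => sumDist a b c k.1 p.1) isCompact_univ ?_
    · refine this.congr fun k => ?_
      simp only [Set.domRestrict_apply]
      congr 1
      ext s
      simp
    · exact (continuousOn_sumDist a b c).comp_continuous
        (f := fun q : {k | Nondeg a b c k} × stdSimplex ℝ (Fin 3) => (q.1.1, q.2.1))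
        (by fun_prop) fun q => ⟨q.1.2, q.2.2⟩
  exact h.congr fun k hk => steiner_eq hk

theorem Nondeg.continuousOn_sumDist {a b c : ℝ} (hnd : Nondeg a b c k) :
    ContinuousOn (sumDist a b c k) (stdSimplex ℝ (Fin 3)) :=
  ContinuousOn.comp (f := fun p : Fin 3 → ℝ => (k, p))
    (TripleCurv.continuousOn_sumDist a b c) (by fun_prop) fun _ hp => ⟨hnd, hp⟩

/-- The minimum is attained. -/
theorem exists_steiner_point {a b c : ℝ} (hnd : Nondeg a b c k) :
    ∃ A B C P : (modelPlane k).carrier, (modelPlane k).IsTriangle a b c A B C ∧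
      P ∈ (modelPlane k).solidTriangle A B C ∧
      steiner a b c k = (modelPlane k).d P A + (modelPlane k).d P B + (modelPlane k).d P C ∧
      ∀ P' ∈ (modelPlane k).solidTriangle A B C, steiner a b c k ≤
        (modelPlane k).d P' A + (modelPlane k).d P' B + (modelPlane k).d P' C := by
  have hcomp := (isCompact_stdSimplex ℝ (Fin 3)).image_of_continuousOn hnd.continuousOn_sumDist
  have hne : (sumDist a b c k '' stdSimplex ℝ (Fin 3)).Nonempty :=
    ⟨_, _, single_mem_stdSimplex ℝ (0 : Fin 3), rfl⟩
  have hmem := hcomp.sInf_mem hne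
  rw [← steiner_eq hnd, ← steiner_set_eq hnd] at hmem
  obtain ⟨A, B, C, P, h1, h2, h3⟩ := hmem
  refine ⟨A, B, C, P, h1, h2, h3, fun P' hP' => ?_⟩
  rw [steiner_eq hnd]
  apply csInf_le hcomp.bddBelow
  rw [← steiner_set_eq hnd]
  exact ⟨A, B, C, P', h1, hP', rfl⟩

theorem steiner_le_sumDist {a b c : ℝ} (hnd : Nondeg a b c k) {p : Fin 3 → ℝ}
    (hp : p ∈ stdSimplex ℝ (Fin 3)) : steiner a b c k ≤ sumDist a b c k p := by
  rw [steiner_eq hnd]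
  exact csInf_le ((isCompact_stdSimplex ℝ (Fin 3)).image_of_continuousOn hnd.continuousOn_sumDist).bddBelow
    ⟨p, hp, rfl⟩

end

/-! ### First variation and Fermat points -/

section

/-- At ε = 0 both sides equal md k y, and their derivatives are -θ sn y and -(θ - η) sn y. The slack
η replaces differentiation of the inverse of `md`. -/
theorem eventually_md_lt {k y : ℝ} (θ : ℝ) {η : ℝ} (hy : 0 < y) (hk : k * y ^ 2 < π ^ 2)
    (hη : 0 < η) : ∀ᶠ ε in 𝓝[>] (0 : ℝ),
      md k ε + md k y - k * (md k ε * md k y) - sn k ε * (sn k y * θ) <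
        md k (y - ε * (θ - η)) := by
  have hs := sn_pos hy hk
  have d1 : HasDerivAt (fun ε => md k (y - ε * (θ - η))) (sn k y * -(θ - η)) 0 := by
    have e : HasDerivAt (fun ε : ℝ => y - ε * (θ - η)) (-(1 * (θ - η))) 0 :=
      ((hasDerivAt_id' (0 : ℝ)).mul_const (θ - η)).const_sub y
    have e2 : HasDerivAt (md k) (sn k y) (y - 0 * (θ - η)) := by
      simpa using hasDerivAt_md k y
    exact (HasDerivAt.comp (h₂ := md k) 0 e2 e).congr_deriv (by ring)
  have d2 : HasDerivAt (fun ε => md k ε + md k y - k * (md k ε * md k y) - sn k ε * (sn k y * θ))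
      (- (sn k y * θ)) 0 := by
    have e1 := hasDerivAt_md k 0
    have e2 := hasDerivAt_sn k 0
    have := ((e1.add_const (md k y)).sub ((e1.mul_const (md k y)).const_mul k)).sub
      (e2.mul_const (sn k y * θ))
    exact this.congr_deriv (by simp)
  have d3 := hasDerivAt_iff_tendsto_slope.1 (d1.sub d2)
  have d4 : Tendsto _ (𝓝[>] (0 : ℝ)) _ := d3.mono_left
    (nhdsWithin_mono 0 fun x (hx : 0 < x) => hx.ne')
  have hc : 0 < sn k y * -(θ - η) - -(sn k y * θ) := by
    have : sn k y * -(θ - η) - -(sn k y * θ) = sn k y * η := by ring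
    rw [this]; positivity
  filter_upwards [d4.eventually (lt_mem_nhds hc), self_mem_nhdsWithin] with ε h1 h2
  have h2' : (0 : ℝ) < ε := h2
  rw [slope_def_field, sub_zero] at h1
  have := (div_pos_iff_of_pos_right h2').1 h1
  simp at this
  linarith

variable {k : ℝ} {M : Plane}

theorem comb_vertex (k : ℝ) (A B C : M.carrier) : Comb k M A B C A 1 0 0 1 0 ∧
    Comb k M A B C B 0 1 0 1 0 ∧ Comb k M A B C C 0 0 1 1 0 := by
  refine ⟨⟨by ring, fun Y => by ring⟩, ⟨by ring, fun Y => by ring⟩, ⟨by ring, fun Y => by ring⟩⟩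

namespace IsModel

theorem vertex_mem (h : IsModel k M) {a b c : ℝ} {A B C : M.carrier} (hnd : Nondeg a b c k)
    (hT : M.IsTriangle a b c A B C) : A ∈ M.solidTriangle A B C ∧ B ∈ M.solidTriangle A B C ∧
      C ∈ M.solidTriangle A B C := by
  obtain ⟨h1, h2, h3⟩ := comb_vertex k A B C
  exact ⟨h.solid_of_comb hnd hT (by simp) (by simp) (by simp) (by simp) (by simp) h1,
    h.solid_of_comb hnd hT (by simp) (by simp) (by simp) (by simp) (by simp) h2,
    h.solid_of_comb hnd hT (by simp) (by simp) (by simp) (by simp) (by simp) h3⟩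

/-- The solid triangle is convex. -/
theorem solid_convex (h : IsModel k M) {a b c : ℝ} {A B C P V P' X : M.carrier}
    (hnd : Nondeg a b c k)
    (hT : M.IsTriangle a b c A B C) (hP : P ∈ M.solidTriangle A B C)
    (hV : V ∈ M.solidTriangle A B C) {u v w E : ℝ} (hu : 0 ≤ u) (hv : 0 ≤ v) (huv : 0 < u + v)
    (hw : 0 < w) (hP' : Comb k M X P V P' 0 u v w E) : P' ∈ M.solidTriangle A B C := by
  obtain ⟨l, m, j, n, F, hl, hm, hj, hs, hn, hc⟩ := h.comb_of_solid hnd hT hP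
  obtain ⟨l', m', j', n', F', hl', hm', hj', hs', hn', hc'⟩ := h.comb_of_solid hnd hT hV
  have key : Comb k M A B C P' (u * n' * l + v * n * l') (u * n' * m + v * n * m')
      (u * n' * j + v * n * j') (w * n * n') (u * n' * F + v * n * F' + n * n' * E) := by
    refine ⟨?_, fun Y => ?_⟩
    · linear_combination u * n' * hc.1 + v * n * hc'.1 + n * n' * hP'.1
    · linear_combination u * n' * hc.2 Y + v * n * hc'.2 Y + n * n' * hP'.2 Y
  refine h.solid_of_comb hnd hT (by positivity) (by positivity) (by positivity) ?_
    (by positivity) key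
  have : u * n' * l + v * n * l' + (u * n' * m + v * n * m') + (u * n' * j + v * n * j') =
      u * n' + v * n := by
    linear_combination u * n' * hs + v * n * hs'
  rw [this]
  rcases hu.eq_or_lt with h0 | h0
  · have : 0 < v * n := mul_pos (by linarith) hn
    have := mul_nonneg hu hn'.le
    linarith
  · have := mul_pos h0 hn'
    have := mul_nonneg hv hn.le
    linarith

theorem solid_dist_le (h : IsModel k M) {a b c : ℝ} {A B C P : M.carrier}
    (hT : M.IsTriangle a b c A B C) (hP : P ∈ M.solidTriangle A B C) :
    M.d P A ≤ (a + b + c) / 2 ∧ M.d P B ≤ (a + b + c) / 2 ∧ M.d P C ≤ (a + b + c) / 2 := by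
  obtain ⟨D, hD, hP⟩ := hP
  obtain ⟨t1, t2, t3⟩ := hT
  unfold Plane.Between at hD hP
  have n1 := h.d_nonneg P D
  have e1 := h.d_triangle A B D
  have e2 := h.d_triangle A C D
  have e3 := h.d_triangle P A B
  have e4 := h.d_triangle P D B
  have e5 := h.d_triangle P A C
  have e6 := h.d_triangle P D C
  rw [h.d_comm C D] at e2
  rw [h.d_comm D B] at e4
  rw [h.d_comm P A] at *
  refine ⟨by linarith, by linarith, by linarith⟩

/-- The quotient of `inn` by the two sines is the cosine of the angle at Z, the rate at which the
distance to Y drops when walking towards D. -/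
theorem first_variation (h : IsModel k M) {Z D Y : M.carrier} (h0 : 0 < M.d Z D)
    (hk : k * M.d Z D ^ 2 < π ^ 2)
    (hy : 0 < M.d Z Y) (hky : k * M.d Z Y ^ 2 < π ^ 2) {η : ℝ} (hη : 0 < η) :
    ∀ᶠ ε in 𝓝[>] (0 : ℝ), ∀ P, md k (M.d P Y) = md k ε + md k (M.d Z Y) -
        k * (md k ε * md k (M.d Z Y)) - sn k ε * (inn k M Z D Y / sn k (M.d Z D)) →
      M.d P Y < M.d Z Y - ε * (inn k M Z D Y / (sn k (M.d Z D) * sn k (M.d Z Y)) - η) := by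
  set θ := inn k M Z D Y / (sn k (M.d Z D) * sn k (M.d Z Y)) with hθ
  have s1 := sn_pos h0 hk
  have s2 := sn_pos hy hky
  have h1 := eventually_md_lt θ hy hky hη
  have h2 : ∀ᶠ ε in 𝓝[>] (0 : ℝ), 0 < M.d Z Y - ε * (θ - η) := by
    have : Tendsto (fun ε : ℝ => M.d Z Y - ε * (θ - η)) (𝓝 0) (𝓝 (M.d Z Y - 0 * (θ - η))) :=
      (by fun_prop : Continuous fun ε : ℝ => M.d Z Y - ε * (θ - η)).tendsto 0
    rw [zero_mul, sub_zero] at this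
    exact (this.mono_left nhdsWithin_le_nhds).eventually (lt_mem_nhds hy)
  filter_upwards [h1, h2] with ε e1 e2 P hP
  refine lt_of_md_lt e2.le (h.d_le _ _) ?_
  rw [hP]
  convert e1 using 3
  rw [hθ]; field_simp

/-- The first order condition at a minimum of the sum of distances. -/
theorem first_order (h : IsModel k M) {P V Y₁ Y₂ : M.carrier} (hV : 0 < M.d P V)
    (hkV : k * M.d P V ^ 2 < π ^ 2)
    (h1 : 0 < M.d P Y₁) (hk1 : k * M.d P Y₁ ^ 2 < π ^ 2)
    (h2 : 0 < M.d P Y₂) (hk2 : k * M.d P Y₂ ^ 2 < π ^ 2)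
    (hmin : ∀ P' u v w E, 0 ≤ u → 0 ≤ v → 0 < u + v → 0 < w → Comb k M P P V P' 0 u v w E →
      M.d P V + M.d P Y₁ + M.d P Y₂ ≤ M.d P' V + M.d P' Y₁ + M.d P' Y₂) :
    1 + inn k M P V Y₁ / (sn k (M.d P V) * sn k (M.d P Y₁)) +
      inn k M P V Y₂ / (sn k (M.d P V) * sn k (M.d P Y₂)) ≤ 0 := by
  by_contra! hc
  set θ₁ := inn k M P V Y₁ / (sn k (M.d P V) * sn k (M.d P Y₁))
  set θ₂ := inn k M P V Y₂ / (sn k (M.d P V) * sn k (M.d P Y₂))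
  -- With this η the two bounds for the other legs add up to a gain of ε, which cancels the exact
  -- drop ε of the distance to V. The strict inequalities then contradict minimality.
  have hη : 0 < (1 + θ₁ + θ₂) / 2 := by linarith
  have e1 := h.first_variation hV hkV h1 hk1 hη
  have e2 := h.first_variation hV hkV h2 hk2 hη
  have e3 : ∀ᶠ ε in 𝓝[>] (0 : ℝ), ε ≤ M.d P V :=
    nhdsWithin_le_nhds (eventually_le_nhds hV)
  obtain ⟨ε, f1, f2, f3, f4⟩ := (e1.and (e2.and (e3.and self_mem_nhdsWithin))).exists
  have f4 : 0 < ε := f4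
  obtain ⟨P', g1, g2, g3, g4, g5⟩ := h.exists_walk hV hkV f4.le f3
  have i1 := f1 P' (g5 Y₁)
  have i2 := f2 P' (g5 Y₂)
  have p1 := sn_pos f4 (mul_sq_lt_of_le f4.le f3 hkV)
  have p2 := sn_nonneg (t := M.d P V - ε) (by linarith)
    (mul_sq_lt_of_le (by linarith) (by linarith) hkV).le
  have i3 := hmin P' _ _ _ _ p2 p1.le (by linarith) (sn_pos hV hkV) (g4 P)
  rw [g3] at i3
  have i4 : ε * (θ₁ - (1 + θ₁ + θ₂) / 2) + ε * (θ₂ - (1 + θ₁ + θ₂) / 2) = -ε := by ring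
  linarith

end IsModel

/-- Three unit vectors in the plane with nonnegative weights summing to zero that satisfy the first
order conditions include angles `2π/3`. -/
theorem angles_eq {x y z α β γ : ℝ} (hx : 0 ≤ x) (hy : 0 ≤ y) (hz : 0 ≤ z) (h0 : 0 < x + y + z)
    (e1 : x + y * γ + z * β = 0) (e2 : x * γ + y + z * α = 0) (e3 : x * β + y * α + z = 0)
    (i1 : 1 + γ + β ≤ 0) (i2 : 1 + γ + α ≤ 0) (i3 : 1 + β + α ≤ 0) :
    α = -1 / 2 ∧ β = -1 / 2 ∧ γ = -1 / 2 ∧ 0 < x ∧ x = y ∧ y = z := by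
  -- A sum of nonpositive terms vanishes, so each does. If all weights are positive, the three first
  -- order conditions are equalities and force the cosines -1/2.
  have key : x * (1 + γ + β) + y * (1 + γ + α) + z * (1 + β + α) = 0 := by
    linear_combination e1 + e2 + e3
  have k1 := mul_nonpos_of_nonneg_of_nonpos hx i1
  have k2 := mul_nonpos_of_nonneg_of_nonpos hy i2
  have k3 := mul_nonpos_of_nonneg_of_nonpos hz i3
  have j1 : x * (1 + γ + β) = 0 := by linarith
  have j2 : y * (1 + γ + α) = 0 := by linarith
  have j3 : z * (1 + β + α) = 0 := by linarith
  have hx0 : x ≠ 0 := by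
    rintro rfl
    have : y ≠ 0 := by
      rintro rfl
      linarith
    have : z ≠ 0 := by
      rintro rfl
      apply this; linarith
    have a1 := (mul_eq_zero.1 j2).resolve_left ‹_›
    have a2 := (mul_eq_zero.1 j3).resolve_left ‹_›
    have hy' : 0 < y := lt_of_le_of_ne hy (Ne.symm ‹_›)
    have hz' : 0 < z := lt_of_le_of_ne hz (Ne.symm ‹_›)
    have : γ = β := by linarith
    subst this
    have : (y + z) * γ = 0 := by linarith
    have := (mul_eq_zero.1 this).resolve_left (by linarith)
    linarith
  have hy0 : y ≠ 0 := by
    rintro rfl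
    have : z ≠ 0 := by
      rintro rfl
      apply hx0; linarith
    have a1 := (mul_eq_zero.1 j1).resolve_left ‹_›
    have a2 := (mul_eq_zero.1 j3).resolve_left ‹_›
    have hx' : 0 < x := lt_of_le_of_ne hx (Ne.symm ‹_›)
    have hz' : 0 < z := lt_of_le_of_ne hz (Ne.symm ‹_›)
    have : γ = α := by linarith
    subst this
    have : (x + z) * γ = 0 := by linarith
    have := (mul_eq_zero.1 this).resolve_left (by linarith)
    linarith
  have hz0 : z ≠ 0 := by
    rintro rfl
    have a1 := (mul_eq_zero.1 j1).resolve_left ‹_›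
    have a2 := (mul_eq_zero.1 j2).resolve_left ‹_›
    have hx' : 0 < x := lt_of_le_of_ne hx (Ne.symm ‹_›)
    have hy' : 0 < y := lt_of_le_of_ne hy (Ne.symm ‹_›)
    have : β = α := by linarith
    subst this
    have : (x + y) * β = 0 := by linarith
    have := (mul_eq_zero.1 this).resolve_left (by linarith)
    linarith
  have a1 := (mul_eq_zero.1 j1).resolve_left hx0
  have a2 := (mul_eq_zero.1 j2).resolve_left hy0
  have a3 := (mul_eq_zero.1 j3).resolve_left hz0
  have b1 : α = -1 / 2 := by linarith
  have b2 : β = -1 / 2 := by linarith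
  have b3 : γ = -1 / 2 := by linarith
  subst b1 b2 b3
  exact ⟨rfl, rfl, rfl, lt_of_le_of_ne hx (Ne.symm hx0), by linarith, by linarith⟩

/-- `P` sees the vertices of `ABC` under angles `2π/3` and is the combination of the vertices with
weights `l, m, j`. -/
structure IsFermat (k : ℝ) (M : Plane) (A B C P : M.carrier) (l m j n E : ℝ) : Prop where
  PA : 0 < M.d P A
  PB : 0 < M.d P B
  PC : 0 < M.d P C
  kA : k * M.d P A ^ 2 < π ^ 2
  kB : k * M.d P B ^ 2 < π ^ 2
  kC : k * M.d P C ^ 2 < π ^ 2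
  AB : inn k M P A B = -1 / 2 * (sn k (M.d P A) * sn k (M.d P B))
  AC : inn k M P A C = -1 / 2 * (sn k (M.d P A) * sn k (M.d P C))
  BC : inn k M P B C = -1 / 2 * (sn k (M.d P B) * sn k (M.d P C))
  l_pos : 0 < l
  m_pos : 0 < m
  j_pos : 0 < j
  sum : l + m + j = 1
  n_pos : 0 < n
  comb : Comb k M A B C P l m j n E
  lm : l * sn k (M.d P A) = m * sn k (M.d P B)
  mj : m * sn k (M.d P B) = j * sn k (M.d P C)

/-- Walking from P towards each vertex stays in the triangle and gives the three first order
conditions. The representation of P by weights says that the weighted tangent vectors at P sum to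
zero. `angles_eq` combines both. -/
theorem IsModel.isFermat_of_min (h : IsModel k M) {a b c : ℝ} {A B C P : M.carrier}
    (hnd : Nondeg a b c k) (hT : M.IsTriangle a b c A B C) (hP : P ∈ M.solidTriangle A B C)
    (hmin : ∀ P' ∈ M.solidTriangle A B C,
      M.d P A + M.d P B + M.d P C ≤ M.d P' A + M.d P' B + M.d P' C)
    (hA : 0 < M.d P A) (hB : 0 < M.d P B) (hC : 0 < M.d P C) :
    ∃ l m j n E, IsFermat k M A B C P l m j n E := by
  obtain ⟨l, m, j, n, E, hl, hm, hj, hs, hn, hc⟩ := h.comb_of_solid hnd hT hP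
  obtain ⟨b1, b2, b3⟩ := h.solid_dist_le hT hP
  obtain ⟨v1, v2, v3⟩ := h.vertex_mem hnd hT
  have kA := mul_sq_lt_of_le hA.le b1 hnd.perim
  have kB := mul_sq_lt_of_le hB.le b2 hnd.perim
  have kC := mul_sq_lt_of_le hC.le b3 hnd.perim
  have sA := sn_pos hA kA
  have sB := sn_pos hB kB
  have sC := sn_pos hC kC
  have f1 := h.first_order hA kA hB kB hC kC fun P' u v w E hu hv huv hw hP' =>
    hmin P' (h.solid_convex hnd hT hP v1 hu hv huv hw hP')
  have f2 := h.first_order hB kB hA kA hC kC fun P' u v w E hu hv huv hw hP' => by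
    linarith [hmin P' (h.solid_convex hnd hT hP v2 hu hv huv hw hP')]
  have f3 := h.first_order hC kC hA kA hB kB fun P' u v w E hu hv huv hw hP' => by
    linarith [hmin P' (h.solid_convex hnd hT hP v3 hu hv huv hw hP')]
  have i1 := h.comb_inn hc P A
  have i2 := h.comb_inn hc P B
  have i3 := h.comb_inn hc P C
  rw [h.inn_base, h.inn_self] at i1 i2 i3
  rw [h.inn_comm P B A] at f2 i1
  rw [h.inn_comm P C A] at f3 i1
  rw [h.inn_comm P C B] at f3 i2
  set x := sn k (M.d P A)
  set y := sn k (M.d P B)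
  set z := sn k (M.d P C)
  obtain ⟨γ, hγ⟩ : ∃ γ, γ = inn k M P A B / (x * y) := ⟨_, rfl⟩
  obtain ⟨β, hβ⟩ : ∃ β, β = inn k M P A C / (x * z) := ⟨_, rfl⟩
  obtain ⟨α, hα⟩ : ∃ α, α = inn k M P B C / (y * z) := ⟨_, rfl⟩
  have hγ' : inn k M P A B = γ * (x * y) := by rw [hγ]; field_simp
  have hβ' : inn k M P A C = β * (x * z) := by rw [hβ]; field_simp
  have hα' : inn k M P B C = α * (y * z) := by rw [hα]; field_simp
  rw [mul_comm y x] at f2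
  rw [mul_comm z x, mul_comm z y] at f3
  rw [← hγ, ← hβ] at f1
  rw [← hγ, ← hα] at f2
  rw [← hβ, ← hα] at f3
  rw [hγ', hβ'] at i1
  rw [hγ', hα'] at i2
  rw [hβ', hα'] at i3
  obtain ⟨r1, r2, r3, r4, r5, r6⟩ := angles_eq (x := l * x) (y := m * y) (z := j * z)
    (by positivity) (by positivity) (by positivity)
    (by
      rcases hl.eq_or_lt with h0 | h0
      · rcases hm.eq_or_lt with h0' | h0'
        · have : 0 < j := by linarith
          have := mul_pos this sC
          rw [← h0, ← h0']; linarith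
        · have := mul_pos h0' sB
          have := mul_nonneg hl sA.le
          have := mul_nonneg hj sC.le
          linarith
      · have := mul_pos h0 sA
        have := mul_nonneg hm sB.le
        have := mul_nonneg hj sC.le
        linarith)
    (α := α) (β := β) (γ := γ)
    (mul_left_cancel₀ sA.ne' (by linear_combination -i1))
    (mul_left_cancel₀ sB.ne' (by linear_combination -i2))
    (mul_left_cancel₀ sC.ne' (by linear_combination -i3)) f1 f2 f3
  subst r1 r2 r3
  exact ⟨l, m, j, n, E, hA, hB, hC, kA, kB, kC, hγ', hβ', hα', pos_of_mul_pos_left r4 sA.le,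
    pos_of_mul_pos_left (r5 ▸ r4) sB.le, pos_of_mul_pos_left (r6 ▸ r5 ▸ r4) sC.le, hs, hn, hc,
    r5, r6⟩

/-- If the angle at `C` is less than `2π/3`, then `C` is not a minimum. -/
theorem IsModel.exists_lt_vertex (h : IsModel k M) {a b c : ℝ} {A B C : M.carrier}
    (hnd : Nondeg a b c k) (hT : M.IsTriangle a b c A B C)
    (hang : -1 / 2 * (sn k a * sn k b) < inn k M C A B) :
    ∃ P ∈ M.solidTriangle A B C, M.d P A + M.d P B + M.d P C < a + b := by
  have sa := sn_pos hnd.a_pos hnd.ka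
  have sb := sn_pos hnd.b_pos hnd.kb
  have hT' := hT
  obtain ⟨t1, t2, t3⟩ := hT'
  have hCA : M.d C A = b := by rw [h.d_comm]; exact t2
  have hCB : M.d C B = a := by rw [h.d_comm]; exact t1
  have hAB : 0 < M.d A B := by rw [t3]; exact hnd.c_pos
  have hkAB : k * M.d A B ^ 2 < π ^ 2 := by rw [t3]; exact hnd.kc
  have n1 : 0 < nsq k (M.d A B) (M.d A B) (M.d A A) 0 (1 / sn k b) (1 / sn k a) := by
    have := nsq_two_pos hAB hkAB (m := 1 / sn k b) (j := 1 / sn k a) (by positivity)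
      (by positivity) (by positivity)
    unfold nsq qf
    linarith
  -- These weights make the tangent vector at C proportional to the sum of the unit vectors towards
  -- A and B, so CD bisects the angle.
  obtain ⟨D, hD⟩ := h.comb_exists A A B 0 (1 / sn k b) (1 / sn k a) le_rfl (by positivity)
    (by positivity) (by positivity) n1
  set n := √(nsq k (M.d A B) (M.d A B) (M.d A A) 0 (1 / sn k b) (1 / sn k a))
  have hn : 0 < n := sqrt_pos.2 n1
  obtain ⟨v1, v2, v3⟩ := h.vertex_mem hnd hT
  have hDs := h.solid_convex hnd hT v1 v2 (by positivity) (by positivity) (by positivity) hn hD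
  obtain ⟨γ, hγ⟩ : ∃ γ, inn k M C A B = γ * (sn k a * sn k b) :=
    ⟨inn k M C A B / (sn k a * sn k b), by field_simp⟩
  have hγ2 : -1 / 2 < γ := by
    rw [hγ] at hang
    exact lt_of_mul_lt_mul_right hang (by positivity)
  have i1 := h.comb_inn hD C A
  have i2 := h.comb_inn hD C B
  have i3 := h.comb_inn hD C D
  rw [h.inn_self, h.inn_comm C B A, hγ, hCA] at i1
  rw [h.inn_self, hγ, hCB] at i2
  rw [h.inn_self, h.inn_comm C A D, h.inn_comm C B D] at i3
  have j1 : n * inn k M C D A = (1 + γ) * sn k b := by rw [i1]; field_simp; ring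
  have j2 : n * inn k M C D B = (1 + γ) * sn k a := by rw [i2]; field_simp; ring
  have j3 : (n * sn k (M.d C D)) ^ 2 = 2 * (1 + γ) := by
    have : (n * sn k (M.d C D)) ^ 2 = n * (n * sn k (M.d C D) ^ 2) := by ring
    rw [this, i3]
    have e0 : n * (0 * inn k M C D A + 1 / sn k b * inn k M C D A + 1 / sn k a * inn k M C D B) =
      1 / sn k b * (n * inn k M C D A) + 1 / sn k a * (n * inn k M C D B) := by ring
    rw [e0, j1, j2]; field_simp; ring
  have b3 := (h.solid_dist_le hT hDs).2.2
  rw [h.d_comm] at b3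
  have hCD : 0 < M.d C D := by
    refine (h.d_nonneg C D).lt_of_ne fun h0 => ?_
    rw [← h0] at j3
    simp at j3
    linarith
  have hkCD := mul_sq_lt_of_le hCD.le b3 hnd.perim
  have sD := sn_pos hCD hkCD
  set N := n * sn k (M.d C D) with hN
  have hN0 : 0 < N := by positivity
  -- N is the length of the sum of the two unit vectors. Each of the distances to A and B drops at
  -- rate N/2, together faster than the distance to C grows.
  have hN1 : 1 < N := by nlinarith
  have θ1 : inn k M C D A / (sn k (M.d C D) * sn k b) = N / 2 := by
    rw [div_eq_iff (by positivity)]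
    apply mul_left_cancel₀ hn.ne'
    rw [j1]
    linear_combination -(sn k b) / 2 * j3 + (sn k b * N) / 2 * hN
  have θ2 : inn k M C D B / (sn k (M.d C D) * sn k a) = N / 2 := by
    rw [div_eq_iff (by positivity)]
    apply mul_left_cancel₀ hn.ne'
    rw [j2]
    linear_combination -(sn k a) / 2 * j3 + (sn k a * N) / 2 * hN
  have hη : 0 < (N - 1) / 4 := by linarith
  have e1 := h.first_variation (Y := A) hCD hkCD (by rw [hCA]; exact hnd.b_pos)
    (by rw [hCA]; exact hnd.kb) hη
  have e2 := h.first_variation (Y := B) hCD hkCD (by rw [hCB]; exact hnd.a_pos)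
    (by rw [hCB]; exact hnd.ka) hη
  rw [hCA, θ1] at e1
  rw [hCB, θ2] at e2
  have e3 : ∀ᶠ ε in 𝓝[>] (0 : ℝ), ε ≤ M.d C D :=
    nhdsWithin_le_nhds (eventually_le_nhds hCD)
  obtain ⟨ε, f1, f2, f3, f4⟩ := (e1.and (e2.and (e3.and self_mem_nhdsWithin))).exists
  have f4 : 0 < ε := f4
  obtain ⟨P', g1, g2, g3, g4, g5⟩ := h.exists_walk hCD hkCD f4.le f3
  have p1 := sn_pos f4 (mul_sq_lt_of_le f4.le f3 hkCD)
  have p2 := sn_nonneg (t := M.d C D - ε) (by linarith)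
    (mul_sq_lt_of_le (by linarith) (by linarith) hkCD).le
  refine ⟨P', h.solid_convex hnd hT v3 hDs p2 p1.le (by linarith) sD (g4 C), ?_⟩
  have i1 := f1 P' (by rw [← hCA]; exact g5 A)
  have i2 := f2 P' (by rw [← hCB]; exact g5 B)
  rw [h.d_comm P' C, g2]
  nlinarith [mul_pos f4 hη]

/-- This is cos γ = 1 - 2 sin²(γ/2), with the half-angle formula for sin²(γ/2). -/
theorem inn_vertex {a b c : ℝ} (k : ℝ) : md k b + md k a - k * (md k b * md k a) - md k c =
    sn k a * sn k b - 2 * (sn k ((a + b + c) / 2 - a) * sn k ((a + b + c) / 2 - b)) := by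
  have e1 := md_sub_md k c (a - b)
  rw [md_sub] at e1
  rw [show (a + b + c) / 2 - a = (c - (a - b)) / 2 by ring,
    show (a + b + c) / 2 - b = (c + (a - b)) / 2 by ring]
  linear_combination -e1

end

/-! ### The angle as a function of the curvature, and Λ -/

section

/-- The squared sine of half of the angle opposite to `c` in the triangle with sides `a, b, c`. -/
def psi (a b c k : ℝ) : ℝ :=
  sn k ((a + b + c) / 2 - a) / sn k b * (sn k ((a + b + c) / 2 - b) / sn k a)

section Psi

variable {a b c : ℝ}
-- With half-perimeter s one has s - a < b and s - b < a, so both factors are quotients sn u / sn v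
-- with u < v, which increase with k.
theorem strictMonoOn_psi (ha : 0 < a) (hb : 0 < b) (h1 : a < b + c) (h2 : b < a + c)
    (h3 : c < a + b) : StrictMonoOn (psi a b c) {k | k * ((a + b + c) / 2) ^ 2 ≤ π ^ 2} := by
  have hs1 : {k | k * ((a + b + c) / 2) ^ 2 ≤ π ^ 2} ⊆ {k | k * b ^ 2 < π ^ 2} :=
    fun k hk => mul_sq_lt_of_lt hb.le (by linarith) hk
  have hs2 : {k | k * ((a + b + c) / 2) ^ 2 ≤ π ^ 2} ⊆ {k | k * a ^ 2 < π ^ 2} :=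
    fun k hk => mul_sq_lt_of_lt ha.le (by linarith) hk
  have m1 := (strictMonoOn_sn_div_sn (u := (a + b + c) / 2 - a) (v := b) (by linarith)
    (by linarith)).mono hs1
  have m2 := (strictMonoOn_sn_div_sn (u := (a + b + c) / 2 - b) (v := a) (by linarith)
    (by linarith)).mono hs2
  intro k hk k' hk' hkk'
  have p1 : ∀ k ∈ {k | k * ((a + b + c) / 2) ^ 2 ≤ π ^ 2},
      0 < sn k ((a + b + c) / 2 - a) / sn k b := fun k hk =>
    div_pos (sn_pos (by linarith) (mul_sq_lt_of_lt (by linarith) (by linarith) hk))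
      (sn_pos hb (hs1 hk))
  have p2 : ∀ k ∈ {k | k * ((a + b + c) / 2) ^ 2 ≤ π ^ 2},
      0 < sn k ((a + b + c) / 2 - b) / sn k a := fun k hk =>
    div_pos (sn_pos (by linarith) (mul_sq_lt_of_lt (by linarith) (by linarith) hk))
      (sn_pos ha (hs2 hk))
  exact mul_lt_mul'' (m1 hk hk' hkk') (m2 hk hk' hkk') (p1 k hk).le (p2 k hk).le

theorem exists_psi_eq (ha : 0 < a) (hb : 0 < b) (h1 : a < b + c) (h2 : b < a + c)
    (h3 : c < a + b) : ∃ L : ℝ, L * ((a + b + c) / 2) ^ 2 < π ^ 2 ∧ psi a b c L = 3 / 4 := by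
  set s := (a + b + c) / 2 with hs
  have hs0 : 0 < s := by linarith
  set K := π ^ 2 / s ^ 2 with hK
  have hK0 : 0 < K := by positivity
  have hKs : K * s ^ 2 = π ^ 2 := by rw [hK]; field_simp
  have hsK : √K * s = π := by
    rw [hK, sqrt_div (by positivity), sqrt_sq pi_pos.le, sqrt_sq hs0.le]; field_simp
  have sa : 0 < sn K a := sn_pos ha (mul_sq_lt_of_lt ha.le (by linarith) hKs.le)
  have sb : 0 < sn K b := sn_pos hb (mul_sq_lt_of_lt hb.le (by linarith) hKs.le)
  have hval : ∀ t, sn K (s - t) = sn K t := by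
    intro t
    rw [sn_pos_curv hK0, sn_pos_curv hK0, mul_sub, hsK, sin_pi_sub]
  -- At K the perimeter is 2 D_K: the triangle is a great circle and its angles are π.
  have e1 : psi a b c K = 1 := by
    unfold psi
    rw [← hs, hval, hval]; field_simp
  obtain ⟨k, hk0, hk⟩ : ∃ k < 0, psi a b c k ≤ 1 / 2 := by
    -- The first quotient of hyperbolic sines is at most exp(-τδ). The choice τ = log 2 / δ makes
    -- this 1/2, and the second quotient is at most 1.
    set δ := b - (s - a) with hδ
    have hδ0 : 0 < δ := by linarith
    have hlog : 0 < log 2 := log_pos (by norm_num)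
    set τ := log 2 / δ with hτ
    have hτ0 : 0 < τ := by positivity
    have hτδ : τ * δ = log 2 := by rw [hτ]; field_simp
    have hneg : -τ ^ 2 < 0 := by nlinarith
    have hsq : √(-(-τ ^ 2)) = τ := by rw [neg_neg, sqrt_sq hτ0.le]
    have hsinh : ∀ u v : ℝ, 0 < v → u ≤ v → sinh u / sinh v ≤ exp (u - v) := by
      intro u v hv huv
      rw [div_le_iff₀ (sinh_pos_iff.2 hv), sinh_eq, sinh_eq]
      have : exp (u - v) * exp v = exp u := by rw [← exp_add]; ring_nf
      have h4 : exp (u - v) * exp (-v) ≤ exp (-u) := by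
        rw [← exp_add]; exact exp_le_exp.2 (by linarith)
      nlinarith
    refine ⟨-τ ^ 2, hneg, ?_⟩
    unfold psi
    rw [← hs]
    simp only [sn_neg_curv hneg, hsq]
    have r1 : sinh (τ * (s - a)) / τ / (sinh (τ * b) / τ) ≤ 1 / 2 := by
      rw [div_div_div_cancel_right₀ hτ0.ne']
      refine (hsinh _ _ (by positivity) (by nlinarith)).trans ?_
      rw [show τ * (s - a) - τ * b = -(log 2) by rw [← hτδ, hδ]; ring, exp_neg,
        exp_log (by norm_num)]
      norm_num
    have r2 : sinh (τ * (s - b)) / τ / (sinh (τ * a) / τ) ≤ 1 := by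
      rw [div_div_div_cancel_right₀ hτ0.ne']
      refine (hsinh _ _ (by positivity) (by nlinarith)).trans ?_
      rw [exp_le_one_iff]
      nlinarith
    have r3 : 0 ≤ sinh (τ * (s - b)) / τ / (sinh (τ * a) / τ) := by
      have q1 : 0 ≤ sinh (τ * (s - b)) := sinh_nonneg_iff.2 (mul_nonneg hτ0.le (by linarith))
      have q2 : 0 ≤ sinh (τ * a) := sinh_nonneg_iff.2 (by positivity)
      positivity
    nlinarith
  have hcont : ContinuousOn (psi a b c) (Set.Icc k K) := by
    intro t ht
    have ht' : t * s ^ 2 ≤ π ^ 2 := by rw [← hKs]; gcongr; exact ht.2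
    have sa : 0 < sn t a := sn_pos ha (mul_sq_lt_of_lt ha.le (by linarith) ht')
    have sb : 0 < sn t b := sn_pos hb (mul_sq_lt_of_lt hb.le (by linarith) ht')
    have c1 := continuous_sn_curv a
    have c2 := continuous_sn_curv b
    have c3 := continuous_sn_curv (s - a)
    have c4 := continuous_sn_curv (s - b)
    exact ((c3.continuousAt.div c2.continuousAt sb.ne').mul
      (c4.continuousAt.div c1.continuousAt sa.ne')).continuousWithinAt
  obtain ⟨L, hL, hL2⟩ := intermediate_value_Icc (hk0.le.trans hK0.le) hcont
    (show (3 / 4 : ℝ) ∈ Set.Icc _ _ by rw [e1]; constructor <;> linarith)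
  refine ⟨L, ?_, hL2⟩
  have : L ≠ K := by rintro rfl; rw [e1] at hL2; norm_num at hL2
  rw [← hKs]
  have := lt_of_le_of_ne hL.2 this
  gcongr

theorem psi_eq_iff (ha : 0 < a) (hb : 0 < b) {k : ℝ} (hka : k * a ^ 2 < π ^ 2)
    (hkb : k * b ^ 2 < π ^ 2) :
    (psi a b c k = 3 / 4 ↔
      md k b + md k a - k * (md k b * md k a) - md k c = -1 / 2 * (sn k a * sn k b)) ∧
    (psi a b c k < 3 / 4 ↔
      -1 / 2 * (sn k a * sn k b) < md k b + md k a - k * (md k b * md k a) - md k c) := by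
  have sa := sn_pos ha hka
  have sb := sn_pos hb hkb
  rw [inn_vertex]
  unfold psi
  rw [div_mul_div_comm, div_eq_iff (by positivity), div_lt_iff₀ (by positivity)]
  constructor
  · constructor <;> intro h <;> linarith
  · constructor <;> intro h <;> linarith

/-- All branches of Λ express psi = sin²(π/3) = 3/4, and comparing psi at k = 0 with 3/4 selects the
branch. Strict monotonicity makes the solution sets singletons. -/
theorem lambdaOrdered_eq (ha : 0 < a) (hb : 0 < b) (h1 : a < b + c) (h2 : b < a + c)
    (h3 : c < a + b) : ∃ L : ℝ, lambdaOrdered a b c = (L : EReal) ∧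
    L * ((a + b + c) / 2) ^ 2 < π ^ 2 ∧ psi a b c L = 3 / 4 ∧ ∀ k < L, psi a b c k < 3 / 4 := by
  obtain ⟨L, hL, hpsi⟩ := exists_psi_eq ha hb h1 h2 h3
  have hmono := strictMonoOn_psi ha hb h1 h2 h3
  have hs0 : 0 < (a + b + c) / 2 := by linarith
  refine ⟨L, ?_, hL, hpsi, fun k hk => ?_⟩
  swap
  · rw [← hpsi]
    exact hmono ((mul_le_mul_of_nonneg_right hk.le (sq_nonneg _)).trans hL.le) hL.le hk
  have h00 : (0 : ℝ) ∈ {k | k * ((a + b + c) / 2) ^ 2 ≤ π ^ 2} := by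
    simp; positivity
  have z1 := (psi_eq_iff (c := c) ha hb (k := 0) (by simp; positivity) (by simp; positivity)).1
  have z2 := (psi_eq_iff (c := c) ha hb (k := 0) (by simp; positivity) (by simp; positivity)).2
  simp only [md_zero_curv, sn_zero_curv] at z1 z2
  have hiff : ∀ k, k ≠ 0 → k * ((a + b + c) / 2) ^ 2 ≤ π ^ 2 →
      (cs k c = cs k a * cs k b - k / 2 * (sn k a * sn k b) ↔ k = L) := by
    intro k hk0 hk
    rw [← hmono.eq_iff_eq hk hL.le, hpsi, (psi_eq_iff ha hb
      (mul_sq_lt_of_lt ha.le (by linarith) hk) (mul_sq_lt_of_lt hb.le (by linarith) hk)).1]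
    rw [cs_eq, cs_eq, cs_eq]
    constructor
    · intro h
      apply mul_left_cancel₀ hk0
      linear_combination h
    · intro h
      linear_combination k * h
  unfold lambdaOrdered
  split_ifs with q1 q2
  · have : psi a b c 0 = 3 / 4 := z1.2 (by linarith)
    have : L = 0 := hmono.injOn hL.le h00 (by rw [this, hpsi])
    simp [this]
  · have hpos : 0 < L := by
      have : psi a b c 0 < 3 / 4 := z2.2 (by linarith)
      rw [← hpsi] at this
      exact (hmono.lt_iff_lt h00 hL.le).1 this
    have hset : {k : ℝ | 0 < k ∧ k ≤ (2 * π / (a + b + c)) ^ 2 ∧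
        cos (c * √k) = cos (a * √k) * cos (b * √k) - 1 / 2 * (sin (a * √k) * sin (b * √k))} =
        {L} := by
      have hrw : ∀ k, 0 < k → (cos (c * √k) = cos (a * √k) * cos (b * √k) -
          1 / 2 * (sin (a * √k) * sin (b * √k)) ↔
          cs k c = cs k a * cs k b - k / 2 * (sn k a * sn k b)) := by
        intro k hk
        have h0 := sqrt_pos.2 hk
        have : k / 2 * (sn k a * sn k b) = 1 / 2 * (sin (a * √k) * sin (b * √k)) := by
          rw [sn_pos_curv hk, sn_pos_curv hk, mul_comm a, mul_comm b]
          field_simp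
          rw [sq_sqrt hk.le]
        rw [this, cs_pos_curv hk, cs_pos_curv hk, cs_pos_curv hk, mul_comm c, mul_comm a,
          mul_comm b]
      have hbd : ∀ k, k ≤ (2 * π / (a + b + c)) ^ 2 ↔ k * ((a + b + c) / 2) ^ 2 ≤ π ^ 2 := by
        intro k
        have : (2 * π / (a + b + c)) ^ 2 = π ^ 2 / ((a + b + c) / 2) ^ 2 := by
          field_simp
        rw [this, le_div_iff₀ (by positivity)]
      ext k
      simp only [Set.mem_ofPred_eq, Set.mem_singleton_iff]
      constructor
      · rintro ⟨g1, g2, g3⟩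
        exact (hiff k g1.ne' ((hbd k).1 g2)).1 ((hrw k g1).1 g3)
      · rintro rfl
        exact ⟨hpos, (hbd k).2 hL.le, (hrw k hpos).2 ((hiff k hpos.ne' hL.le).2 rfl)⟩
    rw [hset]; simp
  · have hneg : L < 0 := by
      have e1 : ¬ psi a b c 0 < 3 / 4 := fun h => q2 (by linarith [z2.1 h])
      have e2 : psi a b c 0 ≠ 3 / 4 := fun h => q1 (by linarith [z1.1 h])
      have : 3 / 4 < psi a b c 0 := lt_of_le_of_ne (not_lt.1 e1) e2.symm
      rw [← hpsi] at this
      exact (hmono.lt_iff_lt hL.le h00).1 this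
    have hset : {k : ℝ | k < 0 ∧ cosh (c * √(-k)) = cosh (a * √(-k)) * cosh (b * √(-k)) +
        1 / 2 * (sinh (a * √(-k)) * sinh (b * √(-k)))} = {L} := by
      have hrw : ∀ k, k < 0 → (cosh (c * √(-k)) = cosh (a * √(-k)) * cosh (b * √(-k)) +
          1 / 2 * (sinh (a * √(-k)) * sinh (b * √(-k))) ↔
          cs k c = cs k a * cs k b - k / 2 * (sn k a * sn k b)) := by
        intro k hk
        have h0 := sqrt_pos.2 (neg_pos.2 hk)
        have : k / 2 * (sn k a * sn k b) = -(1 / 2 * (sinh (a * √(-k)) * sinh (b * √(-k)))) := by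
          rw [sn_neg_curv hk, sn_neg_curv hk, mul_comm a, mul_comm b]
          field_simp
          rw [sq_sqrt_neg hk]; ring
        rw [this, sub_neg_eq_add, cs_neg_curv hk, cs_neg_curv hk, cs_neg_curv hk, mul_comm c,
          mul_comm a, mul_comm b]
      ext k
      simp only [Set.mem_ofPred_eq, Set.mem_singleton_iff]
      constructor
      · rintro ⟨g1, g3⟩
        refine (hiff k g1.ne ?_).1 ((hrw k g1).1 g3)
        nlinarith [sq_nonneg ((a + b + c) / 2), pi_pos]
      · rintro rfl
        exact ⟨hneg, (hrw k hneg).2 ((hiff k hneg.ne hL.le).2 rfl)⟩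
    rw [hset]; simp

end Psi

/-! ### Comparison of the minimum with a sum of two sides -/

theorem steiner_lt_of_psi_lt {a b c k : ℝ} (hnd : Nondeg a b c k) (hpsi : psi a b c k < 3 / 4) :
    steiner a b c k < a + b := by
  have h := isModel_modelPlane k
  obtain ⟨A, B, C, P, hT, hP, hS, hmin⟩ := exists_steiner_point hnd
  have hang := (psi_eq_iff (c := c) hnd.a_pos hnd.b_pos hnd.ka hnd.kb).2.1 hpsi
  obtain ⟨P', hP', hlt⟩ := h.exists_lt_vertex hnd hT (by
    unfold inn
    rw [h.d_comm C A, h.d_comm C B, hT.1, hT.2.1, hT.2.2]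
    exact hang)
  exact (hmin P' hP').trans_lt hlt

/-- Below every sum of two sides the minimum is a Fermat point. -/
theorem exists_fermat {a b c k : ℝ} (hnd : Nondeg a b c k) (h1 : steiner a b c k < a + b)
    (h2 : steiner a b c k < a + c) (h3 : steiner a b c k < b + c) :
    ∃ A B C P : (modelPlane k).carrier, ∃ l m j n E, (modelPlane k).IsTriangle a b c A B C ∧
      P ∈ (modelPlane k).solidTriangle A B C ∧
      steiner a b c k = (modelPlane k).d P A + (modelPlane k).d P B + (modelPlane k).d P C ∧
      IsFermat k (modelPlane k) A B C P l m j n E := by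
  have h := isModel_modelPlane k
  obtain ⟨A, B, C, P, hT, hP, hS, hmin⟩ := exists_steiner_point hnd
  have hpos : 0 < (modelPlane k).d P A ∧ 0 < (modelPlane k).d P B ∧
      0 < (modelPlane k).d P C := by
    obtain ⟨t1, t2, t3⟩ := hT
    refine ⟨(h.d_nonneg _ _).lt_of_ne fun h0 => ?_, (h.d_nonneg _ _).lt_of_ne fun h0 => ?_,
      (h.d_nonneg _ _).lt_of_ne fun h0 => ?_⟩
    · have e1 := h.d_congr h0.symm B
      have e2 := h.d_congr h0.symm C
      linarith
    · have e1 := h.d_congr h0.symm A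
      have e2 := h.d_congr h0.symm C
      rw [h.d_comm B A] at e1
      linarith
    · have e1 := h.d_congr h0.symm A
      have e2 := h.d_congr h0.symm B
      rw [h.d_comm C A] at e1
      rw [h.d_comm C B] at e2
      linarith
  obtain ⟨l, m, j, n, E, hF⟩ := h.isFermat_of_min hnd hT hP
    (fun P' hP' => hS ▸ hmin P' hP') hpos.1 hpos.2.1 hpos.2.2
  exact ⟨A, B, C, P, l, m, j, n, E, hT, hP, hS, hF⟩

/-- In a triangle `P A C` with angle `2π/3` at `P` and a short side `b` opposite to it, the angle at
`C` is less than `π/3`. -/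
theorem angle_lt_of_fermat {k x z b : ℝ} (hx : 0 < x) (hz : 0 < z) (hb : 0 ≤ b)
    (hkx : k * x ^ 2 < π ^ 2) (hkz : k * z ^ 2 < π ^ 2)
    (hmd : md k b = md k x + md k z - k * (md k x * md k z) + 1 / 2 * (sn k x * sn k z))
    (hcs : 0 ≤ cs k b) (hkb : k * b ^ 2 ≤ π ^ 2) (hxz : k * (x + z) ^ 2 ≤ π ^ 2) :
    1 / 2 * (sn k z * sn k b) < md k z + md k b - k * (md k z * md k b) - md k x := by
  have sx := sn_pos hx hkx
  have sz := sn_pos hz hkz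
  have sb := sn_nonneg hb hkb
  set p := sn k z * cs k x + 1 / 2 * (sn k x * cs k z) with hp
  -- So p is sn b times the cosine of the angle at C. The next identity is the law of sines: sn b
  -- times its sine is (√3/2) sn x. Hence sn x < 2p suffices.
  have e1 : md k z + md k b - k * (md k z * md k b) - md k x = sn k z * p := by
    have hz2 := sn_sq k z
    rw [hmd, hp, cs_eq, cs_eq]
    linear_combination (k * md k x - 1) * hz2
  have e2 : sn k b ^ 2 = p ^ 2 + 3 / 4 * sn k x ^ 2 := by
    have hx2 := sn_sq k x
    have hz2 := sn_sq k z
    rw [sn_sq k b, hmd, hp, cs_eq, cs_eq]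
    linear_combination (-1) * hx2 - ((1 - k * md k x) ^ 2 + k / 4 * sn k x ^ 2) * hz2
  have e3 : sn k x < 2 * p := by
    rcases le_or_gt k 0 with hk | hk
    · have c1 := cs_pos_of_nonpos hk x
      have c2 := cs_pos_of_nonpos hk z
      have : 0 < sn k z * cs k x := mul_pos sz (by linarith)
      have : sn k x ≤ sn k x * cs k z := by nlinarith
      rw [hp]; linarith
    · have hcb : cs k b = cs k x * cs k z - k / 2 * (sn k x * sn k z) := by
        rw [cs_eq, hmd, cs_eq, cs_eq]; ring
      have hprod : 0 < cs k x * cs k z := by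
        have : 0 < k / 2 * (sn k x * sn k z) := by positivity
        linarith
      have hsum : 0 ≤ cs k x + cs k z := by
        have h0 := sqrt_pos.2 hk
        have hxz' := sqrt_mul_le_pi hk hxz
        have g1 : 0 < √k * x := by positivity
        have g2 : 0 < √k * z := by positivity
        rw [cs_pos_curv hk, cs_pos_curv hk, cos_add_cos]
        have g3 : 0 ≤ cos ((√k * x + √k * z) / 2) :=
          cos_nonneg_of_neg_pi_div_two_le_of_le (by linarith [pi_pos]) (by linarith)
        have g4 : 0 ≤ cos ((√k * x - √k * z) / 2) :=
          cos_nonneg_of_neg_pi_div_two_le_of_le (by linarith [pi_pos]) (by linarith)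
        positivity
      have cz : 0 < cs k z := by
        by_contra! hc
        have : cs k x ≤ 0 := by
          by_contra! hc'
          nlinarith
        have : cs k z = 0 := by linarith
        rw [this] at hprod; simp at hprod
      have cz1 : cs k z < 1 := by
        rw [cs_eq]
        have := md_lt_md le_rfl hz hkz.le
        rw [md_zero] at this
        nlinarith
      have hz2 := cs_sq k z
      -- This is cs k b ≥ 0 multiplied by 2 sn z, where the shortness of b enters.
      have q1 : sn k x * (1 - cs k z ^ 2) ≤ 2 * (sn k z * cs k x) * cs k z := by
        have : k * sn k z ^ 2 = 1 - cs k z ^ 2 := by linarith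
        rw [← this]
        have := mul_nonneg sz.le (hcb ▸ hcs)
        linarith
      have q2 : sn k x * (1 - cs k z) < 2 * (sn k z * cs k x) := by
        by_contra! hc
        have r1 := mul_le_mul_of_nonneg_right hc cz.le
        have r2 : 0 < sn k x * (1 - cs k z) := mul_pos sx (by linarith)
        linarith
      rw [hp]; linarith
  rw [e1]
  have : sn k b < 2 * p := by
    apply lt_of_pow_lt_pow_left₀ 2 (by linarith)
    rw [e2]
    have := pow_lt_pow_left₀ e3 sx.le two_ne_zero
    linarith [mul_pow 2 p 2]
  have := mul_lt_mul_of_pos_left this sz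
  linarith

/-- A triangle with short sides and angle `2π/3` at `C` has no Fermat point. -/
theorem IsModel.angle_ne_of_fermat {k : ℝ} {M : Plane} (h : IsModel k M) {a b c : ℝ}
    {A B C P : M.carrier} (hnd : Nondeg a b c k) (hT : M.IsTriangle a b c A B C)
    {l m j n E : ℝ} (hF : IsFermat k M A B C P l m j n E) (hka : 4 * (k * a ^ 2) ≤ π ^ 2)
    (hkb : 4 * (k * b ^ 2) ≤ π ^ 2) (hle : M.d P A + M.d P B + M.d P C ≤ a + b) :
    inn k M C A B ≠ -1 / 2 * (sn k a * sn k b) := by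
  intro hG
  have sa := sn_pos hnd.a_pos hnd.ka
  have sb := sn_pos hnd.b_pos hnd.kb
  have sz := sn_pos hF.PC hF.kC
  have hab : k * (a + b) ^ 2 ≤ π ^ 2 := by
    rcases le_or_gt k 0 with hk | hk
    · nlinarith [sq_nonneg (a + b), pi_pos]
    · nlinarith [sq_nonneg (a - b)]
  obtain ⟨t1, t2, t3⟩ := hT
  have hAC := hF.AC
  have hBC := hF.BC
  unfold inn at hAC hBC
  rw [t2] at hAC
  rw [t1] at hBC
  have u1 := angle_lt_of_fermat hF.PA hF.PC hnd.b_pos.le hF.kA hF.kC (by linarith)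
    (cs_nonneg hnd.b_pos.le hkb) hnd.kb.le
    (mul_sq_le_of_le (by linarith [hF.PA, hF.PC]) (by linarith [hF.PB]) hab)
  have u2 := angle_lt_of_fermat hF.PB hF.PC hnd.a_pos.le hF.kB hF.kC (by linarith)
    (cs_nonneg hnd.a_pos.le hka) hnd.ka.le
    (mul_sq_le_of_le (by linarith [hF.PB, hF.PC]) (by linarith [hF.PA]) hab)
  have i1 := h.comb_inn hF.comb C A
  have i2 := h.comb_inn hF.comb C B
  have i3 := h.comb_inn hF.comb C P
  have hCA : M.d C A = b := by rw [h.d_comm]; exact t2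
  have hCB : M.d C B = a := by rw [h.d_comm]; exact t1
  have hCP : M.d C P = M.d P C := h.d_comm _ _
  rw [h.inn_base, h.inn_self, h.inn_comm C B A, hG, hCA] at i1
  rw [h.inn_base, h.inn_self, hG, hCB] at i2
  rw [h.inn_base, h.inn_self, h.inn_comm C A P, h.inn_comm C B P, hCP] at i3
  have v1 : inn k M C P A = md k (M.d P C) + md k b - k * (md k (M.d P C) * md k b) -
      md k (M.d P A) := by unfold inn; rw [hCP, hCA]
  have v2 : inn k M C P B = md k (M.d P C) + md k a - k * (md k (M.d P C) * md k a) -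
      md k (M.d P B) := by unfold inn; rw [hCP, hCB]
  rw [← v1] at u1
  rw [← v2] at u2
  have hn := hF.n_pos
  -- At C the vector towards P, of length N, is a sum of vectors of lengths L and R at angle 2π/3.
  -- Angles below π/3 with both would give N < (L+R)/2, but N² = L² + R² - LR ≥ (L+R)²/4.
  obtain ⟨L, hL⟩ : ∃ L, L = l * sn k b := ⟨_, rfl⟩
  obtain ⟨R, hR⟩ : ∃ R, R = m * sn k a := ⟨_, rfl⟩
  obtain ⟨N, hN⟩ : ∃ N, N = n * sn k (M.d P C) := ⟨_, rfl⟩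
  have hL0 : 0 < L := by rw [hL]; exact mul_pos hF.l_pos sb
  have hR0 : 0 < R := by rw [hR]; exact mul_pos hF.m_pos sa
  have hN0 : 0 < N := by rw [hN]; positivity
  have w1 : N / 2 < L - R / 2 := by
    have := mul_lt_mul_of_pos_left u1 hn
    rw [i1] at this
    apply lt_of_mul_lt_mul_right _ sb.le
    rw [hN, hL, hR]; linarith
  have w2 : N / 2 < R - L / 2 := by
    have := mul_lt_mul_of_pos_left u2 hn
    rw [i2] at this
    apply lt_of_mul_lt_mul_right _ sa.le
    rw [hN, hL, hR]; linarith
  have w3 : N ^ 2 = L ^ 2 + R ^ 2 - L * R := by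
    rw [hN, hL, hR]
    linear_combination n * i3 + l * i1 + m * i2
  nlinarith [sq_nonneg (L - R)]

theorem le_steiner_of_psi_eq {a b c k : ℝ} (hnd : Nondeg a b c k) (hac : a ≤ c) (hbc : b ≤ c)
    (hpsi : psi a b c k = 3 / 4) (hka : 4 * (k * a ^ 2) ≤ π ^ 2)
    (hkb : 4 * (k * b ^ 2) ≤ π ^ 2) : a + b ≤ steiner a b c k := by
  by_contra! hlt
  have h := isModel_modelPlane k
  obtain ⟨A, B, C, P, l, m, j, n, E, hT, hP, hS, hF⟩ := exists_fermat hnd hlt (by linarith)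
    (by linarith)
  refine h.angle_ne_of_fermat hnd hT hF hka hkb (by linarith) ?_
  unfold inn
  rw [h.d_comm C A, h.d_comm C B, hT.1, hT.2.1, hT.2.2]
  exact (psi_eq_iff (c := c) hnd.a_pos hnd.b_pos hnd.ka hnd.kb).1.1 hpsi

end

/-! ### Dependence of the minimum on the curvature -/

/-- The derivative form of the monotonicity of the angle in the curvature, for the angle `2π/3`. -/
theorem side_mul_sn_lt {k x y c : ℝ} (hk : k ≠ 0) (hx : 0 < x) (hy : 0 < y) (hc : 0 < c)
    (hkx : k * x ^ 2 < π ^ 2) (hky : k * y ^ 2 < π ^ 2) (hkc : k * c ^ 2 < π ^ 2)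
    (hmd : md k c = md k x + md k y - k * (md k x * md k y) + 1 / 2 * (sn k x * sn k y)) :
    0 < k * (c * sn k c - (x * (sn k x * cs k y) + y * (cs k x * sn k y) +
      1 / 2 * (x * (cs k x * sn k y) + y * (sn k x * cs k y)))) := by
  have sx := sn_pos hx hkx
  have sy := sn_pos hy hky
  have sxy := mul_pos sx sy
  have h1 : c < x + y := by
    apply lt_of_md_lt (by linarith) hkc.le
    rw [md_add, hmd]; linarith
  have h2 : |x - y| < c := by
    apply lt_of_md_lt hc.le
    · rw [sq_abs]
      rcases le_total x y with h | h
      · rw [show (x - y) ^ 2 = (y - x) ^ 2 by ring]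
        exact (mul_sq_lt_of_le (by linarith) (by linarith) hky).le
      · exact (mul_sq_lt_of_le (by linarith) (by linarith) hkx).le
    · have : md k |x - y| = md k (x - y) := by
        rcases abs_choice (x - y) with h | h <;> rw [h]
        exact md_neg _ _
      rw [this, md_sub, hmd]; linarith
  have h3 := abs_lt.1 h2
  obtain ⟨u, hu⟩ : ∃ u, u = (y + c - x) / 2 := ⟨_, rfl⟩
  obtain ⟨v, hv⟩ : ∃ v, v = (x + c - y) / 2 := ⟨_, rfl⟩
  have su := sn_pos (k := k) (t := u) (by linarith) (mul_sq_lt_of_le (by linarith) (by linarith) hky)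
  have sv := sn_pos (k := k) (t := v) (by linarith) (mul_sq_lt_of_le (by linarith) (by linarith) hkx)
  have i1 := mul_cs_mul_sn_lt hk (u := u) (v := y) (by linarith) (by linarith) hky
  have i2 := mul_cs_mul_sn_lt hk (u := v) (v := x) (by linarith) (by linarith) hkx
  -- Here u and v are the half-perimeter minus x and minus y. This is the half-angle formula at
  -- 2π/3, and `mul_cs_mul_sn_lt` handles each factor.
  have e : sn k u * sn k v = 3 / 4 * (sn k x * sn k y) := by
    have := md_sub_md k c (x - y)
    rw [md_sub, hmd, show (c + (x - y)) / 2 = v by rw [hv]; ring,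
      show (c - (x - y)) / 2 = u by rw [hu]; ring] at this
    linarith
  have e1 : c * sn k c - (x - y) * sn k (x - y) =
      2 * (u * cs k u * sn k v) + 2 * (v * sn k u * cs k v) := by
    have hc' : c = u + v := by rw [hu, hv]; ring
    have hxy : x - y = v - u := by rw [hu, hv]; ring
    rw [hc', hxy, sn_add, sn_sub]; ring
  have j1 : 0 < k * (u * cs k u * sn k v - 3 / 4 * (y * cs k y * sn k x)) := by
    apply pos_of_mul_pos_left (b := sn k y) _ sy.le
    have := mul_pos i1 sv
    have e' : k * (u * cs k u * sn k v - 3 / 4 * (y * cs k y * sn k x)) * sn k y =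
        k * (u * cs k u * sn k y - y * cs k y * sn k u) * sn k v := by
      linear_combination k * y * cs k y * e
    rwa [e']
  have j2 : 0 < k * (v * cs k v * sn k u - 3 / 4 * (x * cs k x * sn k y)) := by
    apply pos_of_mul_pos_left (b := sn k x) _ sx.le
    have := mul_pos i2 su
    have e' : k * (v * cs k v * sn k u - 3 / 4 * (x * cs k x * sn k y)) * sn k x =
        k * (v * cs k v * sn k x - x * cs k x * sn k v) * sn k u := by
      linear_combination k * x * cs k x * e
    rwa [e']
  rw [sn_sub] at e1
  have e2 : k * (c * sn k c - (x * (sn k x * cs k y) + y * (cs k x * sn k y) +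
      1 / 2 * (x * (cs k x * sn k y) + y * (sn k x * cs k y)))) =
      2 * (k * (u * cs k u * sn k v - 3 / 4 * (y * cs k y * sn k x))) +
      2 * (k * (v * cs k v * sn k u - 3 / 4 * (x * cs k x * sn k y))) := by
    linear_combination k * e1
  linarith

/-- Half of the negative derivative of `nsq` with respect to the curvature, up to sign. -/
def nsqDeriv (k a b c l m j : ℝ) : ℝ :=
  l * m * (c * sn k c) + m * j * (a * sn k a) + l * j * (b * sn k b)

/-- The derivative with respect to the curvature of the distance `x` from the point with weights
`l, m, j` to the first vertex. -/
def legDeriv (k a b c l m j n x : ℝ) : ℝ :=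
  ((m * (c * sn k c) + j * (b * sn k b)) / 2 - nsqDeriv k a b c l m j / (2 * n) * cs k x -
    n * (x * sn k x) / 2) / (n * k * sn k x)

theorem hasDerivAt_cs_const {k : ℝ} (hk : k ≠ 0) (t : ℝ) :
    HasDerivAt (fun k => cs k t) (-(t / 2) * sn k t) k := by
  simpa using hasDerivAt_cs_curv hk (hasDerivAt_const k t)

theorem nsq_eq (k a b c l m j : ℝ) : nsq k a b c l m j =
    l ^ 2 + m ^ 2 + j ^ 2 + 2 * (l * m * cs k c + m * j * cs k a + l * j * cs k b) := by
  unfold nsq qf; rw [cs_eq, cs_eq, cs_eq]; ring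

theorem eventually_leg_lt {k a b c l m j n x η : ℝ} (hk : k ≠ 0) (hn : 0 < n)
    (hnn : n ^ 2 = nsq k a b c l m j) (hx : 0 < x) (hkx : k * x ^ 2 < π ^ 2)
    (hval : n * cs k x = l + m * cs k c + j * cs k b) (hη : 0 < η) :
    ∀ᶠ k' in 𝓝[<] k, ∀ x', k' * x' ^ 2 ≤ π ^ 2 →
      √(nsq k' a b c l m j) * cs k' x' = l + m * cs k' c + j * cs k' b →
      x' < x + (k' - k) * (legDeriv k a b c l m j n x - η) := by
  have sx := sn_pos hx hkx
  set ξ := legDeriv k a b c l m j n x with hξ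
  set W := nsqDeriv k a b c l m j with hW
  have hsq : √(nsq k a b c l m j) = n := by rw [← hnn, sqrt_sq hn.le]
  have d1 : HasDerivAt (fun k' => nsq k' a b c l m j) (-W) k := by
    simp only [nsq_eq]
    have := ((((hasDerivAt_cs_const hk c).const_mul (l * m)).add
      ((hasDerivAt_cs_const hk a).const_mul (m * j))).add
      ((hasDerivAt_cs_const hk b).const_mul (l * j))).const_mul 2
    refine (this.const_add (l ^ 2 + m ^ 2 + j ^ 2)).congr_deriv ?_
    rw [hW, nsqDeriv]; ring
  have d2 : HasDerivAt (fun k' => √(nsq k' a b c l m j)) (-W / (2 * n)) k := by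
    have := d1.sqrt (by rw [← hnn]; positivity)
    rwa [hsq] at this
  have d3 : HasDerivAt (fun k' : ℝ => x + (k' - k) * (ξ - η)) (ξ - η) k := by
    have := (((hasDerivAt_id' k).sub_const k).mul_const (ξ - η)).const_add x
    exact this.congr_deriv (by ring)
  have d4 := hasDerivAt_cs_curv hk d3
  simp only [sub_self, zero_mul, add_zero] at d4
  have d5 := ((((hasDerivAt_cs_const hk c).const_mul m).const_add l).add
    ((hasDerivAt_cs_const hk b).const_mul j)).sub (d2.mul d4)
  have d6 := (hasDerivAt_id' k).mul d5
  have hneg : -(k ^ 2 * η * n * sn k x) < 0 := by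
    have : 0 < k ^ 2 := by positivity
    have : 0 < k ^ 2 * η * n * sn k x := by positivity
    linarith
  -- For k' < k the trial length x + (k' - k)(ξ - η) exceeds the first-order leg by (k - k')η, which
  -- makes this derivative negative. The factor k' lets a comparison of `cs` become one of `md` for
  -- either sign of the curvature.
  have d7 : HasDerivAt (fun k' => k' * (l + m * cs k' c + j * cs k' b -
      √(nsq k' a b c l m j) * cs k' (x + (k' - k) * (ξ - η)))) (-(k ^ 2 * η * n * sn k x)) k := by
    refine d6.congr_deriv ?_
    simp only [Pi.add_apply, Pi.mul_apply, Pi.sub_apply, sub_self, zero_mul, add_zero, hsq]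
    have hξ' : n * k * sn k x * ξ = (m * (c * sn k c) + j * (b * sn k b)) / 2 -
        W / (2 * n) * cs k x - n * (x * sn k x) / 2 := by
      rw [hξ, legDeriv, ← hW]; field_simp
    have : -W / (2 * n) = -(W / (2 * n)) := by ring
    rw [this]
    linear_combination -hval + k * hξ'
  have d8 : Tendsto _ (𝓝[<] k) _ := (hasDerivAt_iff_tendsto_slope.1 d7).mono_left
    (nhdsWithin_mono k fun x (hx : x < k) => hx.ne)
  have e1 : ∀ᶠ k' in 𝓝[<] k, 0 < x + (k' - k) * (ξ - η) := by
    have : Tendsto (fun k' : ℝ => x + (k' - k) * (ξ - η)) (𝓝 k) (𝓝 (x + (k - k) * (ξ - η))) :=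
      (by fun_prop : Continuous fun k' : ℝ => x + (k' - k) * (ξ - η)).tendsto k
    rw [sub_self, zero_mul, add_zero] at this
    exact (this.mono_left nhdsWithin_le_nhds).eventually (lt_mem_nhds hx)
  filter_upwards [d8.eventually (gt_mem_nhds hneg), e1, self_mem_nhdsWithin]
    with k' h1 h2 h3 x' hx' hval'
  have h3 : k' < k := h3
  rw [slope_def_field] at h1
  have h4 : 0 < k' * (l + m * cs k' c + j * cs k' b -
      √(nsq k' a b c l m j) * cs k' (x + (k' - k) * (ξ - η))) := by
    have h5 : k * (l + m * cs k c + j * cs k b -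
      √(nsq k a b c l m j) * cs k (x + (k - k) * (ξ - η))) = 0 := by
      rw [hsq, sub_self, zero_mul, add_zero, hval]; ring
    rw [h5, sub_zero] at h1
    by_contra! hc
    have := div_nonneg_of_nonpos hc (by linarith : k' - k ≤ 0)
    linarith
  apply lt_of_md_lt h2.le hx'
  rw [← hval', cs_eq, cs_eq] at h4
  by_contra! hc
  have := mul_nonneg (mul_nonneg (sq_nonneg k') (sqrt_nonneg (nsq k' a b c l m j)))
    (sub_nonneg.2 hc)
  nlinarith

theorem IsModel.comb_cs {k : ℝ} {M : Plane} (h : IsModel k M) {A B C P : M.carrier}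
    {l m j n E : ℝ} (hP : Comb k M A B C P l m j n E) :
    n * cs k (M.d P A) = l + m * cs k (M.d A B) + j * cs k (M.d A C) ∧
    n * cs k (M.d P B) = m + l * cs k (M.d A B) + j * cs k (M.d B C) ∧
    n * cs k (M.d P C) = j + m * cs k (M.d B C) + l * cs k (M.d A C) ∧
    n = l * cs k (M.d P A) + m * cs k (M.d P B) + j * cs k (M.d P C) := by
  obtain ⟨v1, v2, v3, v4⟩ := h.comb_values hP
  have := hP.1
  simp only [cs_eq]
  refine ⟨by linear_combination k * v2 - this, by linear_combination k * v3 - this,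
    by linear_combination k * v4 - this, by linear_combination -this - k * v1⟩

/-- The sum of the derivatives of the distances at a Fermat point is positive. -/
theorem IsModel.legDeriv_sum_pos {k : ℝ} {M : Plane} (h : IsModel k M) (hk : k ≠ 0) {a b c : ℝ}
    {A B C P : M.carrier} (hnd : Nondeg a b c k) (hT : M.IsTriangle a b c A B C)
    {l m j n E : ℝ} (hF : IsFermat k M A B C P l m j n E) :
    0 < legDeriv k a b c l m j n (M.d P A) + legDeriv k b a c m l j n (M.d P B) +
      legDeriv k c b a j m l n (M.d P C) := by
  obtain ⟨-, -, -, c4⟩ := h.comb_cs hF.comb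
  obtain ⟨t1, t2, t3⟩ := hT
  have hAB := hF.AB
  have hAC := hF.AC
  have hBC := hF.BC
  unfold inn at hAB hAC hBC
  rw [t3] at hAB
  rw [t2] at hAC
  rw [t1] at hBC
  have i1 := side_mul_sn_lt hk hF.PA hF.PB hnd.c_pos hF.kA hF.kB hnd.kc (by linarith)
  have i2 := side_mul_sn_lt hk hF.PA hF.PC hnd.b_pos hF.kA hF.kC hnd.kb (by linarith)
  have i3 := side_mul_sn_lt hk hF.PB hF.PC hnd.a_pos hF.kB hF.kC hnd.ka (by linarith)
  have sx := sn_pos hF.PA hF.kA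
  have sy := sn_pos hF.PB hF.kB
  have sz := sn_pos hF.PC hF.kC
  have hl := hF.l_pos
  have hm := hF.m_pos
  have hj := hF.j_pos
  have hn := hF.n_pos
  have lm := hF.lm
  have mj := hF.mj
  unfold legDeriv nsqDeriv
  generalize M.d P A = x at *
  generalize M.d P B = y at *
  generalize M.d P C = z at *
  -- At a Fermat point the three products of weight and sine agree. Their common value clears the
  -- denominators.
  obtain ⟨ρ, hρ⟩ : ∃ ρ, ρ = l * sn k x := ⟨_, rfl⟩
  have hρ0 : 0 < ρ := by rw [hρ]; positivity
  have hX : sn k x = ρ / l := by rw [hρ]; field_simp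
  have hY : sn k y = ρ / m := by rw [hρ, lm]; field_simp
  have hZ : sn k z = ρ / j := by rw [hρ, lm, mj]; field_simp
  obtain ⟨W, hW⟩ : ∃ W, W = l * m * (c * sn k c) + m * j * (a * sn k a) + l * j * (b * sn k b) :=
    ⟨_, rfl⟩
  -- The side inequalities are added with the products of weights as coefficients. The leg terms
  -- collect through n = l cs x + m cs y + j cs z.
  have key : 0 < k * (W - n * ρ * (x + y + z)) := by
    have p1 := mul_pos (mul_pos hl hm) i1
    have p2 := mul_pos (mul_pos hl hj) i2
    have p3 := mul_pos (mul_pos hm hj) i3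
    have : k * (W - n * ρ * (x + y + z)) = l * m * (k * (c * sn k c - (x * (sn k x * cs k y) +
        y * (cs k x * sn k y) + 1 / 2 * (x * (cs k x * sn k y) + y * (sn k x * cs k y))))) +
        l * j * (k * (b * sn k b - (x * (sn k x * cs k z) + z * (cs k x * sn k z) +
        1 / 2 * (x * (cs k x * sn k z) + z * (sn k x * cs k z))))) +
        m * j * (k * (a * sn k a - (y * (sn k y * cs k z) + z * (cs k y * sn k z) +
        1 / 2 * (y * (cs k y * sn k z) + z * (sn k y * cs k z))))) := by
      rw [hW, c4, hX, hY, hZ]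
      field_simp
      ring
    rw [this]; positivity
  have e : ((m * (c * sn k c) + j * (b * sn k b)) / 2 -
        (l * m * (c * sn k c) + m * j * (a * sn k a) + l * j * (b * sn k b)) / (2 * n) * cs k x -
        n * (x * sn k x) / 2) / (n * k * sn k x) +
      ((l * (c * sn k c) + j * (a * sn k a)) / 2 -
        (m * l * (c * sn k c) + l * j * (b * sn k b) + m * j * (a * sn k a)) / (2 * n) * cs k y -
        n * (y * sn k y) / 2) / (n * k * sn k y) +
      ((m * (a * sn k a) + l * (b * sn k b)) / 2 -
        (j * m * (a * sn k a) + m * l * (c * sn k c) + j * l * (b * sn k b)) / (2 * n) * cs k z -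
        n * (z * sn k z) / 2) / (n * k * sn k z) =
      k * (W - n * ρ * (x + y + z)) / (2 * n * ρ * k ^ 2) := by
    have w1 : m * l * (c * sn k c) + l * j * (b * sn k b) + m * j * (a * sn k a) = W := by
      rw [hW]; ring
    have w2 : j * m * (a * sn k a) + m * l * (c * sn k c) + j * l * (b * sn k b) = W := by
      rw [hW]; ring
    have w3 : l * (m * (c * sn k c) + j * (b * sn k b)) + m * (l * (c * sn k c) + j * (a * sn k a))
      + j * (m * (a * sn k a) + l * (b * sn k b)) = 2 * W := by rw [hW]; ring
    rw [w1, w2, ← hW, hX, hY, hZ]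
    field_simp
    linear_combination n * w3 + W * c4
  rw [e]
  have : 0 < k ^ 2 := by positivity
  positivity

/-- The weights of the Fermat point at k serve as a competitor at k' < k. Only an upper bound on the
new minimum is needed, so the minimizer need not be followed as k varies. -/
theorem eventually_steiner_lt {a b c k : ℝ} (hk : k ≠ 0) (hnd : Nondeg a b c k)
    (h1 : steiner a b c k < a + b) (h2 : steiner a b c k < a + c) (h3 : steiner a b c k < b + c) :
    ∀ᶠ k' in 𝓝[<] k, steiner a b c k' < steiner a b c k := by
  have h := isModel_modelPlane k
  obtain ⟨A, B, C, P, l, m, j, n, E, hT, hP, hS, hF⟩ := exists_fermat hnd h1 h2 h3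
  have hsum := h.legDeriv_sum_pos hk hnd hT hF
  obtain ⟨c1, c2, c3, -⟩ := h.comb_cs hF.comb
  have hnn := (h.comb_nE hF.comb).2
  obtain ⟨t1, t2, t3⟩ := hT
  rw [t1, t2, t3] at hnn
  rw [t3, t2] at c1
  rw [t3, t1] at c2
  rw [t1, t2] at c3
  set x := (modelPlane k).d P A
  set y := (modelPlane k).d P B
  set z := (modelPlane k).d P C
  set ξ₁ := legDeriv k a b c l m j n x
  set ξ₂ := legDeriv k b a c m l j n y
  set ξ₃ := legDeriv k c b a j m l n z
  have hη : 0 < (ξ₁ + ξ₂ + ξ₃) / 6 := by linarith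
  have e1 := eventually_leg_lt hk hF.n_pos hnn hF.PA hF.kA c1 hη
  have e2 := eventually_leg_lt hk hF.n_pos (hnn.trans (nsq_swap k a b c l m j).symm) hF.PB hF.kB
    c2 hη
  have e3 := eventually_leg_lt hk hF.n_pos (hnn.trans (nsq_swap' k a b c l m j).symm) hF.PC hF.kC
    c3 hη
  filter_upwards [e1, e2, e3, self_mem_nhdsWithin] with k' f1 f2 f3 f4
  have f4 : k' < k := f4
  have hnd' := hnd.of_le f4.le
  have h' := isModel_modelPlane k'
  obtain ⟨A', B', C', hT'⟩ := hnd'.triangle_exists h'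
  have hn' := hnd'.nsq_pos hF.l_pos.le hF.m_pos.le hF.j_pos.le (by rw [hF.sum]; norm_num)
  have hn'' := hn'
  obtain ⟨s1, s2, s3⟩ := hT'
  rw [← s1, ← s2, ← s3] at hn''
  obtain ⟨P', hP'⟩ := h'.comb_exists A' B' C' _ _ _ hF.l_pos.le hF.m_pos.le hF.j_pos.le
    (by rw [hF.sum]; norm_num) hn''
  obtain ⟨g1, g2, g3⟩ := h'.sum_eq_sumDist ⟨s1, s2, s3⟩ (by rw [hF.sum]; norm_num)
    (sqrt_pos.2 hn'') hP'
  obtain ⟨q1, q2, q3, -⟩ := h'.comb_cs hP'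
  rw [s1, s2, s3] at q1 q2 q3
  have r1 := f1 _ (h'.d_le P' A') q1
  have r2 := f2 _ (h'.d_le P' B') (by rw [nsq_swap]; exact q2)
  have r3 := f3 _ (h'.d_le P' C') (by rw [nsq_swap']; exact q3)
  have hle := steiner_le_sumDist hnd' (p := ![l, m, j]) ⟨by
    intro i; fin_cases i
    · simpa using hF.l_pos.le
    · simpa using hF.m_pos.le
    · simpa using hF.j_pos.le, by simpa [Fin.sum_univ_three] using hF.sum⟩
  have hsd : sumDist a b c k' ![l, m, j] = (modelPlane k').d P' A' + (modelPlane k').d P' B' +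
      (modelPlane k').d P' C' := by
    rw [g1, g2, g3]; simp [sumDist]
  rw [hsd] at hle
  rw [hS]
  have : (k' - k) * (ξ₁ - (ξ₁ + ξ₂ + ξ₃) / 6) + (k' - k) * (ξ₂ - (ξ₁ + ξ₂ + ξ₃) / 6) +
      (k' - k) * (ξ₃ - (ξ₁ + ξ₂ + ξ₃) / 6) = (k' - k) * ((ξ₁ + ξ₂ + ξ₃) / 2) := by ring
  have : (k' - k) * ((ξ₁ + ξ₂ + ξ₃) / 2) < 0 :=
    mul_neg_of_neg_of_pos (by linarith) (by linarith)
  linarith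

/-! ### Global behaviour of the minimum up to Λ -/

/-- A continuous function that is, near each point but at most one, strictly smaller on the left is
strictly increasing. -/
theorem strictMonoOn_of_eventually_lt {f : ℝ → ℝ} {L p : ℝ} (hf : ContinuousOn f (Set.Iic L))
    (h : ∀ k ≤ L, k ≠ p → ∀ᶠ k' in 𝓝[<] k, f k' < f k) : StrictMonoOn f (Set.Iic L) := by
  have key : ∀ u v, u < v → v ≤ L → (∀ k ∈ Set.Ioc u v, k ≠ p) → f u < f v := by
    intro u v huv hv hp
    obtain ⟨t, ht, hmax⟩ := (isCompact_Icc (a := u) (b := v)).exists_isMinOn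
      ⟨u, ⟨le_rfl, huv.le⟩⟩ (hf.mono fun x hx => hx.2.trans hv)
    -- A minimizer other than the left endpoint would have smaller values just to its left.
    have htu : ∀ t ∈ Set.Icc u v, IsMinOn f (Set.Icc u v) t → t = u := by
      intro t ht hmin
      by_contra hne
      have hlt : u < t := lt_of_le_of_ne ht.1 (Ne.symm hne)
      have e1 := h t (ht.2.trans hv) (hp t ⟨hlt, ht.2⟩)
      have e2 : ∀ᶠ k' in 𝓝[<] t, u < k' := nhdsWithin_le_nhds (lt_mem_nhds hlt)
      obtain ⟨k', g1, g2, g3⟩ := (e1.and (e2.and self_mem_nhdsWithin)).exists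
      have g3 : k' < t := g3
      have : f t ≤ f k' := hmin ⟨g2.le, g3.le.trans ht.2⟩
      linarith
    have hu := htu t ht hmax
    subst hu
    refine lt_of_le_of_ne (hmax ⟨huv.le, le_rfl⟩) fun heq => ?_
    have := htu v ⟨huv.le, le_rfl⟩ fun x hx => by
      have : f t ≤ f x := hmax hx
      simpa [← heq] using this
    exact huv.ne' this
  -- The exceptional point may now be the right endpoint: strictness is gained up to the midpoint
  -- and the rest passes to the limit.
  have key2 : ∀ u v, u < v → v ≤ L → (∀ k ∈ Set.Ico u v, k ≠ p) → f u < f v := by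
    intro u v huv hv hp
    set w := (u + v) / 2 with hw
    have h1 : f u < f w := key u w (by linarith) (by linarith) fun k hk =>
      hp k ⟨hk.1.le, by linarith [hk.2]⟩
    have h2 : f w ≤ f v := by
      have hcont : ContinuousWithinAt f (Set.Iio v) v :=
        (hf v hv).mono fun x (hx : x < v) => hx.le.trans hv
      refine ge_of_tendsto hcont ?_
      have : ∀ᶠ x in 𝓝[<] v, w < x := nhdsWithin_le_nhds (lt_mem_nhds (by linarith))
      filter_upwards [this, self_mem_nhdsWithin] with x hx1 hx2
      have hx2 : x < v := hx2
      exact (key w x hx1 (by linarith) fun k hk => hp k ⟨by linarith [hk.1], by linarith [hk.2]⟩).le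
    linarith
  intro u hu v hv huv
  by_cases h1 : u < p ∧ p < v
  · exact (key2 u p h1.1 (h1.2.le.trans hv) fun k hk => hk.2.ne).trans
      (key p v h1.2 hv fun k hk => hk.1.ne')
  · by_cases h2 : u < p
    · exact key2 u v huv hv fun k hk hkp => h1 ⟨h2, by rw [← hkp]; exact hk.2⟩
    · exact key u v huv hv fun k hk hkp => h2 (by rw [← hkp]; exact hk.1)

/-- The solid triangle is swept out from A, so exchanging A with B is not visible in the definition.
It becomes so in barycentric weights, hence the nondegeneracy. -/
theorem steiner_swap {a b c k : ℝ} (hnd : Nondeg a b c k) :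
    steiner b a c k = steiner a b c k := by
  rw [steiner_eq hnd, steiner_eq hnd.swap]
  congr 1
  have key : ∀ a b c : ℝ, sumDist a b c k '' stdSimplex ℝ (Fin 3) ⊆
      sumDist b a c k '' stdSimplex ℝ (Fin 3) := by
    rintro a b c _ ⟨p, ⟨hp, hs⟩, rfl⟩
    rw [Fin.sum_univ_three] at hs
    refine ⟨![p 1, p 0, p 2], ⟨?_, ?_⟩, ?_⟩
    · intro i; fin_cases i
      · exact hp 1
      · exact hp 0
      · exact hp 2
    · simp [Fin.sum_univ_three]; linarith
    · have : legMd k c a b (p 2) (p 0) (p 1) = legMd k c b a (p 2) (p 1) (p 0) := by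
        unfold legMd nsq qf
        ring_nf
      simp [sumDist, this]; ring
  exact (key b a c).antisymm (key a b c)

theorem steiner_swap' (a b c k : ℝ) :
    steiner a c b k = steiner a b c k := by
  have h := isModel_modelPlane k
  unfold steiner
  have key : ∀ a b c : ℝ, {s : ℝ | ∃ A B C P : (modelPlane k).carrier,
      (modelPlane k).IsTriangle a b c A B C ∧ P ∈ (modelPlane k).solidTriangle A B C ∧
      s = (modelPlane k).d P A + (modelPlane k).d P B + (modelPlane k).d P C} ⊆
      {s : ℝ | ∃ A B C P : (modelPlane k).carrier,
      (modelPlane k).IsTriangle a c b A B C ∧ P ∈ (modelPlane k).solidTriangle A B C ∧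
      s = (modelPlane k).d P A + (modelPlane k).d P B + (modelPlane k).d P C} := by
    rintro a b c s ⟨A, B, C, P, ⟨t1, t2, t3⟩, ⟨D, hD, hP⟩, rfl⟩
    refine ⟨A, C, B, P, ⟨by rw [h.d_comm]; exact t1, t3, t2⟩, ⟨D, ?_, hP⟩, by ring⟩
    unfold Plane.Between at hD ⊢
    rw [h.d_comm C D, h.d_comm D B, h.d_comm C B]; linarith
  congr 1
  exact (key a c b).antisymm (key a b c)

theorem lambda_swap (a b c : ℝ) : lambda b a c = lambda a b c := by
  unfold lambda
  rw [min_left_comm, max_left_comm, add_comm b a]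

theorem lambda_swap' (a b c : ℝ) : lambda a c b = lambda a b c := by
  unfold lambda
  rw [min_comm c b, max_comm c b, add_right_comm]

theorem tendsto_inv_sqrt_neg (C : ℝ) : Tendsto (fun k : ℝ => C / √(-k)) atBot (𝓝 0) :=
  (tendsto_sqrt_atTop.comp tendsto_neg_atBot_atTop).const_div_atTop C

theorem half_perimeter_le_steiner {a b c k : ℝ} (hnd : Nondeg a b c k) :
    (a + b + c) / 2 ≤ steiner a b c k := by
  have h := isModel_modelPlane k
  obtain ⟨A, B, C, P, ⟨t1, t2, t3⟩, -, hS, -⟩ := exists_steiner_point hnd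
  have e1 := h.d_triangle A P B
  have e2 := h.d_triangle A P C
  have e3 := h.d_triangle B P C
  rw [h.d_comm A P] at e1 e2
  rw [h.d_comm B P] at e3
  linarith

/-- Legs enclosing the angle `2π/3` in a plane of very negative curvature. -/
theorem legs_le {k x y c : ℝ} (hk : k < 0) (hc : 0 ≤ c)
    (hmd : md k c = md k x + md k y - k * (md k x * md k y) + 1 / 2 * (sn k x * sn k y)) :
    x + y ≤ c + log (8 / 3) / √(-k) := by
  have hτ := sqrt_pos.2 (neg_pos.2 hk)
  -- This is the law of cosines at 2π/3. Dropping the last term and using e^t/2 ≤ cosh t, together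
  -- with cosh t ≤ e^t for t ≥ 0, gives the factor 8/3.
  have e1 : cs k c = 3 / 4 * cs k (x + y) + 1 / 4 * cs k (x - y) := by
    rw [cs_add, cs_sub, cs_eq, hmd, cs_eq, cs_eq]; ring
  have e2 := cs_pos_of_nonpos hk.le (x - y)
  rw [cs_neg_curv hk c, cs_neg_curv hk (x + y)] at e1
  set τ := √(-k)
  have e3 : cosh (τ * c) ≤ exp (τ * c) := by
    have : exp (-(τ * c)) ≤ exp (τ * c) := exp_le_exp.2 (by nlinarith)
    rw [cosh_eq]; linarith
  have e4 : 1 / 2 * exp (τ * (x + y)) ≤ cosh (τ * (x + y)) := by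
    rw [cosh_eq]; linarith [exp_pos (-(τ * (x + y)))]
  have e5 : exp (τ * (x + y)) ≤ exp (τ * c + log (8 / 3)) := by
    rw [exp_add, exp_log (by norm_num)]; linarith
  have e6 := exp_le_exp.1 e5
  have : τ * (log (8 / 3) / τ) = log (8 / 3) := by field_simp
  by_contra! hcon
  have := mul_lt_mul_of_pos_left hcon hτ
  linarith

/-- The behaviour of `steiner a b c` on `(-∞, L]`, where `L` is the value of `lambda`. -/
structure Core (a b c L : ℝ) : Prop where
  lam : lambda a b c = (L : EReal)
  nondeg : Nondeg a b c L
  lt_ab : ∀ k < L, steiner a b c k < a + b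
  lt_ac : ∀ k < L, steiner a b c k < a + c
  lt_bc : ∀ k < L, steiner a b c k < b + c
  cont : ContinuousOn (fun k => steiner a b c k) (Set.Iic L)
  mono : StrictMonoOn (fun k => steiner a b c k) (Set.Iic L)
  tendsto : Tendsto (fun k => steiner a b c k) atBot (𝓝 ((a + b + c) / 2))
  top : ∀ g, g ≤ a + b → g ≤ a + c → g ≤ b + c → 4 * (L * a ^ 2) ≤ π ^ 2 →
    4 * (L * b ^ 2) ≤ π ^ 2 → 4 * (L * c ^ 2) ≤ π ^ 2 → g ≤ steiner a b c L

theorem Core.of_eqOn {a b c a' b' c' L : ℝ} (h : Core a b c L)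
    (heq : ∀ k ≤ L, steiner a' b' c' k = steiner a b c k)
    (hsum : a' + b' + c' = a + b + c) :
    ContinuousOn (fun k => steiner a' b' c' k) (Set.Iic L) ∧
    StrictMonoOn (fun k => steiner a' b' c' k) (Set.Iic L) ∧
    Tendsto (fun k => steiner a' b' c' k) atBot (𝓝 ((a' + b' + c') / 2)) := by
  refine ⟨h.cont.congr heq, h.mono.congr fun k hk => (heq k hk).symm, ?_⟩
  rw [hsum]
  refine h.tendsto.congr' ?_
  filter_upwards [eventually_le_atBot L] with k hk
  exact (heq k hk).symm

theorem Core.swap {a b c L : ℝ} (h : Core a b c L) : Core b a c L := by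
  have heq : ∀ k ≤ L, steiner b a c k = steiner a b c k := fun k hk =>
    steiner_swap (h.nondeg.of_le hk)
  obtain ⟨h1, h2, h3⟩ := h.of_eqOn heq (by ring)
  refine ⟨lambda_swap a b c ▸ h.lam, h.nondeg.swap, fun k hk => ?_, fun k hk => ?_, fun k hk => ?_,
    h1, h2, h3, fun g g1 g2 g3 k1 k2 k3 => ?_⟩
  · rw [heq k hk.le, add_comm]; exact h.lt_ab k hk
  · rw [heq k hk.le]; exact h.lt_bc k hk
  · rw [heq k hk.le]; exact h.lt_ac k hk
  · rw [heq L le_rfl]; exact h.top g (by linarith) g3 g2 k2 k1 k3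

theorem Core.swap' {a b c L : ℝ} (h : Core a b c L) : Core a c b L := by
  have heq : ∀ k ≤ L, steiner a c b k = steiner a b c k := fun k hk =>
    steiner_swap' a b c k
  obtain ⟨h1, h2, h3⟩ := h.of_eqOn heq (by ring)
  refine ⟨lambda_swap' a b c ▸ h.lam, h.nondeg.swap', fun k hk => ?_, fun k hk => ?_,
    fun k hk => ?_, h1, h2, h3, fun g g1 g2 g3 k1 k2 k3 => ?_⟩
  · rw [heq k hk.le]; exact h.lt_ac k hk
  · rw [heq k hk.le]; exact h.lt_ab k hk
  · rw [heq k hk.le, add_comm]; exact h.lt_bc k hk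
  · rw [heq L le_rfl]; exact h.top g g2 g1 (by linarith) k1 k3 k2

theorem lambda_of_le {a b c : ℝ} (hab : a ≤ b) (hbc : b ≤ c) :
    lambda a b c = lambdaOrdered a b c := by
  unfold lambda
  rw [min_eq_left hbc, min_eq_left hab, max_eq_right hbc, max_eq_right (hab.trans hbc)]
  congr 1; ring

/-- The limit at -∞ is squeezed: half the perimeter bounds from below, and `legs_le` for the three
pairs of legs bounds from above with an error of order 1/√(-k). -/
theorem exists_core_of_le {a b c : ℝ} (ha : 0 < a) (hab : a ≤ b) (hbc : b ≤ c) (hc : c < a + b) :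
    ∃ L, Core a b c L := by
  have hb : 0 < b := by linarith
  obtain ⟨L, hlam, hL, hpsi, hlt⟩ := lambdaOrdered_eq ha hb (c := c) (by linarith) (by linarith) hc
  have hnd : Nondeg a b c L :=
    ⟨ha, hb, by linarith, by linarith, by linarith, hc, hL⟩
  have hab' : ∀ k < L, steiner a b c k < a + b := fun k hk =>
    steiner_lt_of_psi_lt (hnd.of_le hk.le) (hlt k hk)
  have hcont : ContinuousOn (fun k => steiner a b c k) (Set.Iic L) :=
    (continuousOn_steiner a b c).mono fun k hk => hnd.of_le hk
  refine ⟨L, by rw [lambda_of_le hab hbc, hlam], hnd, hab',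
    fun k hk => by linarith [hab' k hk], fun k hk => by linarith [hab' k hk], hcont, ?_, ?_, ?_⟩
  · refine strictMonoOn_of_eventually_lt (p := 0) hcont fun k hk hk0 => ?_
    by_cases hs : steiner a b c k < a + b
    · exact eventually_steiner_lt hk0 (hnd.of_le hk) hs (by linarith) (by linarith)
    -- If the value at k is at least a + b, there need be no Fermat point, but every k' < k lies
    -- below L, where the value is below a + b.
    · filter_upwards [self_mem_nhdsWithin] with k' hk'
      have hk' : k' < k := hk'
      linarith [hab' k' (by linarith)]
  · have hup : Tendsto (fun k : ℝ => (a + b + c) / 2 + (3 / 2 * log (8 / 3)) / √(-k)) atBot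
        (𝓝 ((a + b + c) / 2)) := by
      simpa using (tendsto_inv_sqrt_neg (3 / 2 * log (8 / 3))).const_add ((a + b + c) / 2)
    refine tendsto_of_tendsto_of_tendsto_of_le_of_le' tendsto_const_nhds hup ?_ ?_
    · filter_upwards [eventually_le_atBot L] with k hk
      exact half_perimeter_le_steiner (hnd.of_le hk)
    · filter_upwards [eventually_lt_atBot L, eventually_lt_atBot 0] with k hk hk0
      obtain ⟨A, B, C, P, l, m, j, n, E, ⟨t1, t2, t3⟩, -, hS, hF⟩ :=
        exists_fermat (hnd.of_le hk.le) (hab' k hk) (by linarith [hab' k hk])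
          (by linarith [hab' k hk])
      have hAB := hF.AB
      have hAC := hF.AC
      have hBC := hF.BC
      unfold inn at hAB hAC hBC
      rw [t3] at hAB
      rw [t2] at hAC
      rw [t1] at hBC
      have e1 := legs_le (x := (modelPlane k).d P A) (y := (modelPlane k).d P B) hk0 hnd.c_pos.le
        (by linarith)
      have e2 := legs_le (x := (modelPlane k).d P A) (y := (modelPlane k).d P C) hk0 hnd.b_pos.le
        (by linarith)
      have e3 := legs_le (x := (modelPlane k).d P B) (y := (modelPlane k).d P C) hk0 hnd.a_pos.le
        (by linarith)
      rw [hS]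
      have : 3 / 2 * log (8 / 3) / √(-k) = 3 / 2 * (log (8 / 3) / √(-k)) := by ring
      rw [this]
      linarith
  · intro g g1 g2 g3 k1 k2 k3
    exact g1.trans (le_steiner_of_psi_eq hnd (by linarith) hbc hpsi k1 k2)

theorem exists_core {a b c : ℝ} (ha : 0 < a) (hb : 0 < b) (hc : 0 < c) (h1 : a < b + c)
    (h2 : b < a + c) (h3 : c < a + b) : ∃ L, Core a b c L := by
  rcases le_total a b with hab | hab <;> rcases le_total b c with hbc | hbc <;>
    rcases le_total a c with hac | hac
  · exact exists_core_of_le ha hab hbc h3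
  · exact exists_core_of_le ha hab hbc h3
  · obtain ⟨L, hL⟩ := exists_core_of_le ha hac hbc h2
    exact ⟨L, hL.swap'⟩
  · obtain ⟨L, hL⟩ := exists_core_of_le hc hac hab (by linarith)
    exact ⟨L, hL.swap.swap'⟩
  · obtain ⟨L, hL⟩ := exists_core_of_le hb hab hac (by linarith)
    exact ⟨L, hL.swap⟩
  · obtain ⟨L, hL⟩ := exists_core_of_le hb hbc hac (by linarith)
    exact ⟨L, hL.swap'.swap⟩
  · obtain ⟨L, hL⟩ := exists_core_of_le hc hbc hab (by linarith)
    exact ⟨L, hL.swap.swap'.swap⟩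
  · obtain ⟨L, hL⟩ := exists_core_of_le hc hbc hab (by linarith)
    exact ⟨L, hL.swap.swap'.swap⟩

/-! ### Comparison in a CAT(k) space -/

section

theorem coe_lt_two_mul_modelDiam {k p : ℝ} (h : k * (p / 2) ^ 2 < π ^ 2) :
    (p : EReal) < 2 * modelDiam k := by
  unfold modelDiam
  split_ifs with hk
  · have hs := sqrt_pos.2 hk
    have e := sqrt_mul_lt_pi hk h
    have : (2 : EReal) * ((π / √k : ℝ) : EReal) = ((2 * (π / √k) : ℝ) : EReal) := by
      rw [EReal.coe_mul]; rfl
    rw [this, EReal.coe_lt_coe_iff, ← mul_div_assoc, lt_div_iff₀ hs]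
    linarith
  · rw [EReal.mul_top_of_pos (by norm_num)]
    exact EReal.coe_lt_top p

theorem perimeter_lt {k t u v : ℝ} (ht : 0 ≤ t) (hu : 0 ≤ u) (hv : 0 ≤ v)
    (h1 : 4 * (k * t ^ 2) ≤ π ^ 2) (h2 : 4 * (k * u ^ 2) ≤ π ^ 2) (h3 : 4 * (k * v ^ 2) ≤ π ^ 2) :
    k * ((t + u + v) / 2) ^ 2 < π ^ 2 := by
  have hpi : 0 < π ^ 2 := by positivity
  rcases le_or_gt k 0 with hk | hk
  · exact (mul_nonpos_of_nonpos_of_nonneg hk (sq_nonneg _)).trans_lt hpi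
  · have e1 := sqrt_mul_le_pi (t := 2 * t) hk (by linarith)
    have e2 := sqrt_mul_le_pi (t := 2 * u) hk (by linarith)
    have e3 := sqrt_mul_le_pi (t := 2 * v) hk (by linarith)
    have hs := sqrt_nonneg k
    have e4 : √k * ((t + u + v) / 2) < π := by linarith [pi_pos]
    have := pow_lt_pow_left₀ e4 (by positivity) two_ne_zero
    rwa [mul_pow, sq_sqrt hk.le] at this

theorem four_mul_sq_le_of_cs_nonneg {k t : ℝ} (ht : 0 ≤ t) (h : k * t ^ 2 ≤ π ^ 2)
    (hcs : 0 ≤ cs k t) : 4 * (k * t ^ 2) ≤ π ^ 2 := by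
  rcases le_or_gt k 0 with hk | hk
  · nlinarith [sq_nonneg t, sq_nonneg π]
  · rw [cs_pos_curv hk] at hcs
    have e1 := sqrt_mul_le_pi hk h
    have e2 : √k * t ≤ π / 2 := by
      by_contra! hcon
      linarith [cos_neg_of_pi_div_two_lt_of_lt hcon (by linarith [pi_pos])]
    have e3 := pow_le_pow_left₀ (mul_nonneg (sqrt_nonneg k) ht) e2 2
    rw [mul_pow, sq_sqrt hk.le] at e3
    linarith

theorem four_mul_sq_le_of_le {k t u : ℝ} (ht : 0 ≤ t) (htu : t ≤ u)
    (h : 4 * (k * u ^ 2) ≤ π ^ 2) : 4 * (k * t ^ 2) ≤ π ^ 2 := by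
  have := mul_sq_le_of_le (k := 4 * k) ht htu (by linarith)
  linarith

/-- Two ways to compare the height of a point on a cevian. -/
theorem sn_mul_md_sub (k h h' x : ℝ) :
    sn k (h - x) * md k h' - (sn k (h - x) * md k x + sn k x * md k (h - x)) =
      sn k h * md k (h' - x) - sn k x * md k (h' - h) := by
  rw [sn_sub, md_sub, md_sub, md_sub, cs_eq, cs_eq]
  linear_combination sn k h * sn_sq k x

section CAT

variable {X : Type*} [MetricSpace X] {k : ℝ}

theorem IsGeodesic.dist_left {γ : ℝ → X} {x y : X} (h : IsGeodesic γ x y) {t : ℝ} (ht : 0 ≤ t)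
    (ht' : t ≤ dist x y) : dist x (γ t) = t := by
  have := h.2.2 0 ⟨le_rfl, dist_nonneg⟩ t ⟨ht, ht'⟩
  rwa [h.1, zero_sub, abs_neg, abs_of_nonneg ht] at this

theorem IsGeodesic.dist_right {γ : ℝ → X} {x y : X} (h : IsGeodesic γ x y) {t : ℝ} (ht : 0 ≤ t)
    (ht' : t ≤ dist x y) : dist y (γ t) = dist x y - t := by
  have := h.2.2 (dist x y) ⟨dist_nonneg, le_rfl⟩ t ⟨ht, ht'⟩
  rwa [h.2.1, abs_of_nonneg (by linarith)] at this

/-- The distance from `B` to a point of the segment `AD` in a `CAT(k)` space. -/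
theorem IsCAT.exists_dist_le (hX : IsCAT X k) {A B D : X} {γ : ℝ → X} (hγ : IsGeodesic γ A D)
    (h1 : 4 * (k * dist A D ^ 2) ≤ π ^ 2) (h2 : 4 * (k * dist B D ^ 2) ≤ π ^ 2)
    (h3 : 4 * (k * dist B A ^ 2) ≤ π ^ 2) (hpos : 0 < dist A D) {t : ℝ} (ht : 0 ≤ t)
    (ht' : t ≤ dist A D) :
    ∃ r, dist B (γ t) ≤ r ∧ 0 ≤ cs k r ∧ k * r ^ 2 ≤ π ^ 2 ∧
      sn k (dist A D - t) * md k (dist B A) + sn k t * md k (dist B D) =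
        sn k (dist A D) * md k r +
          (sn k (dist A D - t) * md k t + sn k t * md k (dist A D - t)) := by
  have h := isModel_modelPlane k
  have hper := perimeter_lt dist_nonneg dist_nonneg dist_nonneg h1 h2 h3
  obtain ⟨B', A', D', t1, t2, t3⟩ := h.triangle_exists (dist A D) (dist B D) (dist B A)
    dist_nonneg dist_nonneg dist_nonneg
    (by linarith [dist_triangle A B D, dist_comm A B]) (by linarith [dist_triangle B A D])
    (by linarith [dist_triangle B D A, dist_comm A D]) hper.le
  have hk1 : k * dist A D ^ 2 < π ^ 2 := by
    refine mul_sq_lt_of_le dist_nonneg ?_ hper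
    linarith [dist_triangle A B D, dist_comm A B]
  obtain ⟨Q, q1, q2, -, q3⟩ := h.exists_point B' A' D' (p := t) (q := dist A D - t) ht
    (by linarith) (by rw [t1]; ring) (by rwa [t1]) (by rwa [t1])
  have hle := hX.comparison B A D γ (coe_lt_two_mul_modelDiam hper) hγ B' A' D' Q ⟨t1, t2, t3⟩ t
    ⟨ht, ht'⟩ (by rw [q1, hγ.dist_left ht ht']) (by rw [h.d_comm, q2, hγ.dist_right ht ht'])
  have hq := q3 B'
  rw [h.d_comm A' B', h.d_comm D' B', h.d_comm Q B', t1, t2, t3] at hq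
  refine ⟨_, hle, ?_, h.d_le _ _, by linarith⟩
  have hs := sn_pos hpos hk1
  have e1 := sn_nonneg ht (mul_sq_le_of_le ht ht' hk1.le)
  have e2 := sn_nonneg (k := k) (sub_nonneg.2 ht')
    (mul_sq_le_of_le (sub_nonneg.2 ht') (by linarith) hk1.le)
  have e3 := mul_nonneg e2 (cs_nonneg dist_nonneg h3)
  have e4 := mul_nonneg e1 (cs_nonneg dist_nonneg h2)
  refine nonneg_of_mul_nonneg_right (a := sn k (dist A D)) ?_ hs
  have e5 := seg_sum k t (dist A D - t)
  rw [add_sub_cancel] at e5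
  -- The cosine of the comparison distance is a nonnegative combination of the cosines of two sides
  -- at most D_k / 2, so it is nonnegative.
  have e6 : sn k (dist A D) * cs k ((modelPlane k).d B' Q) =
      sn k (dist A D - t) * cs k (dist B A) + sn k t * cs k (dist B D) := by
    rw [cs_eq, cs_eq, cs_eq]
    linear_combination k * hq - e5
  rw [e6]
  exact add_nonneg e3 e4

theorem g_le (A B C P : X) : g A B C ≤ dist A P + dist B P + dist C P :=
  ciInf_le ⟨0, by rintro _ ⟨x, rfl⟩; positivity⟩ P

/-- In a `CAT(k)` space the minimum of the sum of distances is at most that of the comparison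
triangle. -/
theorem IsCAT.g_le_steiner (hX : IsCAT X k) {A B C : X} {a b c : ℝ} (ha : dist B C = a)
    (hb : dist A C = b) (hc : dist A B = c) (hnd : Nondeg a b c k)
    (hab : steiner a b c k < a + b) (hac : steiner a b c k < a + c)
    (hbc : steiner a b c k < b + c) (ka : 4 * (k * a ^ 2) ≤ π ^ 2)
    (kb : 4 * (k * b ^ 2) ≤ π ^ 2) (kc : 4 * (k * c ^ 2) ≤ π ^ 2) :
    g A B C ≤ steiner a b c k := by
  have h := isModel_modelPlane k
  obtain ⟨A', B', C', P', l, m, j, n, E, hT, -, hS, hF⟩ := exists_fermat hnd hab hac hbc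
  obtain ⟨D', ρ, E₁, hD, hP, hρ, hcomb⟩ := h.exists_cevian hnd hT hF.l_pos.le hF.m_pos.le
    hF.j_pos.le (add_pos hF.m_pos hF.j_pos) hF.n_pos hF.comb
  obtain ⟨-, kh'⟩ := h.cevian_bounds hnd hT hD
  obtain ⟨-, n2, n3, -⟩ := h.comb_cs hF.comb
  obtain ⟨hD1, hD2, -, -⟩ := h.comb_values hcomb
  have hDP := hcomb.2 P'
  have hρE := hcomb.1
  have hm := hF.m_pos
  have hj := hF.j_pos
  have hmj := hF.mj
  have hl := hF.l_pos
  have hn := hF.n_pos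
  have hy := hF.PB
  have hz := hF.PC
  have hx := hF.PA
  have ky := hF.kB
  have kz := hF.kC
  obtain ⟨t1, t2, t3⟩ := id hT
  unfold Plane.Between at hD hP
  rw [t1] at hD
  rw [h.d_comm A' P'] at hP
  have hp0 := h.d_nonneg B' D'
  have hq0 := h.d_nonneg D' C'
  have hh'0 := h.d_nonneg A' D'
  have hPD := h.d_nonneg P' D'
  rw [t2, t3, h.d_comm D' A'] at hD2
  rw [h.d_comm D' B'] at hD1
  rw [h.d_comm B' P', h.d_comm C' P', h.d_comm D' P'] at hDP
  rw [t1, t3] at n2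
  rw [t1, t2] at n3
  obtain ⟨γ, hγ⟩ := hX.geodesic B C
  have hle := hX.comparison A B C γ
    (coe_lt_two_mul_modelDiam (by rw [ha, hb, hc]; exact hnd.perim)) hγ A' B' C' D'
    (by rw [ha, hb, hc]; exact hT) ((modelPlane k).d B' D') ⟨hp0, by linarith⟩
    (by rw [hγ.dist_left hp0 (by linarith)])
    (by rw [hγ.dist_right hp0 (by linarith), h.d_comm, ha]; linarith)
  have hdB := hγ.dist_left hp0 (by linarith)
  have hdC := hγ.dist_right hp0 (by linarith)
  generalize γ ((modelPlane k).d B' D') = D at hle hdB hdC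
  replace hdC : dist C D = (modelPlane k).d D' C' := by linarith
  rw [hS]
  generalize (modelPlane k).d P' A' = x at *
  generalize (modelPlane k).d P' B' = y at *
  generalize (modelPlane k).d P' C' = z at *
  generalize (modelPlane k).d B' D' = p at *
  generalize (modelPlane k).d D' C' = q at *
  generalize (modelPlane k).d P' D' = w at *
  generalize (modelPlane k).d A' D' = h' at *
  have ca := cs_nonneg hnd.a_pos.le ka
  have cb := cs_nonneg hnd.b_pos.le kb
  have cc := cs_nonneg hnd.c_pos.le kc
  have cy : 0 ≤ cs k y := nonneg_of_mul_nonneg_right (a := n) (by rw [n2]; positivity) hn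
  have cz : 0 ≤ cs k z := nonneg_of_mul_nonneg_right (a := n) (by rw [n3]; positivity) hn
  have ch' : 0 ≤ cs k h' := by
    have : ρ * cs k h' = m * cs k c + j * cs k b := by
      simp only [cs_eq]; linear_combination k * hD2 - hρE
    exact nonneg_of_mul_nonneg_right (a := ρ) (by rw [this]; positivity) hρ
  have kh'4 := four_mul_sq_le_of_cs_nonneg hh'0 kh'.le ch'
  have kp := four_mul_sq_le_of_le (k := k) hp0 (by linarith) ka
  have kq := four_mul_sq_le_of_le (k := k) hq0 (by linarith) ka
  have kh := four_mul_sq_le_of_le (k := k) dist_nonneg hle kh'4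
  have key : ∀ {P : X} {r s : ℝ}, dist A P ≤ x → dist B P ≤ r → dist C P ≤ s → 0 ≤ cs k r →
      0 ≤ cs k s → k * r ^ 2 ≤ π ^ 2 → k * s ^ 2 ≤ π ^ 2 →
      -- The tangent lines of `md` at y and z, weighted by m and j, have the same slope since m sn y
      -- = j sn z. The weighted bound thus becomes r + s ≤ y + z.
      m * md k r + j * md k s ≤ m * md k y + j * md k z → g A B C ≤ x + y + z := by
    intro P r s hA hB hC cr cs' kr ks hmd
    have i1 := md_tangent hy.le (dist_nonneg.trans hB) cy cr ky.le kr
    have i2 := md_tangent hz.le (dist_nonneg.trans hC) cz cs' kz.le ks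
    have i3 := mul_le_mul_of_nonneg_left i1 hm.le
    have i4 := mul_le_mul_of_nonneg_left i2 hj.le
    have i5 : m * sn k y * (r + s - (y + z)) ≤ 0 := by
      linear_combination i3 + i4 + hmd + (s - z) * hmj
    have i6 := nonpos_of_mul_nonpos_right i5 (mul_pos hm (sn_pos hy ky))
    linarith [g_le A B C P]
  -- If AD reaches length x, the competitor lies on AD at distance x from A. Otherwise D itself
  -- works, being closer to A than x.
  rcases le_or_gt x (dist A D) with hxh | hxh
  · obtain ⟨γ₂, hγ₂⟩ := hX.geodesic A D
    have hpos : 0 < dist A D := hx.trans_le hxh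
    obtain ⟨r, r1, r2, r3, r4⟩ := hX.exists_dist_le hγ₂ kh (B := B) (by rwa [hdB])
      (by rwa [dist_comm, hc]) hpos hx.le hxh
    obtain ⟨s, s1, s2, s3, s4⟩ := hX.exists_dist_le hγ₂ kh (B := C) (by rwa [hdC])
      (by rwa [dist_comm, hb]) hpos hx.le hxh
    refine key (hγ₂.dist_left hx.le hxh).le r1 s1 r2 s2 r3 s3 ?_
    rw [dist_comm B A, hc, hdB] at r4
    rw [dist_comm C A, hb, hdC] at s4
    have e5 := seg_sum k x (dist A D - x)
    rw [add_sub_cancel] at e5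
    have e6 := sn_mul_md_sub k (dist A D) h' x
    have hkh : k * dist A D ^ 2 < π ^ 2 := mul_sq_lt_of_le dist_nonneg hle kh'
    have e7 : 0 ≤ ρ * (sn k x * md k (h' - dist A D)) := mul_nonneg hρ.le <|
      mul_nonneg (sn_nonneg hx.le (mul_sq_le_of_le hx.le hxh hkh.le)) (md_nonneg _ _)
    rw [show w = h' - x by linarith] at hDP
    -- Both sides are expressed by Stewart-type relations on AD and A'D'. After multiplication by sn
    -- of d(A,D), their difference is ρ sn x · md(h' - d(A,D)) ≥ 0, the term `e7`.
    refine le_of_mul_le_mul_left ?_ (sn_pos hpos hkh)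
    linear_combination e7 - m * r4 - j * s4 + sn k (dist A D - x) * hD2 - sn k x * hD1 -
      (sn k (dist A D - x) * md k x + sn k x * md k (dist A D - x)) * hρE + ρ * e6 + E₁ * e5 -
      sn k (dist A D) * hDP
  · refine key (P := D) hxh.le hdB.le hdC.le (cs_nonneg hp0 kp) (cs_nonneg hq0 kq)
      (mul_sq_le_of_le hp0 (by linarith) hnd.ka.le) (mul_sq_le_of_le hq0 (by linarith) hnd.ka.le) ?_
    linarith [mul_nonneg hρ.le (md_nonneg k w)]

end CAT

end

/-! ### Curvature of a triple -/

section

theorem four_mul_sq_le_of_le_sideBound {k t : ℝ} (ht : 0 ≤ t) (h : (t : EReal) ≤ sideBound k) :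
    4 * (k * t ^ 2) ≤ π ^ 2 := by
  rcases le_or_gt k 0 with hk | hk
  · nlinarith [sq_nonneg t, sq_nonneg π]
  · have hs := sqrt_pos.2 hk
    rw [sideBound, if_pos hk, EReal.coe_le_coe_iff, le_div_iff₀ (by positivity)] at h
    have := pow_le_pow_left₀ (by positivity) h 2
    rw [mul_pow, mul_pow, sq_sqrt hk.le] at this
    linarith

/-- With c = a + b the defining equation contradicts the addition formula for cosh, whose sinh term
has coefficient 1 instead of 1/2. The supremum of the empty set is -∞. -/
theorem lambda_of_degenerate {a b c : ℝ} (ha : 0 < a) (hb : 0 < b) (hc : 0 < c)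
    (h : max a (max b c) = (a + b + c) / 2) : lambda a b c = ⊥ := by
  unfold lambda
  have m1 : min a (min b c) ≤ a := min_le_left _ _
  have m2 : min a (min b c) ≤ b := (min_le_right _ _).trans (min_le_left _ _)
  have m3 : min a (min b c) ≤ c := (min_le_right _ _).trans (min_le_right _ _)
  have hx : 0 < min a (min b c) := lt_min ha (lt_min hb hc)
  rw [h]
  set x := min a (min b c)
  obtain ⟨y, hy⟩ : ∃ y, y = a + b + c - x - (a + b + c) / 2 := ⟨_, rfl⟩
  rw [← hy, show (a + b + c) / 2 = x + y by linarith]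
  have hy0 : 0 < y := by linarith
  have hxy := mul_pos hx hy0
  have hset : {k : ℝ | k < 0 ∧
      cosh ((x + y) * √(-k)) = cosh (x * √(-k)) * cosh (y * √(-k))
        + 1 / 2 * (sinh (x * √(-k)) * sinh (y * √(-k)))} = ∅ := by
    rw [Set.eq_empty_iff_forall_notMem]
    rintro k ⟨hk, heq⟩
    have hs : 0 < √(-k) := sqrt_pos.2 (by linarith)
    rw [add_mul, cosh_add] at heq
    have := mul_pos (sinh_pos_iff.2 (mul_pos hx hs)) (sinh_pos_iff.2 (mul_pos hy0 hs))
    linarith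
  rw [lambdaOrdered, if_neg (by nlinarith), if_neg (by nlinarith), hset, Set.image_empty]
  exact _root_.sSup_empty

/-- The vertex between the other two attains the lower bound given by the triangle inequality.
Negative k is enough, as the value is used only in the limit at -∞. -/
theorem steiner_of_degenerate {a b c k : ℝ} (ha : 0 ≤ a) (hb : 0 ≤ b) (hc : 0 ≤ c)
    (h : a = b + c ∨ b = a + c ∨ c = a + b) (hk : k < 0) : steiner a b c k = (a + b + c) / 2 := by
  have hM := isModel_modelPlane k
  obtain ⟨A, B, C, hT⟩ := hM.triangle_exists a b c ha hb hc
    (by rcases h with h | h | h <;> linarith) (by rcases h with h | h | h <;> linarith)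
    (by rcases h with h | h | h <;> linarith)
    (by nlinarith [sq_nonneg ((a + b + c) / 2), sq_nonneg π])
  refine IsLeast.csInf_eq ⟨?_, ?_⟩
  · obtain ⟨t1, t2, t3⟩ := id hT
    have sA := hM.d_self A
    have sB := hM.d_self B
    have sC := hM.d_self C
    rcases h with h | h | h
    · refine ⟨A, B, C, A, hT, ⟨B, ?_, ?_⟩, ?_⟩ <;> try unfold Plane.Between
      all_goals linarith
    · refine ⟨A, B, C, B, hT, ⟨B, ?_, ?_⟩, ?_⟩ <;> try unfold Plane.Between
      all_goals linarith [hM.d_comm A B]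
    · refine ⟨A, B, C, C, hT, ⟨C, ?_, ?_⟩, ?_⟩ <;> try unfold Plane.Between
      all_goals linarith [hM.d_comm A C, hM.d_comm B C]
  · rintro s ⟨A, B, C, P, ⟨t1, t2, t3⟩, -, rfl⟩
    have e1 := hM.d_triangle A P B
    have e2 := hM.d_triangle A P C
    have e3 := hM.d_triangle B P C
    rw [hM.d_comm A P] at e1 e2
    rw [hM.d_comm B P] at e3
    linarith

section MetricSpaces

variable {X : Type*} [MetricSpace X] (A B C : X)

theorem half_perimeter_le_g : (dist B C + dist A C + dist A B) / 2 ≤ g A B C := by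
  have : Nonempty X := ⟨A⟩
  refine le_ciInf fun x => ?_
  linarith [dist_triangle_right A B x, dist_triangle_right A C x, dist_triangle_right B C x]

theorem g_le_at_left : g A B C ≤ dist A C + dist A B := by
  have := g_le A B C A
  rw [dist_self, dist_comm B A, dist_comm C A] at this
  linarith

theorem g_le_at_middle : g A B C ≤ dist B C + dist A B := by
  have := g_le A B C B
  rw [dist_self, dist_comm C B] at this
  linarith

theorem g_le_at_right : g A B C ≤ dist B C + dist A C := by
  have := g_le A B C C
  rw [dist_self] at this
  linarith

end MetricSpaces

variable {X : Type*} [MetricSpace X] {A B C : X}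

/-- A degenerate triple has curvature `-∞`. -/
theorem isTripleCurvature_iff_of_degenerate (hAB : A ≠ B) (hAC : A ≠ C) (hBC : B ≠ C)
    (h : dist B C = dist A C + dist A B ∨ dist A C = dist B C + dist A B ∨
      dist A B = dist B C + dist A C) (κ : EReal) : IsTripleCurvature A B C κ ↔ κ = ⊥ := by
  have ha := dist_pos.2 hBC
  have hb := dist_pos.2 hAC
  have hc := dist_pos.2 hAB
  have hlam : lambda (dist B C) (dist A C) (dist A B) = ⊥ := by
    apply lambda_of_degenerate ha hb hc
    rcases h with h | h | h
    · rw [max_eq_left (max_le (by linarith) (by linarith))]; linarith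
    · rw [max_eq_left (a := dist A C) (by linarith), max_eq_right (by linarith)]; linarith
    · rw [max_eq_right (a := dist A C) (by linarith), max_eq_right (by linarith)]; linarith
  refine ⟨fun hκ => le_bot_iff.1 (hlam ▸ hκ.1), ?_⟩
  rintro rfl
  refine ⟨bot_le, Or.inr ⟨rfl, ?_⟩⟩
  have hg : g A B C = (dist B C + dist A C + dist A B) / 2 := by
    refine le_antisymm ?_ (half_perimeter_le_g A B C)
    rcases h with h | h | h
    · linarith [g_le_at_left A B C]
    · linarith [g_le_at_middle A B C]
    · linarith [g_le_at_right A B C]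
  rw [hg]
  refine tendsto_const_nhds.congr' ?_
  filter_upwards [eventually_lt_atBot (0 : ℝ)] with k hk
  exact (steiner_of_degenerate ha.le hb.le hc.le h hk).symm

/-- A bound of `g` by a value of `steiner` bounds the curvature. -/
theorem exists_unique_tripleCurvature {L k : ℝ} (hL : Core (dist B C) (dist A C) (dist A B) L)
    (hk : k ≤ L) (hg : g A B C ≤ steiner (dist B C) (dist A C) (dist A B) k) :
    ∃ κ : EReal, IsTripleCurvature A B C κ ∧ (∀ κ', IsTripleCurvature A B C κ' → κ' = κ) ∧
      κ ≤ (k : EReal) := by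
  have hhalf := half_perimeter_le_g A B C
  set a := dist B C with ha
  set b := dist A C with hb
  set c := dist A B with hc
  have hlt : ∀ r ≤ L, (a + b + c) / 2 < steiner a b c r := by
    intro r hr
    have h1 := half_perimeter_le_steiner (hL.nondeg.of_le (k' := r - 1) (by linarith))
    have h2 := hL.mono (Set.mem_Iic.2 (by linarith : r - 1 ≤ L)) hr (by linarith)
    exact h1.trans_lt h2
  -- Half the perimeter is the limit of S at -∞ but is not a value on (-∞, L], so this case is
  -- exactly κ = -∞.
  rcases hhalf.eq_or_lt with h0 | h0
  · refine ⟨⊥, ⟨bot_le, Or.inr ⟨rfl, h0 ▸ hL.tendsto⟩⟩, ?_, bot_le⟩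
    rintro κ' ⟨hκ, ⟨r, rfl, hr⟩ | ⟨rfl, -⟩⟩
    · rw [← ha, ← hb, ← hc, hL.lam, EReal.coe_le_coe_iff] at hκ
      exact absurd (hlt r hκ) (by rw [h0, hr]; exact lt_irrefl _)
    · rfl
  · obtain ⟨r₀, hr₀, hr₀k⟩ : ∃ r₀, steiner a b c r₀ < g A B C ∧ r₀ ≤ k :=
      ((hL.tendsto.eventually_lt_const h0).and (eventually_le_atBot k)).exists
    obtain ⟨r, ⟨-, hrk⟩, hr⟩ := intermediate_value_Icc hr₀k
      (hL.cont.mono fun x hx => hx.2.trans hk) ⟨hr₀.le, hg⟩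
    refine ⟨r, ⟨?_, Or.inl ⟨r, rfl, hr.symm⟩⟩, ?_, EReal.coe_le_coe_iff.2 hrk⟩
    · rw [← ha, ← hb, ← hc, hL.lam, EReal.coe_le_coe_iff]; exact hrk.trans hk
    · rintro κ' ⟨hκ, ⟨r', rfl, hr'⟩ | ⟨rfl, ht⟩⟩
      · rw [← ha, ← hb, ← hc, hL.lam, EReal.coe_le_coe_iff] at hκ
        rw [hL.mono.injOn hκ (Set.mem_Iic.2 (hrk.trans hk)) (hr'.symm.trans hr.symm)]
      · exact absurd (tendsto_nhds_unique ht hL.tendsto) h0.ne'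

end

end TripleCurv

end

theorem theorem5p1 {X : Type*} [MetricSpace X] (k : ℝ) (hX : TripleCurv.IsCAT X k)
    (A B C : X) (hAB : A ≠ B) (hAC : A ≠ C) (hBC : B ≠ C)
    (hT : ((max (dist A B) (max (dist A C) (dist B C)) : ℝ) : EReal) ≤ TripleCurv.sideBound k) :
    ∃ κ : EReal, TripleCurv.IsTripleCurvature A B C κ ∧
      (∀ κ' : EReal, TripleCurv.IsTripleCurvature A B C κ' → κ' = κ) ∧
      κ ≤ (k : EReal) := by
  have ha := dist_pos.2 hBC
  have hb := dist_pos.2 hAC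
  have hc := dist_pos.2 hAB
  by_cases hdeg : dist B C = dist A C + dist A B ∨ dist A C = dist B C + dist A B ∨
      dist A B = dist B C + dist A C
  · have h := TripleCurv.isTripleCurvature_iff_of_degenerate hAB hAC hBC hdeg
    exact ⟨⊥, (h ⊥).2 rfl, fun κ' => (h κ').1, bot_le⟩
  push Not at hdeg
  obtain ⟨d1, d2, d3⟩ := hdeg
  obtain ⟨L, hL⟩ := TripleCurv.exists_core ha hb hc
    (lt_of_le_of_ne (by linarith [dist_triangle_left B C A]) d1)
    (lt_of_le_of_ne (by linarith [dist_triangle A B C]) d2)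
    (lt_of_le_of_ne (by linarith [dist_triangle_right A B C]) d3)
  have hM := TripleCurv.four_mul_sq_le_of_le_sideBound (hc.le.trans (le_max_left _ _)) hT
  have ka := TripleCurv.four_mul_sq_le_of_le ha.le
    ((le_max_right _ _).trans (le_max_right _ _)) hM
  have kb := TripleCurv.four_mul_sq_le_of_le hb.le
    ((le_max_left _ _).trans (le_max_right _ _)) hM
  have kc := TripleCurv.four_mul_sq_le_of_le hc.le (le_max_left _ _) hM
  rcases lt_or_ge k L with hk | hk
  · exact TripleCurv.exists_unique_tripleCurvature hL hk.le <|
      hX.g_le_steiner rfl rfl rfl (hL.nondeg.of_le hk.le) (hL.lt_ab k hk) (hL.lt_ac k hk)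
        (hL.lt_bc k hk) ka kb kc
  -- When Λ ≤ k no comparison is needed: short sides for k are short for Λ, so g is at most S at Λ
  -- and κ ≤ Λ ≤ k.
  · have hle : ∀ t : ℝ, 4 * (k * t ^ 2) ≤ Real.pi ^ 2 → 4 * (L * t ^ 2) ≤ Real.pi ^ 2 :=
      fun t ht => (by nlinarith [sq_nonneg t] : 4 * (L * t ^ 2) ≤ 4 * (k * t ^ 2)).trans ht
    obtain ⟨κ, h1, h2, h3⟩ := TripleCurv.exists_unique_tripleCurvature hL le_rfl <|
      hL.top _ (TripleCurv.g_le_at_right A B C) (TripleCurv.g_le_at_middle A B C)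
        (TripleCurv.g_le_at_left A B C) (hle _ ka) (hle _ kb) (hle _ kc)
    exact ⟨κ, h1, h2, h3.trans (EReal.coe_le_coe_iff.2 hk)⟩
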